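/- **Conventions.** Let $p$ be a prime, $\mathbb F_p=\mathbb Z/p$, and $K=\overline{\mathbb F}_p$ an algebraic closure of $\mathbb F_p$. All complexes are cochain complexes; operads are symmetric operads of such complexes, and an algebra over an operad $\mathcal E$ is a complex $A$ with a morphism of operads from $\mathcal E$ to the endomorphism operad of $A$. An $E_\infty$-operad over a field $k$ is an operad $\mathcal E$ such that each $\mathcal E(n)$ is a projective resolution of the trivial $k[\Sigma_n]$-module $k$ (in cohomological degrees $\le 0$), by augmentations $\mathcal E(n)\to k$ that are compatible with the operad structure. For a simplicial set $X$, $C^*(X,k)$ is the complex of normalized simplicial cochains (for $X$ the singular simplicial set of a space this is $C^*_{\mathrm{sing}}$). The Eilenberg–Zilber operad $\mathcal Z_k$ is the operad of natural multilinear operations on the normalized cochains of simplices: an element of $\mathcal Z_k(n)$ of degree $d$ is a family of multilinear operations $C^*(\Delta^m,k)^{\times n}\to C^*(\Delta^m,k)$ of degree $d$ that is natural in $\Delta^m$. It acts on $C^*(X,k)$, naturally in $X$. Extending operations $K$-multilinearly gives a morphism $\mathcal Z_{\mathbb F_p}\otimes_{\mathbb F_p} K\to\mathcal Z_K$ of operads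 over $K$. **Data.** Let $\mathcal E$ be an $E_\infty$-operad over $\mathbb F_p$ with a morphism of operads $\zeta:\mathcal E\to\mathcal Z_{\mathbb F_p}$, let $\mathcal E'$ be an $E_\infty$-operad over $K$ with a morphism of operads $\zeta':\mathcal E'\to\mathcal Z_K$, and let $\varphi:\mathcal E\otimes_{\mathbb F_p}K\to\mathcal E'$ be an isomorphism of operads over $K$ that is compatible with these morphisms, that is, $\zeta'\circ\varphi$ is the composite $\mathcal E\otimes K\xrightarrow{\zeta\otimes K}\mathcal Z_{\mathbb F_p}\otimes K\to\mathcal Z_K$. Cochains of simplicial sets are algebras over $\mathcal E$ and $\mathcal E'$ by means of $\zeta$ and $\zeta'$. Let $X$ be a simplicial set. *First structure.* The $\mathcal E$-algebra $C^*(X,\mathbb F_p)$ gives an $(\mathcal E\otimes K)$-algebra $C^*(X,\mathbb F_p)\otimes_{\mathbb F_p}K$, and hence, through $\varphi^{-1}$, an $\mathcal E'$-algebra structure $S_1$ on $C^*(X,\mathbb F_p)\otimes_{\mathbb F_p}K$. *Second structure.* Let $X\to X_\alpha$ run through the quotients of $X$ that have finitely many simplices in each dimension. There are maps of complexes $$\ell_\alpha:\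 C^*(X_\alpha,K)\ \cong\ C^*(X_\alpha,\mathbb F_p)\otimes_{\mathbb F_p}K\ \longrightarrow\ C^*(X,\mathbb F_p)\otimes_{\mathbb F_p}K .$$ An $\mathcal E'$-algebra structure on $C^*(X,\mathbb F_p)\otimes_{\mathbb F_p}K$ is called a *colimit structure* if all $\ell_\alpha$ are maps of $\mathcal E'$-algebras for it and exhibit it as the colimit of the $\mathcal E'$-algebras $C^*(X_\alpha,K)$. **Lemma.** The maps $\ell_\alpha$ exhibit $C^*(X,\mathbb F_p)\otimes_{\mathbb F_p}K$ as the colimit of the complexes $C^*(X_\alpha,K)$. Moreover there is exactly one colimit structure on $C^*(X,\mathbb F_p)\otimes_{\mathbb F_p}K$, and it coincides with $S_1$: an $\mathcal E'$-algebra structure $S$ is a colimit structure if and only if $S=S_1$. -/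

import Mathlib

universe u v w w'

open CategoryTheory Opposite DirectSum TensorProduct

noncomputable section

namespace EInf

set_option linter.unusedVariables false

/-! ### Signs -/

/-- The image in `k` of a sign `±1`. -/
def sc (k : Type*) [CommRing k] : ℤˣ →* k :=
  (Int.castRingHom k : ℤ →* k).comp (Units.coeHom ℤ)

lemma sc_map {k K : Type*} [CommRing k] [CommRing K] (φ : k →+* K) (u : ℤˣ) :
    φ (sc k u) = sc K u := by simp [sc]

lemma sc_mul_self {k : Type*} [CommRing k] (u : ℤˣ) : sc k u * sc k u = 1 := by
  rw [← map_mul, Int.units_mul_self, map_one]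

lemma sc_smul_self {k : Type*} [CommRing k] {M : Type*} [AddCommGroup M] [Module k M]
    (u : ℤˣ) (x : M) : sc k u • sc k u • x = x := by
  rw [smul_smul, sc_mul_self, one_smul]

/-- The scalar `(-1)^d`. -/
abbrev sg (k : Type*) [CommRing k] (d : ℤ) : k := sc k d.negOnePow

lemma sg_add {k : Type*} [CommRing k] (a b : ℤ) : sg k (a + b) = sg k a * sg k b := by
  simp [sg, Int.negOnePow_add]

/-- The product of `w x y` over all pairs `x < y`. -/
def pairProd {ι : Type*} [Fintype ι] [LinearOrder ι] {M : Type*} [CommMonoid M]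
    (w : ι → ι → M) : M :=
  ∏ x : ι × ι with x.1 < x.2, w x.1 x.2

lemma pairProd_mul {ι : Type*} [Fintype ι] [LinearOrder ι] {M : Type*} [CommMonoid M]
    (w w' : ι → ι → M) : pairProd (fun x y => w x y * w' x y) = pairProd w * pairProd w' :=
  Finset.prod_mul_distrib

lemma pairProd_congr {ι : Type*} [Fintype ι] [LinearOrder ι] {M : Type*} [CommMonoid M]
    {w w' : ι → ι → M} (h : ∀ x y, x < y → w x y = w' x y) : pairProd w = pairProd w' :=
  Finset.prod_congr rfl fun x hx => h _ _ (by simpa using hx)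

lemma pairProd_reindex {ι ι' : Type*} [Fintype ι] [LinearOrder ι] [Fintype ι'] [LinearOrder ι']
    {M : Type*} [CommMonoid M] (e : ι ≃ ι') (w : ι' → ι' → M) (hw : ∀ x y, w x y = w y x) :
    pairProd w = pairProd (fun x y => w (e x) (e y)) := by
  symm
  refine Finset.prod_bij' (fun x _ => if e x.1 < e x.2 then (e x.1, e x.2) else (e x.2, e x.1))
    (fun y _ => if e.symm y.1 < e.symm y.2 then (e.symm y.1, e.symm y.2)
      else (e.symm y.2, e.symm y.1)) ?_ ?_ ?_ ?_ ?_
  · rintro ⟨x, y⟩ h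
    have hne : e x ≠ e y := fun h' => by simp [e.injective h'] at h
    by_cases h1 : e x < e y
    · simp [h1]
    · simp [h1, lt_of_le_of_ne (not_lt.1 h1) hne.symm]
  · rintro ⟨x, y⟩ h
    have hne : e.symm x ≠ e.symm y := fun h' => by simp [e.symm.injective h'] at h
    by_cases h1 : e.symm x < e.symm y
    · simp [h1]
    · simp [h1, lt_of_le_of_ne (not_lt.1 h1) hne.symm]
  · rintro ⟨x, y⟩ h
    have h : x < y := by simpa using h
    by_cases h1 : e x < e y
    · simp [h1, h]
    · simp [h1, h.not_gt]
  · rintro ⟨x, y⟩ h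
    have h : x < y := by simpa using h
    by_cases h1 : e.symm x < e.symm y
    · simp [h1, h]
    · simp [h1, h.not_gt]
  · rintro ⟨x, y⟩ h
    by_cases h1 : e x < e y
    · simp [h1]
    · simp [h1, hw (e x)]

lemma pairProd_sum {α β : Type*} [Fintype α] [LinearOrder α] [Fintype β] [LinearOrder β]
    {M : Type*} [CommMonoid M] {ι : Type*} [Fintype ι] [LinearOrder ι] (e : α ⊕ β ≃ ι)
    (w : ι → ι → M) (hw : ∀ x y, w x y = w y x) :
    pairProd w = pairProd (fun x y => w (e (.inl x)) (e (.inl y))) *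
      pairProd (fun x y => w (e (.inr x)) (e (.inr y))) *
      ∏ x : α, ∏ y : β, w (e (.inl x)) (e (.inr y)) := by
  rw [pairProd_reindex (ofLex.trans e) w hw]
  simp only [pairProd, Finset.prod_filter, Fintype.prod_prod_type]
  rw [← (toLex (α := α ⊕ β)).prod_comp]
  simp_rw [← (toLex (α := α ⊕ β)).prod_comp]
  simp [Fintype.prod_sum_type, Finset.prod_mul_distrib]
  rw [mul_right_comm, mul_assoc]

/-- The Koszul sign of the permutation `σ` of homogeneous elements of degrees `p`: a factor
`(-1)^(p i * p j)` for every inversion `i < j`, `σ j < σ i`. -/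
def koszul {n : ℕ} (σ : Equiv.Perm (Fin n)) (p : Fin n → ℤ) : ℤˣ :=
  pairProd fun i j => if σ j < σ i then (p i * p j).negOnePow else 1

/-- symmetric form of the factors of the Koszul sign -/
def kw {n : ℕ} (σ : Equiv.Perm (Fin n)) (p : Fin n → ℤ) (i j : Fin n) : ℤˣ :=
  (if i < j then (p i * p j).negOnePow else 1) * (if σ i < σ j then (p i * p j).negOnePow else 1)

lemma kw_symm {n : ℕ} (σ : Equiv.Perm (Fin n)) (p : Fin n → ℤ) (i j : Fin n) :
    kw σ p i j = kw σ p j i := by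
  by_cases h0 : i = j
  · rw [h0]
  have h := h0
  have h2 : σ i ≠ σ j := σ.injective.ne h
  unfold kw
  rcases lt_or_gt_of_ne h with h | h <;> rcases lt_or_gt_of_ne h2 with h2 | h2 <;>
    simp [h, h.not_gt, h2, h2.not_gt, mul_comm (p i)]

lemma koszul_eq {n : ℕ} (σ : Equiv.Perm (Fin n)) (p : Fin n → ℤ) :
    koszul σ p = pairProd (kw σ p) := by
  refine pairProd_congr fun i j h => ?_
  have h2 : σ i ≠ σ j := σ.injective.ne h.ne
  unfold kw
  rcases lt_or_gt_of_ne h2 with h2 | h2 <;> simp [h, h2, h2.not_gt, Int.units_mul_self]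

lemma koszul_one {n : ℕ} (p : Fin n → ℤ) : koszul (1 : Equiv.Perm (Fin n)) p = 1 :=
  Finset.prod_eq_one fun x hx => by
    have : x.1 < x.2 := by simpa using hx
    simp [this.not_gt]

lemma koszul_mul {n : ℕ} (σ τ : Equiv.Perm (Fin n)) (p : Fin n → ℤ) :
    koszul (σ * τ) p = koszul τ p * koszul σ (fun i => p (τ⁻¹ i)) := by
  rw [koszul_eq, koszul_eq, koszul_eq, pairProd_reindex τ (kw σ _) (kw_symm _ _),
    ← pairProd_mul]
  refine pairProd_congr fun i j h => ?_
  simp only [kw, h, Equiv.Perm.mul_apply, if_true, show ∀ x, τ⁻¹ (τ x) = x from τ.symm_apply_apply]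
  have := Int.units_mul_self (p i * p j).negOnePow
  by_cases h1 : τ i < τ j <;> by_cases h2 : σ (τ i) < σ (τ j) <;> simp [h1, h2, this]

/-- The bijection between the positions of `x ∘ᵢ y` and the positions of `x` other than `i`
together with the positions of `y`; the positions of `y` become the block starting at `i`. -/
def slotFun {m n r : ℕ} (h : m + n = r + 1) (i : Fin m) : {j : Fin m // j ≠ i} ⊕ Fin n → Fin r :=
  Sum.elim
    (fun j => if hj : j.1 < i then ⟨j.1, by have := j.1.2; have := i.2; omega⟩
      else ⟨j.1 + n - 1, by have := j.1.2; have := j.2; omega⟩)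
    (fun l => ⟨i + l, by have := i.2; have := l.2; omega⟩)

lemma slotFun_inl_val {m n r : ℕ} (h : m + n = r + 1) (i : Fin m) (j : {j : Fin m // j ≠ i}) :
    (slotFun h i (.inl j) : ℕ) = if (j.1 : ℕ) < i then (j.1 : ℕ) else j.1 + n - 1 := by
  simp only [slotFun, Sum.elim_inl, Fin.lt_def]
  split_ifs <;> rfl

lemma slotFun_inr_val {m n r : ℕ} (h : m + n = r + 1) (i : Fin m) (l : Fin n) :
    (slotFun h i (.inr l) : ℕ) = i + l := rfl

lemma slotFun_bijective {m n r : ℕ} (h : m + n = r + 1) (i : Fin m) :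
    Function.Bijective (slotFun h i) := by
  have hi := i.2
  constructor
  · rintro (a | a) (b | b) hab
    all_goals
      have hab := congrArg Fin.val hab
      have h1 := a.2; have h2 := b.2
      simp only [slotFun_inl_val, slotFun_inr_val, ne_eq, Fin.ext_iff] at hab h1 h2
    · have : a = b := Subtype.ext (Fin.ext (by split_ifs at hab <;> omega))
      rw [this]
    · exfalso; split_ifs at hab <;> omega
    · exfalso; split_ifs at hab <;> omega
    · have : a = b := Fin.ext (by omega)
      rw [this]
  · intro x
    have hx := x.2
    by_cases h1 : x.1 < i
    · refine ⟨.inl ⟨⟨x, by omega⟩, fun h => ?_⟩, Fin.ext ?_⟩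
      · have := congrArg Fin.val h; simp at this; omega
      · rw [slotFun_inl_val]; simp [h1]
    · by_cases h2 : x.1 < i + n
      · refine ⟨.inr ⟨x - i, by omega⟩, Fin.ext ?_⟩
        rw [slotFun_inr_val]; simp; omega
      · refine ⟨.inl ⟨⟨x + 1 - n, by omega⟩, fun h => ?_⟩, Fin.ext ?_⟩
        · have := congrArg Fin.val h; simp at this; omega
        · rw [slotFun_inl_val]
          have : ¬ (x.1 + 1 - n < i) := by omega
          simp only [this, if_false]; omega

/-- `slotFun` as a bijection. -/
def slot {m n r : ℕ} (h : m + n = r + 1) (i : Fin m) :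
    {j : Fin m // j ≠ i} ⊕ Fin n ≃ Fin r :=
  Equiv.ofBijective (slotFun h i) (slotFun_bijective h i)

lemma slot_inl_val {m n r : ℕ} (h : m + n = r + 1) (i : Fin m) (j : {j : Fin m // j ≠ i}) :
    (slot h i (.inl j) : ℕ) = if (j.1 : ℕ) < i then (j.1 : ℕ) else j.1 + n - 1 :=
  slotFun_inl_val h i j

lemma slot_inr_val {m n r : ℕ} (h : m + n = r + 1) (i : Fin m) (l : Fin n) :
    (slot h i (.inr l) : ℕ) = i + l := rfl

lemma slot_inl_lt {m n r : ℕ} (h : m + n = r + 1) (i : Fin m) (j j' : {j : Fin m // j ≠ i}) :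
    slot h i (.inl j) < slot h i (.inl j') ↔ j.1 < j'.1 := by
  rw [Fin.lt_def, Fin.lt_def, slot_inl_val, slot_inl_val]
  have := j.2; have := j'.2
  simp only [ne_eq, Fin.ext_iff] at *
  split_ifs <;> omega

lemma slot_inr_lt {m n r : ℕ} (h : m + n = r + 1) (i : Fin m) (l l' : Fin n) :
    slot h i (.inr l) < slot h i (.inr l') ↔ l < l' := by
  rw [Fin.lt_def, Fin.lt_def, slot_inr_val, slot_inr_val]; omega

lemma slot_inl_inr_lt {m n r : ℕ} (h : m + n = r + 1) (i : Fin m) (j : {j : Fin m // j ≠ i})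
    (l : Fin n) : slot h i (.inl j) < slot h i (.inr l) ↔ j.1 < i := by
  rw [Fin.lt_def, Fin.lt_def, slot_inl_val, slot_inr_val]
  have := j.2; have := l.2
  simp only [ne_eq, Fin.ext_iff] at *
  split_ifs <;> omega

lemma slot_inr_inl_lt {m n r : ℕ} (h : m + n = r + 1) (i : Fin m) (j : {j : Fin m // j ≠ i})
    (l : Fin n) : slot h i (.inr l) < slot h i (.inl j) ↔ i < j.1 := by
  rw [Fin.lt_def, Fin.lt_def, slot_inl_val, slot_inr_val]
  have := j.2; have := l.2
  simp only [ne_eq, Fin.ext_iff] at *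
  split_ifs <;> omega

/-- The permutation `σ ∘ᵢ τ`: it permutes the block inserted at `i` by `τ`, and then the `m`
entries, one of which is this block, by `σ`. -/
def blockPerm {m n r : ℕ} (h : m + n = r + 1) (i : Fin m) (σ : Equiv.Perm (Fin m))
    (τ : Equiv.Perm (Fin n)) : Equiv.Perm (Fin r) :=
  (slot h i).symm.trans
    ((Equiv.sumCongr (σ.subtypeEquiv (q := fun j => j ≠ σ i) fun _ => σ.injective.ne_iff.symm) τ).trans (slot h (σ i)))

lemma blockPerm_inl {m n r : ℕ} (h : m + n = r + 1) (i : Fin m) (σ : Equiv.Perm (Fin m))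
    (τ : Equiv.Perm (Fin n)) (j : {j : Fin m // j ≠ i}) :
    blockPerm h i σ τ (slot h i (.inl j)) =
      slot h (σ i) (.inl ⟨σ j.1, σ.injective.ne j.2⟩) := by
  simp [blockPerm, Equiv.subtypeEquiv]

lemma blockPerm_inr {m n r : ℕ} (h : m + n = r + 1) (i : Fin m) (σ : Equiv.Perm (Fin m))
    (τ : Equiv.Perm (Fin n)) (l : Fin n) :
    blockPerm h i σ τ (slot h i (.inr l)) = slot h (σ i) (.inr (τ l)) := by
  simp [blockPerm]

lemma koszul_split {m n r : ℕ} (h : m + n = r + 1) (i : Fin m) (σ : Equiv.Perm (Fin m))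
    (τ : Equiv.Perm (Fin n)) (p : Fin r → ℤ) :
    koszul (blockPerm h i σ τ) p =
      pairProd (fun j j' : {j : Fin m // j ≠ i} =>
        if σ j'.1 < σ j.1 then (p (slot h i (.inl j)) * p (slot h i (.inl j'))).negOnePow else 1) *
      koszul τ (fun l => p (slot h i (.inr l))) *
      ∏ j : {j : Fin m // j ≠ i}, 
        (if j.1 < i then (p (slot h i (.inl j)) * ∑ l, p (slot h i (.inr l))).negOnePow else 1) *
        (if σ j.1 < σ i then (p (slot h i (.inl j)) * ∑ l, p (slot h i (.inr l))).negOnePow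
          else 1) := by
  rw [koszul_eq, pairProd_sum (slot h i) _ (kw_symm _ _)]
  congr 1
  · congr 1
    · refine pairProd_congr fun j j' hj => ?_
      have hj : j.1 < j'.1 := hj
      have h2 : σ j.1 ≠ σ j'.1 := σ.injective.ne hj.ne
      simp only [kw, blockPerm_inl, slot_inl_lt, hj, if_true]
      rcases lt_or_gt_of_ne h2 with h2 | h2 <;> simp [h2, h2.not_gt, Int.units_mul_self]
    · rw [koszul_eq]
      refine pairProd_congr fun j j' hj => ?_
      simp only [kw, blockPerm_inr, slot_inr_lt]
  · refine Finset.prod_congr rfl fun j _ => ?_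
    simp only [kw, blockPerm_inr, blockPerm_inl, slot_inl_inr_lt, Finset.prod_mul_distrib]
    have key : ∏ l, (p (slot h i (.inl j)) * p (slot h i (.inr l))).negOnePow =
        (p (slot h i (.inl j)) * ∑ l, p (slot h i (.inr l))).negOnePow := by
      rw [Finset.mul_sum]
      exact (map_prod (M := Multiplicative ℤ) (⟨⟨Int.negOnePow, rfl⟩, Int.negOnePow_add⟩ : Multiplicative ℤ →* ℤˣ) _ _).symm
    congr 1
    · split_ifs
      · exact key
      · simp
    · split_ifs
      · exact key
      · simp

lemma koszul_at {m : ℕ} (i : Fin m) (σ : Equiv.Perm (Fin m)) (p : Fin m → ℤ) :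
    koszul σ p =
      pairProd (fun j j' : {j : Fin m // j ≠ i} =>
        if σ j'.1 < σ j.1 then (p j.1 * p j'.1).negOnePow else 1) *
      ∏ j : {j : Fin m // j ≠ i}, 
        (if j.1 < i then (p j.1 * p i).negOnePow else 1) *
        (if σ j.1 < σ i then (p j.1 * p i).negOnePow else 1) := by
  have h1 : ∀ (i : Fin m) (j : {j : Fin m // j ≠ i}), slot (n := 1) (rfl : m + 1 = m + 1) i (.inl j) = j.1 := by
    intro i j; apply Fin.ext; rw [slot_inl_val]; split_ifs <;> simp
  have h2 : ∀ (i : Fin m) (l : Fin 1), slot (n := 1) (rfl : m + 1 = m + 1) i (.inr l) = i := by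
    intro i j; apply Fin.ext; rw [slot_inr_val]; simp
  have h3 : blockPerm (n := 1) (rfl : m + 1 = m + 1) i σ 1 = σ := by
    ext x
    obtain ⟨x | x, rfl⟩ := (slot (n := 1) (rfl : m + 1 = m + 1) i).surjective x
    · rw [blockPerm_inl, h1, h1]
    · rw [blockPerm_inr, h2, h2]
  have := koszul_split (n := 1) (rfl : m + 1 = m + 1) i σ 1 p
  rw [h3, koszul_one, mul_one] at this
  simpa only [h1, h2, Fin.sum_univ_one] using this

lemma koszul_shift {m : ℕ} (i : Fin m) (σ : Equiv.Perm (Fin m)) (p p' : Fin m → ℤ) (c : ℤ)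
    (h : ∀ j, j ≠ i → p' j = p j) (hi : p' i = p i + c) :
    koszul σ p' * (∏ j : {j : Fin m // j ≠ i}, if j.1 < i then (c * p j.1).negOnePow else 1) =
    koszul σ p * (∏ j : {j : Fin m // j ≠ i}, if σ j.1 < σ i then (c * p j.1).negOnePow else 1) := by
  rw [koszul_at i σ p, koszul_at i σ p', mul_assoc, mul_assoc, ← Finset.prod_mul_distrib,
    ← Finset.prod_mul_distrib]
  congr 1
  · exact pairProd_congr fun j j' _ => by rw [h _ j.2, h _ j'.2]
  · refine Finset.prod_congr rfl fun j _ => ?_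
    rw [h _ j.2, hi, mul_add, Int.negOnePow_add, mul_comm c]
    have := Int.units_mul_self (c * p j.1).negOnePow
    split_ifs <;> simp [mul_comm (p j.1)] <;> grind

/-! ### Operads of cochain complexes -/

/-- A (symmetric) operad in cochain complexes of `k`-modules, in terms of its partial
compositions. The grading is cohomological. -/
structure Operad (k : Type v) [CommRing k] where
  /-- the complex of operations of arity `n` -/
  obj : ℕ → CochainComplex (ModuleCat.{w} k) ℤ
  /-- the right action of the symmetric group: `act σ d x` is `x · σ` -/
  act {n : ℕ} (σ : Equiv.Perm (Fin n)) (d : ℤ) : (obj n).X d →ₗ[k] (obj n).X d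
  /-- the unit -/
  one : (obj 1).X 0
  /-- the partial composition `x ∘ᵢ y` -/
  circ {m n r : ℕ} (h : m + n = r + 1) (i : Fin m) {a b c : ℤ} (hc : a + b = c) :
    (obj m).X a →ₗ[k] (obj n).X b →ₗ[k] (obj r).X c
  act_one {n : ℕ} (d : ℤ) (x : (obj n).X d) : act 1 d x = x
  act_mul {n : ℕ} (σ τ : Equiv.Perm (Fin n)) (d : ℤ) (x : (obj n).X d) :
    act (σ * τ) d x = act τ d (act σ d x)
  d_act {n : ℕ} (σ : Equiv.Perm (Fin n)) (d d' : ℤ) (x : (obj n).X d) :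
    (obj n).d d d' (act σ d x) = act σ d' ((obj n).d d d' x)
  d_one : (obj 1).d 0 1 one = 0
  one_circ {n : ℕ} (h : 1 + n = n + 1) (i : Fin 1) {b : ℤ} (hc : 0 + b = b) (x : (obj n).X b) :
    circ h i hc one x = x
  circ_one {n : ℕ} (i : Fin n) {a : ℤ} (hc : a + 0 = a) (x : (obj n).X a) :
    circ (rfl : n + 1 = n + 1) i hc x one = x
  d_circ {m n r : ℕ} (h : m + n = r + 1) (i : Fin m) {a b c : ℤ} (hc : a + b = c)
    (hc₁ : (a + 1) + b = c + 1) (hc₂ : a + (b + 1) = c + 1) (x : (obj m).X a) (y : (obj n).X b) :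
    (obj r).d c (c + 1) (circ h i hc x y) = circ h i hc₁ ((obj m).d a (a + 1) x) y +
      sg k a • circ h i hc₂ x ((obj n).d b (b + 1) y)
  /-- `(x ∘ᵢ y) ∘ᵢ₊ⱼ z = x ∘ᵢ (y ∘ⱼ z)` -/
  circ_seq {m n l r s t : ℕ} (h₁ : m + n = r + 1) (h₂ : r + l = s + 1) (h₃ : n + l = t + 1)
    (h₄ : m + t = s + 1) (i : Fin m) (j : Fin n) {a b c ab bc abc : ℤ} (hab : a + b = ab)
    (hbc : b + c = bc) (h₅ : ab + c = abc) (h₆ : a + bc = abc)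
    (x : (obj m).X a) (y : (obj n).X b) (z : (obj l).X c) :
    circ h₂ (slot h₁ i (.inr j)) h₅ (circ h₁ i hab x y) z =
      circ h₄ i h₆ x (circ h₃ j hbc y z)
  /-- `(x ∘ᵢ y) ∘ z = ± (x ∘ⱼ z) ∘ y` for `i < j`, with `z` inserted at the position that was
  `j` in `x`, and `y` at the position that was `i` in `x` -/
  circ_par {m n l r s t : ℕ} (h₁ : m + n = r + 1) (h₂ : r + l = s + 1) (h₃ : m + l = t + 1)
    (h₄ : t + n = s + 1) (i j : Fin m) (hij : i < j) {a b c ab ac abc : ℤ} (hab : a + b = ab)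
    (hac : a + c = ac) (h₅ : ab + c = abc) (h₆ : ac + b = abc)
    (x : (obj m).X a) (y : (obj n).X b) (z : (obj l).X c) :
    circ h₂ (slot h₁ i (.inl ⟨j, hij.ne'⟩)) h₅ (circ h₁ i hab x y) z =
      sg k (b * c) • circ h₄ (slot h₃ j (.inl ⟨i, hij.ne⟩)) h₆ (circ h₃ j hac x z) y
  circ_act {m n r : ℕ} (h : m + n = r + 1) (i : Fin m) {a b c : ℤ} (hc : a + b = c)
    (σ : Equiv.Perm (Fin m)) (τ : Equiv.Perm (Fin n)) (x : (obj m).X a) (y : (obj n).X b) :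
    circ h i hc (act σ a x) (act τ b y) =
      act (blockPerm h i σ τ) c (circ h (σ i) hc x y)

/-- A morphism of operads, linear over the ring homomorphism `φ` of the ground rings
(`φ = RingHom.id k` gives the usual morphisms of operads over `k`). -/
@[ext]
structure Operad.Hom {k : Type v} {K : Type*} [CommRing k] [CommRing K] (φ : k →+* K)
    (E : Operad.{v, w} k) (F : Operad.{_, w'} K) where
  toFun (n : ℕ) (d : ℤ) : (E.obj n).X d →+ (F.obj n).X d
  map_smul (n : ℕ) (d : ℤ) (c : k) (x : (E.obj n).X d) : toFun n d (c • x) = φ c • toFun n d x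
  map_d (n : ℕ) (d d' : ℤ) (x : (E.obj n).X d) :
    toFun n d' ((E.obj n).d d d' x) = (F.obj n).d d d' (toFun n d x)
  map_act {n : ℕ} (σ : Equiv.Perm (Fin n)) (d : ℤ) (x : (E.obj n).X d) :
    toFun n d (E.act σ d x) = F.act σ d (toFun n d x)
  map_one : toFun 1 0 E.one = F.one
  map_circ {m n r : ℕ} (h : m + n = r + 1) (i : Fin m) {a b c : ℤ} (hc : a + b = c)
    (x : (E.obj m).X a) (y : (E.obj n).X b) :
    toFun r c (E.circ h i hc x y) = F.circ h i hc (toFun m a x) (toFun n b y)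

/-- Composition of morphisms of operads. -/
def Operad.Hom.comp {k : Type*} {K : Type*} {L : Type*} [CommRing k] [CommRing K] [CommRing L]
    {φ : k →+* K} {ψ : K →+* L} {χ : k →+* L} {E : Operad k} {F : Operad K} {G : Operad L}
    (g : Operad.Hom ψ F G) (f : Operad.Hom φ E F) (hχ : ψ.comp φ = χ) : Operad.Hom χ E G where
  toFun n d := (g.toFun n d).comp (f.toFun n d)
  map_smul n d c x := by simp [f.map_smul, g.map_smul, ← hχ]
  map_d n d d' x := by simp [f.map_d, g.map_d]
  map_act σ d x := by simp [f.map_act, g.map_act]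
  map_one := by simp [f.map_one, g.map_one]
  map_circ h i a b c hc x y := by simp [f.map_circ, g.map_circ]

/-! ### The total module of a complex -/

section Tot

variable {k : Type v} [CommRing k] (A : CochainComplex (ModuleCat.{w} k) ℤ)

/-- The direct sum of the terms of a complex. -/
abbrev Tot : Type w := ⨁ i : ℤ, A.X i

/-- The elements that are homogeneous of degree `i`. -/
def deg (i : ℤ) : Submodule k (Tot A) := LinearMap.range (lof k ℤ (fun i => A.X i) i)

/-- The operator `x ↦ (-1)^(c * deg x) x`. -/
def sgn (c : ℤ) : Tot A →ₗ[k] Tot A :=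
  toModule k ℤ _ fun i => sg k (c * i) • lof k ℤ (fun i => A.X i) i

/-- The differential on the direct sum. -/
def dT : Tot A →ₗ[k] Tot A :=
  toModule k ℤ _ fun i => lof k ℤ (fun i => A.X i) (i + 1) ∘ₗ (A.d i (i + 1)).hom

variable {A}

lemma lof_mem (i : ℤ) (x : A.X i) : lof k ℤ (fun i => A.X i) i x ∈ deg A i := ⟨x, rfl⟩

lemma sgn_of_mem {i : ℤ} {x : Tot A} (hx : x ∈ deg A i) (c : ℤ) :
    sgn A c x = sg k (c * i) • x := by
  obtain ⟨x, rfl⟩ := hx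
  simp [sgn]

lemma dT_lof (i : ℤ) (x : A.X i) :
    dT A (lof k ℤ (fun i => A.X i) i x) = lof k ℤ (fun i => A.X i) (i + 1) (A.d i (i + 1) x) := by
  simp [dT]

lemma dT_mem {i : ℤ} {x : Tot A} (hx : x ∈ deg A i) : dT A x ∈ deg A (i + 1) := by
  obtain ⟨x, rfl⟩ := hx
  rw [dT_lof]; exact lof_mem _ _

lemma tot_ext {M : Type*} [AddCommGroup M] [Module k M] {f g : Tot A →ₗ[k] M}
    (h : ∀ i, ∀ x ∈ deg A i, f x = g x) (x : Tot A) : f x = g x := by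
  have : f = g := DirectSum.linearMap_ext k fun i => LinearMap.ext fun x => h i _ (lof_mem i x)
  rw [this]

lemma sgn_mem {i : ℤ} {x : Tot A} (hx : x ∈ deg A i) (c : ℤ) : sgn A c x ∈ deg A i := by
  rw [sgn_of_mem hx]; exact Submodule.smul_mem _ _ hx

lemma sgn_add (a b : ℤ) (x : Tot A) : sgn A (a + b) x = sgn A a (sgn A b x) := by
  refine tot_ext (g := sgn A a ∘ₗ sgn A b) (fun i x hx => ?_) x
  rw [LinearMap.comp_apply, sgn_of_mem hx, sgn_of_mem hx, map_smul, sgn_of_mem hx, smul_smul,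
    add_mul, sg_add, mul_comm]

lemma sgn_comm (a b : ℤ) (x : Tot A) : sgn A a (sgn A b x) = sgn A b (sgn A a x) := by
  rw [← sgn_add, ← sgn_add, add_comm]

lemma sgn_zero (x : Tot A) : sgn A 0 x = x := by
  refine tot_ext (g := LinearMap.id) (fun i x hx => ?_) x
  rw [sgn_of_mem hx]; simp [sg]

lemma sgn_sgn (a : ℤ) (x : Tot A) : sgn A a (sgn A a x) = x := by
  refine tot_ext (f := sgn A a ∘ₗ sgn A a) (g := LinearMap.id) (fun i x hx => ?_) x
  rw [LinearMap.comp_apply, sgn_of_mem hx, map_smul, sgn_of_mem hx, sc_smul_self]; rfl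

lemma dT_sgn (c : ℤ) (x : Tot A) : dT A (sgn A c x) = sg k c • sgn A c (dT A x) := by
  refine tot_ext (f := dT A ∘ₗ sgn A c) (g := sg k c • (sgn A c ∘ₗ dT A)) (fun i x hx => ?_) x
  simp only [LinearMap.comp_apply, LinearMap.smul_apply]
  rw [sgn_of_mem hx, map_smul, sgn_of_mem (dT_mem hx), mul_add, mul_one, sg_add, smul_smul,
    mul_left_comm, sc_mul_self, mul_one]

lemma dT_dT (x : Tot A) : dT A (dT A x) = 0 := by
  refine tot_ext (f := dT A ∘ₗ dT A) (g := 0) (fun i x hx => ?_) x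
  obtain ⟨x, rfl⟩ := hx
  rw [LinearMap.comp_apply, dT_lof, dT_lof, ← ModuleCat.comp_apply, A.d_comp_d]
  simp

end Tot

/-! ### The endomorphism operad of a complex -/

section EndOp

variable {k : Type v} [CommRing k] {A : CochainComplex (ModuleCat.{w} k) ℤ}

/-- `n`-ary multilinear operations on `A`. -/
abbrev Op (A : CochainComplex (ModuleCat.{w} k) ℤ) (n : ℕ) : Type w :=
  MultilinearMap k (fun _ : Fin n => Tot A) (Tot A)

lemma op_ext {n : ℕ} {M : Type*} [AddCommGroup M] [Module k M]
    {θ θ' : MultilinearMap k (fun _ : Fin n => Tot A) M}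
    (h : ∀ (p : Fin n → ℤ) (a : Fin n → Tot A), (∀ i, a i ∈ deg A (p i)) → θ a = θ' a) :
    θ = θ' := by
  refine MultilinearMap.directSum_ext fun p => ?_
  ext a
  exact h p _ fun i => lof_mem _ _

/-- The operations that are homogeneous of degree `d`. -/
def opDeg (A : CochainComplex (ModuleCat.{w} k) ℤ) (n : ℕ) (d : ℤ) : Submodule k (Op A n) where
  carrier := {θ | ∀ (p : Fin n → ℤ) (a : Fin n → Tot A), (∀ i, a i ∈ deg A (p i)) →
    θ a ∈ deg A (∑ i, p i + d)}
  add_mem' h h' p a ha := Submodule.add_mem _ (h p a ha) (h' p a ha)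
  zero_mem' _ _ _ := Submodule.zero_mem _
  smul_mem' c _ h p a ha := Submodule.smul_mem _ c (h p a ha)

/-- The arguments of `θ` in `(θ ∘ᵢ η)(a)`: `η` is applied to the block of arguments that
starts at `i`, and passes the arguments before it with the Koszul sign. -/
def graft {m n r : ℕ} (h : m + n = r + 1) (i : Fin m) (b : ℤ) (η : (Fin n → Tot A) → Tot A)
    (a : Fin r → Tot A) : Fin m → Tot A := fun j =>
  if hj : j = i then η fun l => a (slot h i (.inr l))
  else if j < i then sgn A b (a (slot h i (.inl ⟨j, hj⟩))) else a (slot h i (.inl ⟨j, hj⟩))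

section graft

variable {m n r : ℕ} (h : m + n = r + 1) (i : Fin m) (b : ℤ) (η : (Fin n → Tot A) → Tot A)
  (a : Fin r → Tot A)

@[simp] lemma graft_self : graft h i b η a i = η fun l => a (slot h i (.inr l)) := by
  simp [graft]

lemma graft_ne (j : {j : Fin m // j ≠ i}) : graft h i b η a j.1 =
    if j.1 < i then sgn A b (a (slot h i (.inl j))) else a (slot h i (.inl j)) := by
  simp [graft, j.2]

/-- two tuples indexed by `Fin m` are compared at `i` and away from `i` -/
lemma tuple_ext {T : Type*} {f g : Fin m → T} (h0 : f i = g i)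
    (h1 : ∀ j : {j : Fin m // j ≠ i}, f j.1 = g j.1) : f = g := by
  funext j
  by_cases hj : j = i
  · rw [hj, h0]
  · exact h1 ⟨j, hj⟩

lemma graft_update_inl (j : {j : Fin m // j ≠ i}) (x : Tot A) :
    graft h i b η (Function.update a (slot h i (.inl j)) x) =
      Function.update (graft h i b η a) j.1 (if j.1 < i then sgn A b x else x) := by
  refine tuple_ext i ?_ fun j' => ?_
  · rw [Function.update_of_ne j.2.symm, graft_self, graft_self]
    congr 1; funext l
    rw [Function.update_of_ne (fun h' => by simpa using (slot h i).injective h')]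
  · by_cases hj : j' = j
    · subst hj; rw [graft_ne]; simp
    · rw [graft_ne, Function.update_of_ne (fun h' => hj (by simpa using (slot h i).injective h')),
        Function.update_of_ne (fun h' => hj (Subtype.ext h')), graft_ne]

lemma graft_update_inr (l : Fin n) (x : Tot A) :
    graft h i b η (Function.update a (slot h i (.inr l)) x) =
      Function.update (graft h i b η a) i
        (η (Function.update (fun l => a (slot h i (.inr l))) l x)) := by
  refine tuple_ext i ?_ fun j' => ?_
  · rw [Function.update_self, graft_self]
    congr 1; funext l'
    by_cases hl : l' = l
    · subst hl; simp
    · rw [Function.update_of_ne hl,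
        Function.update_of_ne (fun h' => hl (by simpa using (slot h i).injective h'))]
  · rw [graft_ne, Function.update_of_ne (fun h' => by simpa using (slot h i).injective h'),
        Function.update_of_ne j'.2, graft_ne]

end graft

/-- The partial composition `θ ∘ᵢ η`, with `η` of degree `b`. -/
def compOp {m n r : ℕ} (h : m + n = r + 1) (i : Fin m) (b : ℤ) (θ : Op A m) (η : Op A n) :
    Op A r :=
  MultilinearMap.mk' (fun a => θ (graft h i b η a))
    (by
      intro a x y z
      obtain ⟨x | x, rfl⟩ := (slot h i).surjective x
      · simp only [graft_update_inl]
        split_ifs <;> simp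
      · simp only [graft_update_inr]
        simp)
    (by
      intro a x c z
      obtain ⟨x | x, rfl⟩ := (slot h i).surjective x
      · simp only [graft_update_inl]
        split_ifs <;> simp
      · simp only [graft_update_inr]
        simp)

lemma compOp_apply {m n r : ℕ} (h : m + n = r + 1) (i : Fin m) (b : ℤ) (θ : Op A m) (η : Op A n)
    (a : Fin r → Tot A) : compOp h i b θ η a = θ (graft h i b η a) := rfl

/-- The `j`-th factor of the `i`-th summand of the differential of `A^{⊗ n}`. -/
def dMap (A : CochainComplex (ModuleCat.{w} k) ℤ) {n : ℕ} (i j : Fin n) : Tot A →ₗ[k] Tot A :=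
  if j < i then sgn A 1 else if j = i then dT A else LinearMap.id

/-- The differential `d ∘ θ - (-1)^c θ ∘ d` of an operation of degree `c`. -/
def dOp {n : ℕ} (c : ℤ) (θ : Op A n) : Op A n :=
  (dT A).compMultilinearMap θ - sg k c • ∑ i, θ.compLinearMap (dMap A i)

lemma dOp_apply {n : ℕ} (c : ℤ) (θ : Op A n) (a : Fin n → Tot A) :
    dOp c θ a = dT A (θ a) - sg k c • ∑ i, θ fun j => dMap A i j (a j) := by
  simp [dOp]

/-- `θ · σ`: permute the arguments with the Koszul sign. -/
def permOp {n : ℕ} (σ : Equiv.Perm (Fin n)) (θ : Op A n) : Op A n :=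
  MultilinearMap.fromDirectSumEquiv fun p : Fin n → ℤ =>
    sc k (koszul σ p) • (θ.domDomCongr σ⁻¹).compLinearMap
      fun i => lof k ℤ (fun i => A.X i) (p i)

lemma permOp_apply {n : ℕ} (σ : Equiv.Perm (Fin n)) (θ : Op A n) (p : Fin n → ℤ)
    (a : Fin n → Tot A) (ha : ∀ i, a i ∈ deg A (p i)) :
    permOp σ θ a = sc k (koszul σ p) • θ fun i => a (σ⁻¹ i) := by
  choose x hx using ha
  obtain rfl : (fun i => lof k ℤ (fun i => A.X i) (p i) (x i)) = a := funext hx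
  rw [permOp, MultilinearMap.fromDirectSumEquiv_lof]
  rfl

lemma slot_sum {m n r : ℕ} (h : m + n = r + 1) (i : Fin m) {M : Type*} [AddCommMonoid M]
    (f : Fin r → M) : ∑ x, f x = ∑ j : {j : Fin m // j ≠ i}, f (slot h i (.inl j)) +
      ∑ l, f (slot h i (.inr l)) := by
  rw [← (slot h i).sum_comp, Fintype.sum_sum_type]

lemma sum_ne {m : ℕ} (i : Fin m) {M : Type*} [AddCommMonoid M]
    (f : Fin m → M) : ∑ x, f x = ∑ j : {j : Fin m // j ≠ i}, f j.1 + f i := by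
  rw [Fintype.sum_eq_add_sum_subtype_ne f i, add_comm]

/-- degrees of the entries of `graft` -/
def gdeg {m n r : ℕ} (h : m + n = r + 1) (i : Fin m) (b : ℤ) (p : Fin r → ℤ) : Fin m → ℤ :=
  fun j => if hj : j = i then ∑ l, p (slot h i (.inr l)) + b else p (slot h i (.inl ⟨j, hj⟩))

lemma gdeg_sum {m n r : ℕ} (h : m + n = r + 1) (i : Fin m) (b : ℤ) (p : Fin r → ℤ) :
    ∑ j, gdeg h i b p j = ∑ x, p x + b := by
  rw [sum_ne i, slot_sum h i]
  have : ∀ j : {j : Fin m // j ≠ i}, gdeg h i b p j.1 = p (slot h i (.inl j)) := fun j => by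
    simp [gdeg, j.2]
  simp only [this]
  simp [gdeg, add_assoc]

lemma graft_mem {m n r : ℕ} (h : m + n = r + 1) (i : Fin m) (b : ℤ) {η : Op A n}
    (hη : η ∈ opDeg A n b) {p : Fin r → ℤ} {a : Fin r → Tot A} (ha : ∀ x, a x ∈ deg A (p x))
    (j : Fin m) : graft h i b η a j ∈ deg A (gdeg h i b p j) := by
  by_cases hj : j = i
  · subst hj
    simp only [graft_self, gdeg, dite_true]
    exact hη _ _ fun l => ha _
  · have := graft_ne h i b η a ⟨j, hj⟩
    simp only at this
    rw [this]
    simp only [gdeg, hj, dite_false]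
    split_ifs
    · exact sgn_mem (ha _) _
    · exact ha _

lemma compOp_mem {m n r : ℕ} (h : m + n = r + 1) (i : Fin m) {b c d : ℤ} (hd : c + b = d)
    {θ : Op A m} {η : Op A n} (hθ : θ ∈ opDeg A m c) (hη : η ∈ opDeg A n b) :
    compOp h i b θ η ∈ opDeg A r d := by
  intro p a ha
  have := hθ _ _ (graft_mem h i b hη ha)
  rw [gdeg_sum] at this
  rw [compOp_apply]
  convert this using 2
  omega

lemma dOp_mem {n : ℕ} {c d : ℤ} (hd : c + 1 = d) {θ : Op A n} (hθ : θ ∈ opDeg A n c) :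
    dOp c θ ∈ opDeg A n d := by
  intro p a ha
  rw [dOp_apply]
  refine Submodule.sub_mem _ ?_ (Submodule.smul_mem _ _ (Submodule.sum_mem _ fun i _ => ?_))
  · have := dT_mem (hθ p a ha)
    convert this using 2; omega
  · have := hθ (fun j => p j + if j = i then 1 else 0) (fun j => dMap A i j (a j)) fun j => by
      unfold dMap
      by_cases h1 : j < i
      · simp [h1, h1.ne, sgn_mem (ha j)]
      · by_cases h2 : j = i
        · subst h2; simp [dT_mem (ha j)]
        · simp [h1, h2, ha j]
    convert this using 2
    rw [Finset.sum_add_distrib]; simp; omega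

lemma permOp_mem {n : ℕ} (σ : Equiv.Perm (Fin n)) {c : ℤ} {θ : Op A n} (hθ : θ ∈ opDeg A n c) :
    permOp σ θ ∈ opDeg A n c := by
  intro p a ha
  rw [permOp_apply σ θ p a ha]
  refine Submodule.smul_mem _ _ ?_
  have := hθ (fun i => p (σ⁻¹ i)) _ fun i => ha (σ⁻¹ i)
  rwa [Equiv.sum_comp σ⁻¹ p] at this

lemma sgn_op {n : ℕ} {c : ℤ} (b : ℤ) {θ : Op A n} (hθ : θ ∈ opDeg A n c) (a : Fin n → Tot A) :
    sgn A b (θ a) = sg k (b * c) • θ fun i => sgn A b (a i) := by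
  have : (sgn A b).compMultilinearMap θ = sg k (b * c) • θ.compLinearMap fun _ => sgn A b := by
    refine op_ext fun p a ha => ?_
    simp only [LinearMap.compMultilinearMap_apply, _root_.smul_apply,
      MultilinearMap.compLinearMap_apply]
    rw [sgn_of_mem (hθ p a ha)]
    simp only [fun i => sgn_of_mem (ha i) b]
    rw [MultilinearMap.map_smul_univ, smul_smul, mul_add, sg_add, mul_comm (sg k _)]
    congr 2
    rw [← map_prod, Finset.mul_sum]
    exact congrArg (sc k) (map_prod (M := Multiplicative ℤ)
      (⟨⟨Int.negOnePow, rfl⟩, Int.negOnePow_add⟩ : Multiplicative ℤ →* ℤˣ) _ _)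
  exact congrArg (fun θ => θ a) this

end EndOp

section EndLaws

variable {k : Type v} [CommRing k] {A : CochainComplex (ModuleCat.{w} k) ℤ}

lemma permOp_one {n : ℕ} (θ : Op A n) : permOp 1 θ = θ :=
  op_ext fun p a ha => by rw [permOp_apply _ _ p a ha, koszul_one]; simp

lemma permOp_mul {n : ℕ} (σ τ : Equiv.Perm (Fin n)) (θ : Op A n) :
    permOp (σ * τ) θ = permOp τ (permOp σ θ) :=
  op_ext fun p a ha => by
    rw [permOp_apply _ _ p a ha, permOp_apply _ _ p a ha,
      permOp_apply _ _ (fun i => p (τ⁻¹ i)) _ (fun i => ha _), koszul_mul, map_mul, smul_smul]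
    simp

lemma dMap_smul {n : ℕ} (i j : Fin n) {p : ℤ} {x : Tot A} (hx : x ∈ deg A p) :
    dMap A i j x = sc k (if j < i then (1 * p).negOnePow else 1) • if j = i then dT A x else x := by
  unfold dMap
  by_cases h1 : j < i
  · simp [h1, h1.ne, sgn_of_mem hx]
  · by_cases h2 : j = i
    · subst h2; simp
    · simp [h1, h2]

lemma dMap_mem {n : ℕ} (i j : Fin n) {p : ℤ} {x : Tot A} (hx : x ∈ deg A p) :
    dMap A i j x ∈ deg A (p + if j = i then 1 else 0) := by
  rw [dMap_smul i j hx]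
  refine Submodule.smul_mem _ _ ?_
  split_ifs
  · exact dT_mem hx
  · simpa using hx

lemma prod_ne {m : ℕ} (i : Fin m) {M : Type*} [CommMonoid M]
    (f : Fin m → M) (hf : f i = 1) : ∏ x, f x = ∏ j : {j : Fin m // j ≠ i}, f j.1 := by
  rw [Fintype.prod_eq_mul_prod_subtype_ne f i, hf, one_mul]

lemma dOp_permOp {n : ℕ} (c : ℤ) (σ : Equiv.Perm (Fin n)) (θ : Op A n) :
    dOp c (permOp σ θ) = permOp σ (dOp c θ) := by
  refine op_ext fun p a ha => ?_
  rw [dOp_apply, permOp_apply _ _ p a ha, permOp_apply _ _ p a ha, dOp_apply, map_smul, smul_sub,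
    smul_comm (sc k (koszul σ p)) (sg k c)]
  congr 2
  rw [Finset.smul_sum, ← Equiv.sum_comp σ (fun i => sc k (koszul σ p) • θ fun j => dMap A i j (a (σ⁻¹ j)))]
  refine Finset.sum_congr rfl fun i _ => ?_
  rw [permOp_apply _ _ _ _ (fun j => dMap_mem i j (ha j))]
  have e1 : (fun j => dMap A i (σ⁻¹ j) (a (σ⁻¹ j))) = fun j =>
      sc k (if σ⁻¹ j < i then (1 * p (σ⁻¹ j)).negOnePow else 1) •
        if σ⁻¹ j = i then dT A (a (σ⁻¹ j)) else a (σ⁻¹ j) :=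
    funext fun j => dMap_smul i _ (ha _)
  have e2 : (fun j => dMap A (σ i) j (a (σ⁻¹ j))) = fun j =>
      sc k (if j < σ i then (1 * p (σ⁻¹ j)).negOnePow else 1) •
        if σ⁻¹ j = i then dT A (a (σ⁻¹ j)) else a (σ⁻¹ j) :=
    funext fun j => by
      rw [dMap_smul (σ i) _ (ha _)]
      congr 1
      have : j = σ i ↔ σ⁻¹ j = i := (σ.symm_apply_eq).symm
      simp only [this]
  rw [e1, e2, MultilinearMap.map_smul_univ, MultilinearMap.map_smul_univ, smul_smul, smul_smul]
  congr 1
  rw [← map_prod, ← map_prod, ← map_mul, ← map_mul]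
  congr 1
  have f1 := Equiv.prod_comp σ fun j => if σ⁻¹ j < i then (1 * p (σ⁻¹ j)).negOnePow else 1
  have f2 := Equiv.prod_comp σ fun j => if j < σ i then (1 * p (σ⁻¹ j)).negOnePow else 1
  have s : ∀ x, σ⁻¹ (σ x) = x := σ.symm_apply_apply
  simp only [s] at f1 f2
  rw [← f1, ← f2, prod_ne i _ (by simp), prod_ne i _ (by simp)]
  exact koszul_shift i σ p _ 1 (fun j hj => by simp [hj]) (by simp)

lemma sum_antisymm {n : ℕ} {M : Type*} [AddCommGroup M] (f : Fin n → Fin n → M)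
    (h0 : ∀ i, f i i = 0) (h : ∀ i j, i < j → f i j + f j i = 0) : ∑ i, ∑ j, f i j = 0 := by
  rw [← Fintype.sum_prod_type']
  refine Finset.sum_involution (fun x _ => x.swap) ?_ ?_ ?_ ?_
  · rintro ⟨i, j⟩ _
    rcases lt_trichotomy i j with hij | rfl | hij
    · exact h i j hij
    · simp [h0]
    · rw [add_comm]; exact h j i hij
  · rintro ⟨i, j⟩ _ hne heq
    obtain rfl : j = i := congrArg Prod.fst heq
    exact hne (h0 _)
  · simp
  · simp

lemma dOp_dOp {n : ℕ} (c : ℤ) (θ : Op A n) : dOp (c + 1) (dOp c θ) = 0 := by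
  refine MultilinearMap.ext fun a => ?_
  simp only [dOp_apply, map_sub, map_smul, map_sum, dT_dT, Finset.sum_sub_distrib,
    _root_.zero_apply, ← Finset.smul_sum]
  have hs : sg k (c + 1) = - sg k c := by rw [sg_add]; simp [sg, sc]
  rw [sum_antisymm (fun i j => θ fun l => dMap A j l (dMap A i l (a l)))]
  · rw [hs]; simp
  · intro i
    refine θ.map_coord_zero i ?_
    simp [dMap, dT_dT]
  · intro i j hij
    have : (fun l => dMap A j l (dMap A i l (a l))) =
        Function.update (fun l => dMap A i l (dMap A j l (a l))) i
          (- dMap A i i (dMap A j i (a i))) := by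
      funext l
      by_cases hl : l = i
      · subst hl
        simp only [Function.update_self, dMap, hij, if_true, lt_irrefl, if_false]
        rw [dT_sgn]; simp [sg, sc]
      · rw [Function.update_of_ne hl]
        by_cases h1 : l < i
        · simp [dMap, h1, h1.trans hij]
        · by_cases h2 : l = j
          · simp [dMap, h2, hij.not_gt, hij.ne']
          · by_cases h3 : l < j <;> simp [dMap, h1, h2, h3, hl]
    rw [this, MultilinearMap.map_update_neg, Function.update_eq_self, neg_add_cancel]

lemma graft_sgn {m n r : ℕ} (h : m + n = r + 1) (i : Fin m) (b : ℤ) (η : (Fin n → Tot A) → Tot A)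
    {p : Fin r → ℤ} {a : Fin r → Tot A} (ha : ∀ x, a x ∈ deg A (p x)) (j : Fin m) :
    graft h i b η a j =
      sc k (if j < i then (b * gdeg h i 0 p j).negOnePow else 1) • graft h i 0 η a j := by
  by_cases hj : j = i
  · subst hj; simp
  · simp only [graft, gdeg, hj, dite_false]
    split_ifs
    · rw [sgn_zero, sgn_of_mem (ha _)]
    · simp

lemma compOp_permOp {m n r : ℕ} (h : m + n = r + 1) (i : Fin m) (b : ℤ) (σ : Equiv.Perm (Fin m))
    (τ : Equiv.Perm (Fin n)) (θ : Op A m) {η : Op A n} (hη : η ∈ opDeg A n b) :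
    compOp h i b (permOp σ θ) (permOp τ η) =
      permOp (blockPerm h i σ τ) (compOp h (σ i) b θ η) := by
  refine op_ext fun p a ha => ?_
  set ρ := blockPerm h i σ τ with hρ
  have r1 : ∀ j : {j : Fin m // j ≠ i}, ρ⁻¹ (slot h (σ i) (.inl ⟨σ j.1, σ.injective.ne j.2⟩)) =
      slot h i (.inl j) := fun j => by
    rw [← blockPerm_inl h i σ τ]; exact ρ.symm_apply_apply _
  have r2 : ∀ l, ρ⁻¹ (slot h (σ i) (.inr l)) = slot h i (.inr (τ⁻¹ l)) := fun l => by
    have := blockPerm_inr h i σ τ (τ⁻¹ l)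
    rw [show τ (τ⁻¹ l) = l from τ.apply_symm_apply l] at this
    rw [← this]; exact ρ.symm_apply_apply _
  have s : ∀ x, σ⁻¹ (σ x) = x := σ.symm_apply_apply
  rw [compOp_apply, permOp_apply _ _ _ _ (graft_mem h i b (permOp_mem τ hη) ha),
    permOp_apply _ _ p a ha, compOp_apply]
  set a' := fun x => a (ρ⁻¹ x)
  have ha' : ∀ x, a' x ∈ deg A (p (ρ⁻¹ x)) := fun x => ha _
  -- comparison of the degrees and of the tuples without signs
  have g1 : ∀ j : {j : Fin m // j ≠ i}, gdeg h (σ i) 0 (fun x => p (ρ⁻¹ x)) (σ j.1) =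
      gdeg h i 0 p j.1 := fun j => by
    simp only [gdeg, j.2, σ.injective.ne j.2, dite_false]
    rw [r1 j]
  have g2 : ∀ j, graft h i 0 (permOp τ η) a j = 
      sc k (if j = i then koszul τ (fun l => p (slot h i (.inr l))) else 1) •
        graft h (σ i) 0 η a' (σ j) := fun j => by
    by_cases hj : j = i
    · subst hj
      rw [graft_self, graft_self, permOp_apply τ η _ _ (fun l => ha _), if_pos rfl]
      congr 2; funext l
      exact congrArg a (r2 l).symm
    · have e1 := graft_ne h i 0 (permOp τ η) a ⟨j, hj⟩
      have e2 := graft_ne h (σ i) 0 η a' ⟨σ j, σ.injective.ne hj⟩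
      simp only [sgn_zero, ite_self] at e1 e2
      rw [e1, e2, if_neg hj, map_one, one_smul]
      exact congrArg a (r1 ⟨j, hj⟩).symm
  have t1 : (fun j => graft h i b (permOp τ η) a (σ⁻¹ j)) = fun j =>
      sc k ((if σ⁻¹ j < i then (b * gdeg h i 0 p (σ⁻¹ j)).negOnePow else 1) *
        (if σ⁻¹ j = i then koszul τ (fun l => p (slot h i (.inr l))) else 1)) •
        graft h (σ i) 0 η a' j := funext fun j => by
    rw [graft_sgn h i b _ ha, g2, smul_smul, ← map_mul, show σ (σ⁻¹ j) = j from σ.apply_symm_apply j]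
  have t2 : graft h (σ i) b η a' = fun j =>
      sc k (if j < σ i then (b * gdeg h (σ i) 0 (fun x => p (ρ⁻¹ x)) j).negOnePow else 1) •
        graft h (σ i) 0 η a' j := funext fun j => graft_sgn h (σ i) b _ ha' j
  rw [t1, t2, MultilinearMap.map_smul_univ, MultilinearMap.map_smul_univ, smul_smul, smul_smul]
  congr 1
  rw [← map_prod, ← map_prod, ← map_mul, ← map_mul]
  congr 1
  rw [Finset.prod_mul_distrib]
  have f1 := Equiv.prod_comp σ fun j => if σ⁻¹ j < i then (b * gdeg h i 0 p (σ⁻¹ j)).negOnePow else 1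
  have f2 := Equiv.prod_comp σ fun j =>
    if j < σ i then (b * gdeg h (σ i) 0 (fun x => p (ρ⁻¹ x)) j).negOnePow else 1
  have f3 := Equiv.prod_comp σ fun j =>
    if σ⁻¹ j = i then koszul τ (fun l => p (slot h i (.inr l))) else 1
  simp only [s, Finset.prod_ite_eq', Finset.mem_univ, if_true] at f1 f2 f3
  rw [← f1, ← f2, ← f3, prod_ne i _ (by simp), prod_ne i _ (by simp)]
  simp only [g1]
  have g0 : ∀ c j, ∀ hj : j ≠ i, gdeg h i c p j = p (slot h i (.inl ⟨j, hj⟩)) := fun c j hj => by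
    simp [gdeg, hj]
  have K1 := koszul_shift i σ (gdeg h i 0 p) (gdeg h i b p) b
    (fun j hj => by rw [g0 _ j hj, g0 _ j hj]) (by simp [gdeg])
  have K2 : koszul ρ p = koszul σ (gdeg h i 0 p) * koszul τ (fun l => p (slot h i (.inr l))) := by
    rw [hρ, koszul_split, koszul_at i σ, mul_right_comm]
    have g0' : ∀ j : {j : Fin m // j ≠ i}, gdeg h i 0 p j.1 = p (slot h i (.inl j)) :=
      fun j => g0 0 _ j.2
    have gi : gdeg h i 0 p i = ∑ l, p (slot h i (.inr l)) := by simp [gdeg]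
    simp only [g0', gi]
  rw [K2, ← mul_assoc, K1]
  ac_rfl

lemma compOp_seq {m n l r s t : ℕ} (h₁ : m + n = r + 1) (h₂ : r + l = s + 1) (h₃ : n + l = t + 1)
    (h₄ : m + t = s + 1) (i : Fin m) (j : Fin n) (b c : ℤ) (θ : Op A m) (η : Op A n)
    (ζ : Op A l) :
    compOp h₂ (slot h₁ i (.inr j)) c (compOp h₁ i b θ η) ζ =
      compOp h₄ i (b + c) θ (compOp h₃ j c η ζ) := by
  refine MultilinearMap.ext fun a => ?_
  simp only [compOp_apply]
  congr 1
  refine tuple_ext i ?_ fun x => ?_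
  · rw [graft_self, graft_self, compOp_apply]
    congr 1
    refine tuple_ext j ?_ fun y => ?_
    · rw [graft_self, graft_self]
      congr 1; funext z; congr 1
      apply Fin.ext; simp only [slot_inr_val]; omega
    · have e := graft_ne h₂ (slot h₁ i (.inr j)) c ζ a ⟨slot h₁ i (.inr y.1), fun h' => y.2 (by
        simpa using (slot h₁ i).injective h')⟩
      simp only at e
      rw [e, graft_ne]
      simp only [slot_inr_lt]
      have : slot h₂ (slot h₁ i (.inr j)) (.inl ⟨slot h₁ i (.inr y.1), fun h' => y.2 (by
        simpa using (slot h₁ i).injective h')⟩) = slot h₄ i (.inr (slot h₃ j (.inl y))) := by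
        apply Fin.ext
        have hy0 : y.1.1 ≠ j.1 := fun h' => y.2 (Fin.ext h')
        rcases lt_or_ge y.1.1 j.1 with hy | hy
        · have hlt : (slot h₁ i (.inr y.1)).1 < (slot h₁ i (.inr j)).1 := by
            rw [slot_inr_val, slot_inr_val]; omega
          rw [slot_inl_val h₂, if_pos hlt, slot_inr_val, slot_inr_val, slot_inl_val, if_pos hy]
        · have hlt : ¬ (slot h₁ i (.inr y.1)).1 < (slot h₁ i (.inr j)).1 := by
            rw [slot_inr_val, slot_inr_val]; omega
          rw [slot_inl_val h₂, if_neg hlt, slot_inr_val, slot_inr_val, slot_inl_val,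
            if_neg (by omega)]
          omega
      rw [this]
  · have e := graft_ne h₂ (slot h₁ i (.inr j)) c ζ a ⟨slot h₁ i (.inl x), fun h' => by
        simpa using (slot h₁ i).injective h'⟩
    simp only at e
    rw [graft_ne, graft_ne, e]
    have : slot h₂ (slot h₁ i (.inr j)) (.inl ⟨slot h₁ i (.inl x), fun h' => by
        simpa using (slot h₁ i).injective h'⟩) = slot h₄ i (.inl x) := by
      apply Fin.ext
      have := x.2
      have := j.2
      simp only [slot_inl_val, slot_inr_val, ne_eq, Fin.ext_iff] at *
      split_ifs <;> omega
    rw [this]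
    simp only [slot_inl_inr_lt]
    split_ifs
    · rw [sgn_add]
    · rfl

lemma compOp_par {m n l r s t : ℕ} (h₁ : m + n = r + 1) (h₂ : r + l = s + 1) (h₃ : m + l = t + 1)
    (h₄ : t + n = s + 1) (i j : Fin m) (hij : i < j) (b c : ℤ) (θ : Op A m) {η : Op A n}
    (hη : η ∈ opDeg A n b) (ζ : Op A l) :
    compOp h₂ (slot h₁ i (.inl ⟨j, hij.ne'⟩)) c (compOp h₁ i b θ η) ζ =
      sg k (b * c) • compOp h₄ (slot h₃ j (.inl ⟨i, hij.ne⟩)) b (compOp h₃ j c θ ζ) η := by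
  refine MultilinearMap.ext fun a => ?_
  simp only [_root_.smul_apply, compOp_apply]
  set J := slot h₁ i (.inl ⟨j, hij.ne'⟩) with hJ
  set I := slot h₃ j (.inl ⟨i, hij.ne⟩) with hI
  have vJ : J.1 = j + n - 1 := by
    rw [hJ, slot_inl_val, if_neg]; simpa using hij.le
  have vI : I.1 = i := by
    rw [hI, slot_inl_val, if_pos]; simpa using hij
  have hij' : i.1 < j.1 := hij
  set G := graft h₃ j c ζ (graft h₄ I b η a) with hG
  have key : graft h₁ i b η (graft h₂ J c ζ a) = Function.update G i (sg k (b * c) • G i) := by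
    refine tuple_ext i ?_ fun x => ?_
    · rw [graft_self, Function.update_self, hG]
      have e := graft_ne h₃ j c ζ (graft h₄ I b η a) ⟨i, hij.ne⟩
      simp only [hij, if_true] at e
      rw [e, ← hI, graft_self, sgn_op c hη, smul_smul, mul_comm b c, sc_mul_self, one_smul]
      congr 1; funext y
      have hne : slot h₁ i (.inr y) ≠ J := fun h' => by
        rw [hJ] at h'; simpa using (slot h₁ i).injective h'
      have e := graft_ne h₂ J c ζ a ⟨_, hne⟩
      simp only at e
      have hlt : slot h₁ i (.inr y) < J := by rw [hJ, slot_inr_inl_lt]; exact hij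
      rw [e, if_pos hlt]
      congr 2
      apply Fin.ext
      have := y.2
      rw [slot_inl_val, slot_inr_val, if_pos (by exact hlt), slot_inr_val, vI]
    · rw [Function.update_of_ne x.2, graft_ne]
      by_cases hx : x.1 = j
      · obtain rfl : x = ⟨j, hij.ne'⟩ := Subtype.ext hx
        rw [if_neg hij.not_gt, ← hJ, graft_self, hG]
        simp only [graft_self]
        congr 1; funext y
        have hne : slot h₃ j (.inr y) ≠ I := fun h' => by
          rw [hI] at h'; simpa using (slot h₃ j).injective h'
        have e := graft_ne h₄ I b η a ⟨_, hne⟩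
        simp only at e
        have hlt : ¬ slot h₃ j (.inr y) < I := by
          rw [hI, slot_inr_inl_lt]; exact hij.not_gt
        rw [e, if_neg hlt]
        congr 1
        apply Fin.ext
        have := y.2
        have hlt' := hlt
        rw [Fin.lt_def] at hlt'
        rw [slot_inr_val, slot_inl_val h₄, if_neg hlt', slot_inr_val, vJ]
        omega
      · have hne : slot h₁ i (.inl x) ≠ J := fun h' => by
          rw [hJ] at h'
          have := (slot h₁ i).injective h'
          simp only [Sum.inl.injEq] at this
          exact hx (congrArg Subtype.val this)
        have e := graft_ne h₂ J c ζ a ⟨_, hne⟩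
        simp only at e
        have hlt : slot h₁ i (.inl x) < J ↔ x.1 < j := by rw [hJ, slot_inl_lt]
        have e2 := graft_ne h₃ j c ζ (graft h₄ I b η a) ⟨x.1, hx⟩
        simp only at e2
        have hne' : slot h₃ j (.inl ⟨x.1, hx⟩) ≠ I := fun h' => by
          rw [hI] at h'
          have := (slot h₃ j).injective h'
          simp only [Sum.inl.injEq, Subtype.mk.injEq] at this
          exact x.2 this
        have e3 := graft_ne h₄ I b η a ⟨_, hne'⟩
        simp only at e3
        have hlt2 : slot h₃ j (.inl ⟨x.1, hx⟩) < I ↔ x.1 < i := by rw [hI, slot_inl_lt]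
        have idx : slot h₂ J (.inl ⟨_, hne⟩) = slot h₄ I (.inl ⟨_, hne'⟩) := by
          apply Fin.ext
          have hx2 := x.2
          simp only [slot_inl_val, vI, vJ, ne_eq, Fin.ext_iff] at *
          split_ifs <;> omega
        rw [e, hG, e2, e3, idx]
        simp only [hlt, hlt2]
        split_ifs
        · exact sgn_comm _ _ _
        · rfl
        · rfl
        · rfl
  rw [key, MultilinearMap.map_update_smul, Function.update_eq_self]

lemma dOp_compOp {m n r : ℕ} (h : m + n = r + 1) (i : Fin m) (a b : ℤ)
    (θ : Op A m) {η : Op A n} (hη : η ∈ opDeg A n b) :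
    dOp (a + b) (compOp h i b θ η) = compOp h i b (dOp a θ) η +
      sg k a • compOp h i (b + 1) θ (dOp b η) := by
  refine MultilinearMap.ext fun x => ?_
  simp only [_root_.add_apply, _root_.smul_apply, compOp_apply, dOp_apply]
  set T := graft h i (b + 1) (fun _ => 0) x with hT
  have hb : sgn A b = fun x => sgn A b x := rfl
  -- the summands outside the block
  have k1 : ∀ j : {j : Fin m // j ≠ i},
      θ (fun y => dMap A j.1 y (graft h i b η x y)) =
      sg k b • θ (graft h i b η fun y => dMap A (slot h i (.inl j)) y (x y)) := by
    intro j
    set G := graft h i b η fun y => dMap A (slot h i (.inl j)) y (x y) with hG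
    rcases lt_or_gt_of_ne j.2 with hj | hj
    · have : (fun y => dMap A j.1 y (graft h i b η x y)) =
          Function.update G j.1 (sg k b • G j.1) := by
        refine tuple_ext i ?_ fun y => ?_
        · rw [Function.update_of_ne j.2.symm, hG, graft_self, graft_self]
          simp [dMap, hj.not_gt, hj.ne', slot_inr_inl_lt]
        · by_cases hy : y = j
          · subst hy
            rw [Function.update_self, hG, graft_ne, graft_ne]
            simp only [hj, if_true, dMap, lt_irrefl, if_false]
            rw [dT_sgn]
          · have hy' : y.1 ≠ j.1 := fun h' => hy (Subtype.ext h')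
            rw [Function.update_of_ne hy', hG, graft_ne, graft_ne]
            simp only [dMap, slot_inl_lt, EmbeddingLike.apply_eq_iff_eq, Sum.inl.injEq, hy, hy',
              if_false]
            split_ifs <;> simp [sgn_comm]
      rw [this, MultilinearMap.map_update_smul, Function.update_eq_self]
    · have : (fun y => dMap A j.1 y (graft h i b η x y)) =
          Function.update G i (sg k b • G i) := by
        refine tuple_ext i ?_ fun y => ?_
        · rw [Function.update_self, hG, graft_self, graft_self]
          simp only [dMap, slot_inr_inl_lt, hj, if_true]
          rw [sgn_op 1 hη, one_mul]
        · rw [Function.update_of_ne y.2, hG, graft_ne, graft_ne]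
          by_cases hy : y = j
          · subst hy
            simp [dMap, hj.not_gt]
          · have hy' : y.1 ≠ j.1 := fun h' => hy (Subtype.ext h')
            simp only [dMap, slot_inl_lt, EmbeddingLike.apply_eq_iff_eq, Sum.inl.injEq, hy, hy',
              if_false]
            split_ifs <;> simp [sgn_comm]
      rw [this, MultilinearMap.map_update_smul, Function.update_eq_self]
  have k2 : (fun y => dMap A i y (graft h i b η x y)) =
      Function.update T i (dT A (η fun l => x (slot h i (.inr l)))) := by
    refine tuple_ext i ?_ fun y => ?_
    · simp [dMap]
    · rw [Function.update_of_ne y.2, hT, graft_ne, graft_ne]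
      simp only [dMap, y.2, if_false]
      split_ifs
      · rw [add_comm, sgn_add]
      · rfl
  have k3 : ∀ l, (graft h i b η fun y => dMap A (slot h i (.inr l)) y (x y)) =
      Function.update T i (η fun l' => dMap A l l' (x (slot h i (.inr l')))) := by
    intro l
    refine tuple_ext i ?_ fun y => ?_
    · simp [dMap, slot_inr_lt]
    · rw [Function.update_of_ne y.2, hT, graft_ne, graft_ne]
      simp only [dMap, slot_inl_inr_lt, EmbeddingLike.apply_eq_iff_eq, reduceCtorEq, if_false]
      split_ifs
      · rw [sgn_add]
      · rfl
  have k4 : graft h i (b + 1) (dOp b η) x =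
      Function.update T i (dT A (η fun l => x (slot h i (.inr l))) -
        sg k b • ∑ l, η fun l' => dMap A l l' (x (slot h i (.inr l')))) := by
    refine tuple_ext i ?_ fun y => ?_
    · simp [dOp_apply]
    · rw [Function.update_of_ne y.2, hT, graft_ne, graft_ne]
  rw [slot_sum h i, sum_ne i]
  simp only [k1, k2, k3, k4, MultilinearMap.map_update_sub, MultilinearMap.map_update_smul,
    MultilinearMap.map_update_sum, sg_add, ← Finset.smul_sum]
  module

/-- The differential on homogeneous operations. -/
def opD {n : ℕ} (c d : ℤ) : opDeg A n c →ₗ[k] opDeg A n d where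
  toFun := fun θ => if h : c + 1 = d then ⟨dOp c θ.1, dOp_mem h θ.2⟩ else 0
  map_add' := fun θ θ' => by
    split_ifs
    · refine Subtype.ext (MultilinearMap.ext fun a => ?_)
      simp only [Submodule.coe_add, _root_.add_apply, dOp_apply, map_add,
        Finset.sum_add_distrib]
      module
    · simp
  map_smul' := fun s θ => by
    split_ifs
    · refine Subtype.ext (MultilinearMap.ext fun a => ?_)
      simp only [Submodule.coe_smul, _root_.smul_apply, dOp_apply, map_smul,
        ← Finset.smul_sum, RingHom.id_apply]
      module
    · simp

lemma opD_succ {n : ℕ} (c : ℤ) (θ : opDeg A n c) : (opD c (c + 1) θ).1 = dOp c θ.1 := by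
  simp [opD]

lemma opD_ne {n : ℕ} {c d : ℤ} (h : ¬ c + 1 = d) (θ : opDeg A n c) : opD c d θ = 0 := by
  simp [opD, h]

/-- The complex of `n`-ary multilinear operations `A^{⊗ n} → A`. -/
def opComplex (A : CochainComplex (ModuleCat.{w} k) ℤ) (n : ℕ) :
    CochainComplex (ModuleCat.{w} k) ℤ where
  X d := ModuleCat.of k (opDeg A n d)
  d c d := ModuleCat.ofHom (opD c d)
  shape c d h := ModuleCat.hom_ext (LinearMap.ext fun θ => opD_ne h θ)
  d_comp_d' c d e h h' := by
    have h : c + 1 = d := h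
    have h' : d + 1 = e := h'
    subst h h'
    refine ModuleCat.hom_ext (LinearMap.ext fun θ => Subtype.ext ?_)
    change (opD (c + 1) (c + 1 + 1) (opD c (c + 1) θ)).1 = 0
    rw [opD_succ, opD_succ, dOp_dOp]

/-- The action of permutations on homogeneous operations. -/
def opAct {n : ℕ} (σ : Equiv.Perm (Fin n)) (d : ℤ) : opDeg A n d →ₗ[k] opDeg A n d where
  toFun θ := ⟨permOp σ θ.1, permOp_mem σ θ.2⟩
  map_add' θ θ' := Subtype.ext <| op_ext fun p a ha => by
    simp [permOp_apply _ _ p a ha]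
  map_smul' s θ := Subtype.ext <| op_ext fun p a ha => by
    simp [permOp_apply _ _ p a ha, smul_comm s]

lemma compOp_update {m n r : ℕ} (h : m + n = r + 1) (i : Fin m) (b : ℤ) (η ζ : Op A n)
    (x : Fin r → Tot A) : graft h i b ζ x = Function.update (graft h i b η x) i
        (ζ fun l => x (slot h i (.inr l))) := tuple_ext i (by simp) fun j => by
  rw [Function.update_of_ne j.2, graft_ne, graft_ne]

/-- The partial composition of homogeneous operations. -/
def opCirc {m n r : ℕ} (h : m + n = r + 1) (i : Fin m) {a b c : ℤ} (hc : a + b = c) :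
    opDeg A m a →ₗ[k] opDeg A n b →ₗ[k] opDeg A r c :=
  LinearMap.mk₂ k (fun θ η => ⟨compOp h i b θ.1 η.1, compOp_mem h i hc θ.2 η.2⟩)
    (fun θ θ' η => rfl) (fun s θ η => rfl)
    (fun θ η η' => Subtype.ext <| MultilinearMap.ext fun x => by
      change θ.1 (graft h i b (η.1 + η'.1 : Op A _) x) =
        θ.1 (graft h i b η.1 x) + θ.1 (graft h i b η'.1 x)
      rw [compOp_update h i b η.1 (η.1 + η'.1), compOp_update h i b η.1 η'.1, _root_.add_apply,
        MultilinearMap.map_update_add, ← compOp_update h i b η.1 η.1])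
    (fun s θ η => Subtype.ext <| MultilinearMap.ext fun x => by
      change θ.1 (graft h i b (s • η.1 : Op A _) x) = s • θ.1 (graft h i b η.1 x)
      rw [compOp_update h i b η.1 (s • η.1), _root_.smul_apply, MultilinearMap.map_update_smul,
        ← compOp_update h i b η.1 η.1])

/-- The identity operation. -/
def opOne (A : CochainComplex (ModuleCat.{w} k) ℤ) : opDeg A 1 0 :=
  ⟨MultilinearMap.mk' (fun a => a 0) (fun a i x y => by simp [Subsingleton.elim i 0])
    (fun a i c x => by simp [Subsingleton.elim i 0]), fun p a ha => by simpa using ha 0⟩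

lemma opD_act {n : ℕ} (σ : Equiv.Perm (Fin n)) (d d' : ℤ) (θ : opDeg A n d) :
    opD d d' (opAct σ d θ) = opAct σ d' (opD d d' θ) := by
  by_cases h : d + 1 = d'
  · subst h
    refine Subtype.ext ?_
    rw [opD_succ]
    refine (dOp_permOp d σ θ.1).trans ?_
    rw [← opD_succ]; rfl
  · rw [opD_ne h, opD_ne h, map_zero]

lemma opD_one : opD 0 1 (opOne A) = 0 := by
  refine Subtype.ext ((opD_succ 0 _).trans (MultilinearMap.ext fun a => ?_))
  rw [dOp_apply]
  simp [dMap, sg, sc, opOne]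

lemma opD_circ {m n r : ℕ} (h : m + n = r + 1) (i : Fin m) {a b c : ℤ} (hc : a + b = c)
    (hc₁ : (a + 1) + b = c + 1) (hc₂ : a + (b + 1) = c + 1) (θ : opDeg A m a) (η : opDeg A n b) :
    opD c (c + 1) (opCirc h i hc θ η) = opCirc h i hc₁ (opD a (a + 1) θ) η +
      sg k a • opCirc h i hc₂ θ (opD b (b + 1) η) := by
  subst hc
  refine Subtype.ext ?_
  rw [opD_succ]
  refine (dOp_compOp h i a b θ.1 η.2).trans ?_
  rw [← opD_succ, ← opD_succ]; rfl

/-- The endomorphism operad of the complex `A`. -/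
def EndOp (A : CochainComplex (ModuleCat.{w} k) ℤ) : Operad.{v, w} k where
  obj := opComplex A
  act σ d := opAct σ d
  one := opOne A
  circ h i _ _ _ hc := opCirc h i hc
  act_one d θ := Subtype.ext (permOp_one θ.1)
  act_mul σ τ d θ := Subtype.ext (permOp_mul σ τ θ.1)
  d_act σ d d' θ := opD_act σ d d' θ
  d_one := opD_one
  one_circ h i b hc η := Subtype.ext <| MultilinearMap.ext fun x => by
    obtain rfl := Subsingleton.elim i 0
    change graft h 0 b η.1 x 0 = η.1 x
    rw [graft_self]
    congr 1; funext l; congr 1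
    apply Fin.ext; simp [slot_inr_val]
  circ_one i a hc θ := Subtype.ext <| MultilinearMap.ext fun x => by
    change θ.1 (graft _ i 0 (fun a => a 0) x) = θ.1 x
    congr 1
    refine tuple_ext i ?_ fun j => ?_
    · rw [graft_self]; congr 1
    · rw [graft_ne, sgn_zero, ite_self]
      congr 1; apply Fin.ext
      rw [slot_inl_val]; simp
  d_circ h i a b c hc hc₁ hc₂ θ η := opD_circ h i hc hc₁ hc₂ θ η
  circ_seq h₁ h₂ h₃ h₄ i j a b c ab bc abc hab hbc h₅ h₆ θ η ζ := by
    subst hbc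
    exact Subtype.ext (compOp_seq h₁ h₂ h₃ h₄ i j b c θ.1 η.1 ζ.1)
  circ_par h₁ h₂ h₃ h₄ i j hij a b c ab ac abc hab hac h₅ h₆ θ η ζ :=
    Subtype.ext (compOp_par h₁ h₂ h₃ h₄ i j hij b c θ.1 η.2 ζ.1)
  circ_act h i a b c hc σ τ θ η := Subtype.ext (compOp_permOp h i b σ τ θ.1 η.2)

end EndLaws

/-! ### Semilinear chain maps and compatible operations -/

/-- A map of complexes that is linear over the ring homomorphism `φ` of the ground rings. -/
structure SemiMap {k : Type v} {K : Type*} [CommRing k] [CommRing K] (φ : k →+* K)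
    (A : CochainComplex (ModuleCat.{w} k) ℤ) (B : CochainComplex (ModuleCat.{w'} K) ℤ) where
  toFun (i : ℤ) : A.X i →+ B.X i
  map_smul (i : ℤ) (c : k) (x : A.X i) : toFun i (c • x) = φ c • toFun i x
  map_d (i j : ℤ) (x : A.X i) : toFun j (A.d i j x) = B.d i j (toFun i x)

/-- A morphism of complexes as a semilinear map over the identity. -/
def SemiMap.ofHom {k : Type v} [CommRing k] {A B : CochainComplex (ModuleCat.{w} k) ℤ}
    (f : A ⟶ B) : SemiMap (RingHom.id k) A B where
  toFun i := (f.f i).hom.toAddMonoidHom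
  map_smul i c x := by simp
  map_d i j x := by
    exact (ConcreteCategory.congr_hom (f.comm i j) x).symm

section SemiMap

variable {k : Type v} {K : Type*} [CommRing k] [CommRing K] {φ : k →+* K}
    {A : CochainComplex (ModuleCat.{w} k) ℤ} {B : CochainComplex (ModuleCat.{w'} K) ℤ}

/-- The induced map on direct sums. -/
def SemiMap.tot (f : SemiMap φ A B) : Tot A →+ Tot B := DirectSum.map f.toFun

variable (f : SemiMap φ A B)

lemma SemiMap.tot_lof (i : ℤ) (x : A.X i) :
    f.tot (lof k ℤ (fun i => A.X i) i x) = lof K ℤ (fun i => B.X i) i (f.toFun i x) :=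
  DirectSum.map_of _ _ _

lemma SemiMap.tot_mem {i : ℤ} {x : Tot A} (hx : x ∈ deg A i) : f.tot x ∈ deg B i := by
  obtain ⟨x, rfl⟩ := hx
  rw [f.tot_lof]; exact lof_mem _ _

lemma SemiMap.tot_smul (c : k) (x : Tot A) : f.tot (c • x) = φ c • f.tot x := by
  ext i
  simp only [SemiMap.tot, DirectSum.map_apply, DirectSum.smul_apply]
  exact f.map_smul i c (x i)

/-- `f.tot` as a linear map of `k`-modules -/
def SemiMap.totₗ : letI : Module k (Tot B) := Module.compHom _ φ; Tot A →ₗ[k] Tot B :=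
  letI : Module k (Tot B) := Module.compHom _ φ
  { f.tot with map_smul' := f.tot_smul }

lemma SemiMap.tot_sgn (c : ℤ) (x : Tot A) : f.tot (sgn A c x) = sgn B c (f.tot x) := by
  induction x using DirectSum.induction_on with
  | zero => simp
  | of i x =>
    have hx : DirectSum.of (fun i => A.X i) i x ∈ deg A i := lof_mem i x
    rw [sgn_of_mem hx, f.tot_smul, sgn_of_mem (f.tot_mem hx), sc_map]
  | add x y hx hy => simp [hx, hy]

lemma SemiMap.tot_dT (x : Tot A) : f.tot (dT A x) = dT B (f.tot x) := by
  induction x using DirectSum.induction_on with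
  | zero => simp
  | of i x =>
    have e : DirectSum.of (fun i => A.X i) i x = lof k ℤ (fun i => A.X i) i x := rfl
    rw [e, dT_lof, f.tot_lof, f.tot_lof, dT_lof, f.map_d]
  | add x y hx hy => simp [hx, hy]

/-- `f` intertwines the operations `θ` and `θ'`:
`f (θ (a₁, …, aₙ)) = θ' (f a₁, …, f aₙ)`. -/
def Rel {n : ℕ} (θ : Op A n) (θ' : Op B n) : Prop :=
  ∀ a : Fin n → Tot A, f.tot (θ a) = θ' fun i => f.tot (a i)

variable {f}

lemma rel_of_homog {n : ℕ} {θ : Op A n} {θ' : Op B n}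
    (h : ∀ (p : Fin n → ℤ) (a : Fin n → Tot A), (∀ i, a i ∈ deg A (p i)) →
      f.tot (θ a) = θ' fun i => f.tot (a i)) : Rel f θ θ' := by
  let _ : Module k (Tot B) := Module.compHom _ φ
  let F : MultilinearMap k (fun _ : Fin n => Tot A) (Tot B) := f.totₗ.compMultilinearMap θ
  let G : MultilinearMap k (fun _ : Fin n => Tot A) (Tot B) :=
    MultilinearMap.mk' (fun a => θ' fun i => f.tot (a i))
      (fun a i x y => by
        have : ∀ x, (fun j => f.tot (Function.update a i x j)) =
          Function.update (fun j => f.tot (a j)) i (f.tot x) := fun x => funext fun j =>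
            Function.apply_update (fun _ => f.tot) a i x j
        simp only [this, map_add, MultilinearMap.map_update_add])
      (fun a i c x => by
        have : ∀ x, (fun j => f.tot (Function.update a i x j)) =
          Function.update (fun j => f.tot (a j)) i (f.tot x) := fun x => funext fun j =>
            Function.apply_update (fun _ => f.tot) a i x j
        simp only [this, f.tot_smul, MultilinearMap.map_update_smul]
        rfl)
  have : F = G := op_ext fun p a ha => h p a ha
  exact fun a => congrArg (fun F => F a) this

lemma rel_add {n : ℕ} {θ η : Op A n} {θ' η' : Op B n} (h : Rel f θ θ') (h' : Rel f η η') :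
    Rel f (θ + η) (θ' + η') := fun a => by
  rw [_root_.add_apply, map_add, h, h']; rfl

lemma rel_zero {n : ℕ} : Rel f (0 : Op A n) (0 : Op B n) := fun a => by simp

lemma rel_smul {n : ℕ} {θ : Op A n} {θ' : Op B n} (c : k) (h : Rel f θ θ') :
    Rel f (c • θ) (φ c • θ') := fun a => by
  rw [_root_.smul_apply, f.tot_smul, h]; rfl

lemma rel_dOp {n : ℕ} {θ : Op A n} {θ' : Op B n} (c : ℤ) (h : Rel f θ θ') :
    Rel f (dOp c θ) (dOp c θ') := fun a => by
  have : ∀ i j : Fin n, ∀ x, f.tot (dMap A i j x) = dMap B i j (f.tot x) := fun i j x => by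
    unfold dMap
    split_ifs
    · exact f.tot_sgn _ _
    · exact f.tot_dT _
    · rfl
  rw [dOp_apply, dOp_apply, map_sub, f.tot_smul, map_sum, f.tot_dT, h, sc_map]
  simp only [h _, this]

lemma rel_permOp {n : ℕ} {θ : Op A n} {θ' : Op B n} (σ : Equiv.Perm (Fin n))
    (h : Rel f θ θ') : Rel f (permOp σ θ) (permOp σ θ') :=
  rel_of_homog fun p a ha => by
    rw [permOp_apply _ _ p a ha, f.tot_smul, h, sc_map,
      permOp_apply _ _ p _ fun i => f.tot_mem (ha i)]

lemma rel_compOp {m n r : ℕ} (h : m + n = r + 1) (i : Fin m) (b : ℤ) {θ : Op A m} {θ' : Op B m}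
    {η : Op A n} {η' : Op B n} (hθ : Rel f θ θ') (hη : Rel f η η') :
    Rel f (compOp h i b θ η) (compOp h i b θ' η') := fun a => by
  rw [compOp_apply, compOp_apply, hθ]
  congr 1
  refine tuple_ext i ?_ fun j => ?_
  · rw [graft_self, graft_self, hη]
  · rw [graft_ne, graft_ne]
    split_ifs
    · exact f.tot_sgn _ _
    · rfl

lemma rel_opOne : Rel f (opOne A).1 (opOne B).1 := fun _ => rfl

end SemiMap

/-! ### Algebras over operads -/

/-- The structures of an `E`-algebra on the complex `A`: morphisms of operads from `E` to the
endomorphism operad of `A`. -/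
abbrev AlgStr {k : Type v} [CommRing k] (E : Operad.{v, w} k)
    (A : CochainComplex (ModuleCat.{w'} k) ℤ) := Operad.Hom (RingHom.id k) E (EndOp A)

/-- The operation on `A` given by `x ∈ E(n)` of degree `d`. -/
def AlgStr.op {k : Type v} [CommRing k] {E : Operad.{v, w} k}
    {A : CochainComplex (ModuleCat.{w'} k) ℤ} (s : AlgStr E A) {n : ℕ} {d : ℤ}
    (x : (E.obj n).X d) : Op A n := Subtype.val (p := (· ∈ opDeg A n d)) (s.toFun n d x)

/-- The chain map `f` is a map of `E`-algebras. -/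
def IsAlgHom {k : Type v} [CommRing k] {E : Operad.{v, w} k}
    {A B : CochainComplex (ModuleCat.{w'} k) ℤ} (s : AlgStr E A) (t : AlgStr E B) (f : A ⟶ B) :
    Prop :=
  ∀ (n : ℕ) (d : ℤ) (x : (E.obj n).X d), Rel (SemiMap.ofHom f) (s.op x) (t.op x)

/-- An `E`-algebra. -/
structure AlgCat {k : Type v} [CommRing k] (E : Operad.{v, w} k) where
  cpx : CochainComplex (ModuleCat.{w'} k) ℤ
  str : AlgStr E cpx

lemma SemiMap.ofHom_id_tot {k : Type v} [CommRing k] (A : CochainComplex (ModuleCat.{w} k) ℤ)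
    (x : Tot A) : (SemiMap.ofHom (𝟙 A)).tot x = x := by
  ext i; simp [SemiMap.tot, SemiMap.ofHom]

lemma SemiMap.ofHom_comp_tot {k : Type v} [CommRing k]
    {A B C : CochainComplex (ModuleCat.{w} k) ℤ} (f : A ⟶ B) (g : B ⟶ C) (x : Tot A) :
    (SemiMap.ofHom (f ≫ g)).tot x = (SemiMap.ofHom g).tot ((SemiMap.ofHom f).tot x) := by
  ext i; simp [SemiMap.tot, SemiMap.ofHom]

/-- The category of `E`-algebras. -/
instance algCategory {k : Type v} [CommRing k] (E : Operad.{v, w} k) :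
    Category (AlgCat.{v, w, w'} E) where
  Hom A B := {f : A.cpx ⟶ B.cpx // IsAlgHom A.str B.str f}
  id A := ⟨𝟙 A.cpx, fun n d x a => by simp only [SemiMap.ofHom_id_tot]⟩
  comp f g := ⟨f.1 ≫ g.1, fun n d x a => by
    simp only [SemiMap.ofHom_comp_tot]
    rw [f.2, g.2]⟩

/-! ### Normalized cochains of simplicial sets -/

section Cochains

variable (k : Type) [CommRing k]

/-- The `m`-simplices of `X`. -/
abbrev Sx (X : SSet.{u}) (m : ℕ) : Type u := X.obj (op (SimplexCategory.mk m))

/-- The normalized cochains of degree `i` of the simplicial set `X` with coefficients in `k`: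
functions on the simplices of `X` that vanish on the simplices of dimension `≠ i` and on the
degenerate simplices. -/
def nCoch (X : SSet.{u}) (i : ℤ) : Submodule k ((Σ m : ℕ, Sx X m) → k) where
  carrier := {f | ∀ (m : ℕ) (x : Sx X m), ((m : ℤ) ≠ i ∨ x ∈ X.degenerate m) → f ⟨m, x⟩ = 0}
  add_mem' h h' m x hx := by simp [h m x hx, h' m x hx]
  zero_mem' _ _ _ := rfl
  smul_mem' c _ h m x hx := by simp [h m x hx]

/-- The coboundary: the alternating sum over the faces. -/
def coboundary (X : SSet.{u}) : ((Σ m : ℕ, Sx X m) → k) →ₗ[k] ((Σ m : ℕ, Sx X m) → k) where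
  toFun f := fun
    | ⟨0, _⟩ => 0
    | ⟨m + 1, x⟩ => ∑ j : Fin (m + 2), (-1) ^ (j : ℕ) * f ⟨m, X.δ j x⟩
  map_add' f g := by
    funext ⟨m, x⟩
    cases m with
    | zero => simp
    | succ m => simp [mul_add, Finset.sum_add_distrib]
  map_smul' c f := by
    funext ⟨m, x⟩
    cases m with
    | zero => simp
    | succ m => simp [Finset.mul_sum, mul_left_comm]

lemma coboundary_zero (X : SSet.{u}) (f : (Σ m : ℕ, Sx X m) → k) (x : Sx X 0) :
    coboundary k X f ⟨0, x⟩ = 0 := rfl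

lemma coboundary_succ (X : SSet.{u}) (f : (Σ m : ℕ, Sx X m) → k) (m : ℕ) (x : Sx X (m + 1)) :
    coboundary k X f ⟨m + 1, x⟩ = ∑ j : Fin (m + 2), (-1) ^ (j : ℕ) * f ⟨m, X.δ j x⟩ := rfl

lemma coboundary_coboundary (X : SSet.{u}) (f : (Σ m : ℕ, Sx X m) → k) :
    coboundary k X (coboundary k X f) = 0 := by
  funext ⟨m, x⟩
  match m, x with
  | 0, x => rfl
  | 1, x => simp [coboundary_succ, coboundary_zero]
  | n + 2, x =>
    simp only [coboundary_succ, Finset.mul_sum, Pi.zero_apply]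
    rw [← Fintype.sum_prod_type' (fun (i : Fin (n + 3)) (j : Fin (n + 2)) => (-1 : k) ^ (i : ℕ) * ((-1) ^ (j : ℕ) * f ⟨n, X.δ j (X.δ i x)⟩))]
    let P := Fin (n + 3) × Fin (n + 2)
    let S : Finset P := {ij : P | (ij.1 : ℕ) ≤ (ij.2 : ℕ)}
    rw [← Finset.sum_add_sum_compl S, ← eq_neg_iff_add_eq_zero, ← Finset.sum_neg_distrib]
    let F : ∀ ij : P, ij ∈ S → P := fun ij hij =>
      (ij.2.succ, Fin.castLT ij.1 (lt_of_le_of_lt (Finset.mem_filter.mp hij).right (Fin.is_lt ij.2)))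
    apply Finset.sum_bij F
    · intro ij hij
      simp_rw [S, F, Finset.compl_filter, Finset.mem_filter_univ, Fin.val_succ,
        Fin.val_castLT] at hij ⊢
      omega
    · rintro ⟨i, j⟩ hij ⟨i', j'⟩ hij' h
      refine Prod.ext (Fin.ext ?_) (Fin.succ_injective _ (congrArg Prod.fst h))
      exact congrArg (fun x => (Prod.snd x : Fin (n + 2)).1) h
    · rintro ⟨i', j'⟩ hij'
      simp_rw [S, Finset.compl_filter, Finset.mem_filter_univ, not_le] at hij'
      refine ⟨(Fin.castSucc j', i'.pred ?_), ?_, ?_⟩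
      · rintro rfl
        simp only [Fin.val_zero, not_lt_zero] at hij'
      · simp [S]; omega
      · simp only [F, Fin.castLT_castSucc, Fin.succ_pred]
    · rintro ⟨i, j⟩ hij
      simp only [F, Fin.val_succ, Fin.val_castLT, pow_succ]
      have : X.δ j (X.δ i x) = X.δ (i.castLT (lt_of_le_of_lt (Finset.mem_filter.mp hij).right
          (Fin.is_lt j))) (X.δ j.succ x) := by
        have := SimplicialObject.δ_comp_δ'' X (i := i) (j := j)
          (by
            rw [Fin.le_def]; simpa [S] using hij)
        exact (congrArg (fun g => g x) this).symm
      rw [this]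
      ring

lemma δ_σ_degenerate (X : SSet.{u}) {m : ℕ} (j : Fin (m + 1)) (i : Fin (m + 2)) (y : Sx X m)
    (h1 : i ≠ j.castSucc) (h2 : i ≠ j.succ) : X.δ i (X.σ j y) ∈ X.degenerate m := by
  have e : X.δ i (X.σ j y) = X.map (SimplexCategory.δ i ≫ SimplexCategory.σ j).op y := by
    simp [SimplicialObject.δ, SimplicialObject.σ]
  rw [e]
  obtain ⟨a, ha⟩ := Fin.exists_succAbove_eq h1.symm
  obtain ⟨b, hb⟩ := Fin.exists_succAbove_eq h2.symm
  have hab : a ≠ b := by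
    rintro rfl
    have := ha.symm.trans hb
    exact (Fin.castSucc_lt_succ).ne this
  have hni : ¬ Function.Injective (SimplexCategory.δ i ≫ SimplexCategory.σ j).toOrderHom := by
    intro hinj
    apply hab
    apply hinj
    simp [SimplexCategory.δ, SimplexCategory.σ, ha, hb, SimplexCategory.mkHom]
  cases m with
  | zero => exact absurd (Subsingleton.elim (α := Fin 1) a b) hab
  | succ m =>
    obtain ⟨l, θ, hθ⟩ := SimplexCategory.eq_σ_comp_of_not_injective _ hni
    exact ⟨m, by omega, SimplexCategory.σ l, X.map θ.op y, by rw [hθ]; simp⟩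

lemma coboundary_mem (X : SSet.{u}) (i : ℤ) {f : (Σ m : ℕ, Sx X m) → k} (hf : f ∈ nCoch k X i) :
    coboundary k X f ∈ nCoch k X (i + 1) := by
  intro m x hx
  cases m with
  | zero => rfl
  | succ m =>
    rw [coboundary_succ]
    rcases hx with hx | hx
    · refine Finset.sum_eq_zero fun j _ => ?_
      rw [hf m _ (Or.inl (fun h => hx (by push_cast; omega))), mul_zero]
    · rw [SSet.degenerate_eq_iUnion_range_σ, Set.mem_iUnion] at hx
      obtain ⟨j, y, rfl⟩ := hx
      have hne : j.castSucc ≠ j.succ := (Fin.castSucc_lt_succ).ne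
      rw [Fintype.sum_eq_add j.castSucc j.succ hne]
      · have e1 : X.δ j.castSucc (X.σ j y) = y :=
          congrArg (fun g => g y) (SimplicialObject.δ_comp_σ_self X (i := j))
        have e2 : X.δ j.succ (X.σ j y) = y :=
          congrArg (fun g => g y) (SimplicialObject.δ_comp_σ_succ X (i := j))
        rw [e1, e2]
        simp only [Fin.val_castSucc, Fin.val_succ, pow_succ]
        ring
      · rintro l ⟨h1, h2⟩
        rw [hf m _ (Or.inr (δ_σ_degenerate X j l y h1 h2)), mul_zero]

/-- The normalized cochain complex of the simplicial set `X` with coefficients in `k`. -/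
def nCochains (X : SSet.{u}) : CochainComplex (ModuleCat.{u} k) ℤ where
  X i := ModuleCat.of k (nCoch k X i)
  d i j := ModuleCat.ofHom (if h : i + 1 = j then
    (coboundary k X).restrict (q := nCoch k X j) fun f hf => h ▸ coboundary_mem k X i hf else 0)
  shape i j h := by
    have h : ¬ i + 1 = j := h
    simp only [h, dite_false]; rfl
  d_comp_d' i j l h h' := by
    have h : i + 1 = j := h
    have h' : j + 1 = l := h'
    subst h h'
    simp only [dite_true]
    exact ModuleCat.hom_ext (LinearMap.ext fun f => Subtype.ext (coboundary_coboundary k X f.1))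

lemma nCochains_d_succ (X : SSet.{u}) (i : ℤ) (f : nCoch k X i) :
    Subtype.val (p := (· ∈ nCoch k X (i + 1))) ((nCochains k X).d i (i + 1) f) =
      coboundary k X f.1 := by
  have : ((nCochains k X).d i (i + 1)) = ModuleCat.ofHom
    ((coboundary k X).restrict (q := nCoch k X (i + 1)) fun f hf => coboundary_mem k X i hf) := by
    simp only [nCochains, dite_true]
  rw [this]; rfl

lemma nCochains_d_ne (X : SSet.{u}) {i j : ℤ} (h : ¬ i + 1 = j) (f : (nCochains k X).X i) :
    (nCochains k X).d i j f = 0 := by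
  rw [(nCochains k X).shape i j h]; rfl

variable {k} in
/-- Chain maps out of `nCochains` are checked on the coboundary. -/
lemma nCochains_map_d {K : Type} [CommRing K] {X Y : SSet.{u}}
    (F : ∀ i, nCoch k Y i →+ nCoch K X i)
    (h : ∀ i (f : nCoch k Y i) (g : nCoch k Y (i + 1)), g.1 = coboundary k Y f.1 →
      (F (i + 1) g).1 = coboundary K X (F i f).1)
    (i j : ℤ) (f : nCoch k Y i) :
    F j ((nCochains k Y).d i j f) = (nCochains K X).d i j (F i f) := by
  by_cases hij : i + 1 = j
  · subst hij
    refine Subtype.ext ?_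
    rw [nCochains_d_succ]
    exact h i f _ (nCochains_d_succ k Y i f)
  · exact ((congrArg (F j) (nCochains_d_ne k Y hij f)).trans (map_zero (F j))).trans
      (nCochains_d_ne K X hij _).symm

/-- Pull-back of cochains of degree `i`. -/
def nPull {X Y : SSet.{u}} (g : X ⟶ Y) (i : ℤ) : nCoch k Y i →ₗ[k] nCoch k X i where
  toFun f := ⟨fun x => f.1 ⟨x.1, g.app _ x.2⟩, fun m _ hx =>
    f.2 m _ (hx.imp id fun h => SSet.degenerate_le_preimage g m h)⟩
  map_add' _ _ := rfl
  map_smul' _ _ := rfl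

/-- The map of normalized cochain complexes induced by a map of simplicial sets. -/
def nMap {X Y : SSet.{u}} (g : X ⟶ Y) : nCochains k Y ⟶ nCochains k X where
  f i := ModuleCat.ofHom (nPull k g i)
  comm' i j _ := ModuleCat.hom_ext (LinearMap.ext fun f =>
    (nCochains_map_d (fun i => (nPull k g i).toAddMonoidHom) (fun i f f' hf => by
      funext ⟨m, x⟩
      change f'.1 ⟨m, g.app _ x⟩ = _
      rw [hf]
      cases m with
      | zero => rfl
      | succ m =>
        rw [coboundary_succ, coboundary_succ]
        refine Finset.sum_congr rfl fun l _ => ?_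
        have : X.δ l ≫ g.app _ = g.app _ ≫ Y.δ l := g.naturality _
        have := congrArg (fun h => h x) this
        change _ = (-1) ^ (l : ℕ) * f.1 ⟨m, g.app _ (X.δ l x)⟩
        rw [show g.app _ (X.δ l x) = Y.δ l (g.app _ x) from this]) i j f).symm)

/-- The map of cochains induced by a homomorphism of the coefficient rings. -/
def nCoeff {k K : Type} [CommRing k] [CommRing K] (φ : k →+* K) (X : SSet.{u}) :
    SemiMap φ (nCochains k X) (nCochains K X) where
  toFun i := 
    { toFun := fun f : nCoch k X i => (⟨fun x => φ (f.1 x), fun m x hx => by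
        simp only [f.2 m x hx, map_zero]⟩ : nCoch K X i)
      map_zero' := Subtype.ext (funext fun x => map_zero φ)
      map_add' := fun f g => Subtype.ext (funext fun x => map_add φ _ _) }
  map_smul i c f := Subtype.ext (funext fun x => map_mul φ _ _)
  map_d i j f := nCochains_map_d
    (fun i => 
    { toFun := fun f : nCoch k X i => (⟨fun x => φ (f.1 x), fun m x hx => by
        simp only [f.2 m x hx, map_zero]⟩ : nCoch K X i)
      map_zero' := Subtype.ext (funext fun x => map_zero φ)
      map_add' := fun f g => Subtype.ext (funext fun x => map_add φ _ _) })
    (fun i f f' hf => by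
      funext ⟨m, x⟩
      change φ (f'.1 ⟨m, x⟩) = _
      rw [hf]
      cases m with
      | zero => exact map_zero φ
      | succ m => simp [coboundary_succ]) i j f

end Cochains

/-! ### The Eilenberg–Zilber operad and its action on cochains -/

section EZ

variable (k : Type) [CommRing k]

/-- The normalized cochains of the standard simplex `Δ[m]`. -/
abbrev simplexCochains (m : ℕ) : CochainComplex (ModuleCat.{u} k) ℤ :=
  nCochains k (SSet.stdSimplex.{u}.obj (SimplexCategory.mk m))

instance famGroup (A : ℕ → CochainComplex (ModuleCat.{u} k) ℤ) (n : ℕ) (d : ℤ) :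
    AddCommGroup (∀ m, opDeg (A m) n d) := Pi.addCommGroup

instance famMonoid (A : ℕ → CochainComplex (ModuleCat.{u} k) ℤ) (n : ℕ) (d : ℤ) :
    AddCommMonoid (∀ m, opDeg (A m) n d) := AddCommGroup.toAddCommMonoid

instance famModule (A : ℕ → CochainComplex (ModuleCat.{u} k) ℤ) (n : ℕ) (d : ℤ) :
    Module k (∀ m, opDeg (A m) n d) := Pi.module _ _ _

/-- The `n`-ary operations of degree `d` of the Eilenberg–Zilber operad: the multilinear
operations on the normalized cochains of the standard simplices that are natural with respect
to all simplicial operators. -/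
def zDeg (n : ℕ) (d : ℤ) : Submodule k (∀ m : ℕ, opDeg (simplexCochains.{u} k m) n d) where
  carrier := {θ | ∀ (m m' : ℕ) (α : SimplexCategory.mk m ⟶ SimplexCategory.mk m'),
    Rel (SemiMap.ofHom (nMap k (SSet.stdSimplex.{u}.map α))) (θ m').1 (θ m).1}
  add_mem' h h' m m' α := rel_add (h m m' α) (h' m m' α)
  zero_mem' _ _ _ := rel_zero
  smul_mem' c _ h m m' α := rel_smul c (h m m' α)

variable {k}

lemma rel_opD {A B : CochainComplex (ModuleCat.{w} k) ℤ} {f : SemiMap (RingHom.id k) A B} {n : ℕ}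
    {c d : ℤ} {θ : opDeg A n c} {θ' : opDeg B n c} (h : Rel f θ.1 θ'.1) :
    Rel f (opD c d θ).1 (opD c d θ').1 := by
  by_cases hcd : c + 1 = d
  · subst hcd
    rw [opD_succ, opD_succ]; exact rel_dOp c h
  · rw [opD_ne hcd, opD_ne hcd]; exact rel_zero

/-- The differential of the Eilenberg–Zilber operad. -/
def zD {n : ℕ} (c d : ℤ) : zDeg.{u} k n c →ₗ[k] zDeg.{u} k n d where
  toFun θ := ⟨fun m => opD c d (θ.1 m), fun m m' α => rel_opD (θ.2 m m' α)⟩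
  map_add' θ θ' := Subtype.ext (funext fun m => map_add (opD c d) (θ.1 m) (θ'.1 m))
  map_smul' s θ := Subtype.ext (funext fun m => map_smul (opD c d) s (θ.1 m))

/-- The symmetric group action of the Eilenberg–Zilber operad. -/
def zPerm {n : ℕ} (σ : Equiv.Perm (Fin n)) (d : ℤ) : zDeg.{u} k n d →ₗ[k] zDeg.{u} k n d where
  toFun θ := ⟨fun m => opAct σ d (θ.1 m), fun m m' α => rel_permOp σ (θ.2 m m' α)⟩
  map_add' θ θ' := Subtype.ext (funext fun m => map_add (opAct σ d) (θ.1 m) (θ'.1 m))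
  map_smul' s θ := Subtype.ext (funext fun m => map_smul (opAct σ d) s (θ.1 m))

/-- The partial composition of the Eilenberg–Zilber operad. -/
def zCirc {m n r : ℕ} (h : m + n = r + 1) (i : Fin m) {a b c : ℤ} (hc : a + b = c) :
    zDeg.{u} k m a →ₗ[k] zDeg.{u} k n b →ₗ[k] zDeg.{u} k r c :=
  LinearMap.mk₂ k (fun θ η => ⟨fun l => opCirc h i hc (θ.1 l) (η.1 l), fun l l' α =>
      rel_compOp h i b (θ.2 l l' α) (η.2 l l' α)⟩)
    (fun θ θ' η => Subtype.ext (funext fun l =>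
      LinearMap.map_add₂ (opCirc h i hc) (θ.1 l) (θ'.1 l) (η.1 l)))
    (fun s θ η => Subtype.ext (funext fun l =>
      LinearMap.map_smul₂ (opCirc h i hc) s (θ.1 l) (η.1 l)))
    (fun θ η η' => Subtype.ext (funext fun l => map_add (opCirc h i hc (θ.1 l)) (η.1 l) (η'.1 l)))
    (fun s θ η => Subtype.ext (funext fun l => map_smul (opCirc h i hc (θ.1 l)) s (η.1 l)))

variable (k) in
/-- The Eilenberg–Zilber operad over `k`: the suboperad, of the product over `m` of the
endomorphism operads of the normalized cochain complexes of `Δ[m]`, of the natural operations. -/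
def EZ : Operad.{0, u} k where
  obj n :=
    { X := fun d => ModuleCat.of k (zDeg.{u} k n d)
      d := fun c d => ModuleCat.ofHom (zD c d)
      shape := fun c d h => ModuleCat.hom_ext <| LinearMap.ext fun θ => Subtype.ext <|
        funext fun m => opD_ne h (θ.1 m)
      d_comp_d' := fun c d e h h' => by
        have h : c + 1 = d := h
        have h' : d + 1 = e := h'
        subst h h'
        refine ModuleCat.hom_ext (LinearMap.ext fun θ => Subtype.ext (funext fun m =>
          Subtype.ext ?_))
        change (opD (c + 1) (c + 1 + 1) (opD c (c + 1) (θ.1 m))).1 = 0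
        rw [opD_succ, opD_succ, dOp_dOp] }
  act σ d := zPerm σ d
  one := ⟨fun m => opOne _, fun m m' α => rel_opOne⟩
  circ h i _ _ _ hc := zCirc h i hc
  act_one d θ := Subtype.ext (funext fun m => (EndOp (simplexCochains k m)).act_one d (θ.1 m))
  act_mul σ τ d θ :=
    Subtype.ext (funext fun m => (EndOp (simplexCochains k m)).act_mul σ τ d (θ.1 m))
  d_act σ d d' θ := Subtype.ext (funext fun m => opD_act σ d d' (θ.1 m))
  d_one := Subtype.ext (funext fun m => opD_one)
  one_circ h i b hc η :=
    Subtype.ext (funext fun m => (EndOp (simplexCochains k m)).one_circ h i hc (η.1 m))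
  circ_one i a hc θ :=
    Subtype.ext (funext fun m => (EndOp (simplexCochains k m)).circ_one i hc (θ.1 m))
  d_circ h i a b c hc hc₁ hc₂ θ η :=
    Subtype.ext (funext fun m => opD_circ h i hc hc₁ hc₂ (θ.1 m) (η.1 m))
  circ_seq h₁ h₂ h₃ h₄ i j a b c ab bc abc hab hbc h₅ h₆ θ η ζ :=
    Subtype.ext (funext fun m => (EndOp (simplexCochains k m)).circ_seq h₁ h₂ h₃ h₄ i j hab hbc
      h₅ h₆ (θ.1 m) (η.1 m) (ζ.1 m))
  circ_par h₁ h₂ h₃ h₄ i j hij a b c ab ac abc hab hac h₅ h₆ θ η ζ :=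
    Subtype.ext (funext fun m => (EndOp (simplexCochains k m)).circ_par h₁ h₂ h₃ h₄ i j hij hab
      hac h₅ h₆ (θ.1 m) (η.1 m) (ζ.1 m))
  circ_act h i a b c hc σ τ θ η :=
    Subtype.ext (funext fun m => (EndOp (simplexCochains k m)).circ_act h i hc σ τ
      (θ.1 m) (η.1 m))

variable (X : SSet.{u})

variable (k) in
/-- The map of cochains `x^*` induced by the map `Δ[m] ⟶ X` that classifies a simplex `x`. -/
abbrev classify {X : SSet.{u}} {m : ℕ} (x : Sx X m) :
    SemiMap (RingHom.id k) (nCochains k X) (simplexCochains.{u} k m) :=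
  SemiMap.ofHom (nMap k (SSet.yonedaEquiv.symm x))

/-- The tautological `m`-simplex of `Δ[m]`. -/
abbrev iota (m : ℕ) : Sx (SSet.stdSimplex.{u}.obj (SimplexCategory.mk m)) m :=
  SSet.stdSimplex.objEquiv.symm (𝟙 _)

variable {X}

variable (k) in
/-- The value of the component of degree `q` of a cochain at a simplex. -/
def evalAt {m : ℕ} (x : Sx X m) (q : ℤ) : Tot (nCochains k X) →ₗ[k] k where
  toFun z := Subtype.val (p := (· ∈ nCoch k X q)) (z q) ⟨m, x⟩
  map_add' _ _ := rfl
  map_smul' _ _ := rfl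

lemma evalAt_lof {m : ℕ} (x : Sx X m) (q : ℤ) (f : nCoch k X q) :
    evalAt k x q (lof k ℤ (fun i => (nCochains k X).X i) q f) = f.1 ⟨m, x⟩ := by
  change Subtype.val (p := (· ∈ nCoch k X q)) _ _ = _
  exact congrFun (congrArg (Subtype.val (p := (· ∈ nCoch k X q)))
    (DirectSum.of_eq_same (β := fun i => (nCochains k X).X i) q f)) ⟨m, x⟩

lemma evalAt_nMap {Y : SSet.{u}} (g : Y ⟶ X) {m : ℕ} (y : Sx Y m) (q : ℤ)
    (z : Tot (nCochains k X)) :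
    evalAt k y q ((SemiMap.ofHom (nMap k g)).tot z) = evalAt k (g.app _ y) q z := rfl

lemma evalAt_degenerate {m : ℕ} {x : Sx X m} (hx : x ∈ X.degenerate m) (q : ℤ)
    (z : Tot (nCochains k X)) : evalAt k x q z = 0 :=
  Subtype.property (p := (· ∈ nCoch k X q)) (z q) m x (Or.inr hx)

lemma evalAt_ne {m : ℕ} (x : Sx X m) {q : ℤ} (h : (m : ℤ) ≠ q)
    (z : Tot (nCochains k X)) : evalAt k x q z = 0 :=
  Subtype.property (p := (· ∈ nCoch k X q)) (z q) m x (Or.inl h)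

lemma evalAt_ext {z z' : Tot (nCochains k X)}
    (h : ∀ (m : ℕ) (x : Sx X m) (q : ℤ), evalAt k x q z = evalAt k x q z') : z = z' := by
  refine DFinsupp.ext fun q => Subtype.ext (funext fun ⟨m, x⟩ => h m x q)

lemma yoneda_app {m l : ℕ} (x : Sx X m) (α : SimplexCategory.mk l ⟶ SimplexCategory.mk m) :
    (SSet.yonedaEquiv.symm x).app (op (SimplexCategory.mk l)) (SSet.stdSimplex.objEquiv.symm α) =
      X.map α.op x := rfl

lemma yoneda_iota {m : ℕ} (x : Sx X m) :
    (SSet.yonedaEquiv.symm x).app (op (SimplexCategory.mk m)) (iota m) = x := by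
  rw [iota, yoneda_app]; simp

lemma classify_map {m l : ℕ} (x : Sx X m) (α : SimplexCategory.mk l ⟶ SimplexCategory.mk m)
    (z : Tot (nCochains k X)) :
    (classify k (X.map α.op x)).tot z =
      (SemiMap.ofHom (nMap k (SSet.stdSimplex.{u}.map α))).tot ((classify k x).tot z) := by
  refine evalAt_ext fun j y q => ?_
  rw [evalAt_nMap, evalAt_nMap, evalAt_nMap]
  congr 1
  obtain ⟨β, rfl⟩ := SSet.stdSimplex.objEquiv.symm.surjective y
  rw [yoneda_app, ← SSet.stdSimplex.objEquiv_symm_comp, yoneda_app]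
  simp

lemma classify_ext {z z' : Tot (nCochains k X)}
    (h : ∀ (m : ℕ) (x : Sx X m), (classify k x).tot z = (classify k x).tot z') : z = z' := by
  refine evalAt_ext fun m x q => ?_
  have := congrArg (evalAt k (iota m) q) (h m x)
  rwa [evalAt_nMap, evalAt_nMap, yoneda_iota] at this

/-- The pullback along the classifying map of a simplex, as a linear map. -/
def pullLin {m : ℕ} (x : Sx X m) : Tot (nCochains k X) →ₗ[k] Tot (simplexCochains.{u} k m) where
  toFun := (classify k x).tot
  map_add' := map_add _
  map_smul' c z := SemiMap.tot_smul _ c z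

/-- The value at the simplex `x` of a natural operation on homogeneous cochains `a i`. -/
def zVal {n : ℕ} {d : ℤ} (θ : zDeg.{u} k n d) (p : Fin n → ℤ) {m : ℕ} (x : Sx X m) :
    MultilinearMap k (fun i => (nCochains k X).X (p i)) k :=
  ((evalAt k (iota m) (∑ i, p i + d)).compMultilinearMap (θ.1 m).1).compLinearMap
    fun i => (pullLin x).comp (lof k ℤ (fun i => (nCochains k X).X i) (p i))

lemma zVal_mem {n : ℕ} {d : ℤ} (θ : zDeg.{u} k n d) (p : Fin n → ℤ)
    (a : ∀ i, (nCochains k X).X (p i)) :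
    (fun s : Σ m : ℕ, Sx X m => zVal θ p s.2 a) ∈ nCoch k X (∑ i, p i + d) := by
  rintro m x (hx | ⟨l, hl, α, y, rfl⟩)
  · exact evalAt_ne _ hx _
  · change evalAt k (iota m) _ ((θ.1 m).1 fun i => (classify k (X.map α.op y)).tot _) = 0
    simp only [classify_map]
    rw [← θ.2 m l α, evalAt_nMap]
    refine evalAt_degenerate ⟨l, hl, α, iota l, ?_⟩ _ _
    rw [SSet.stdSimplex.map_objEquiv_symm, ← SSet.stdSimplex.objEquiv_symm_comp]
    simp

/-- The value of a natural operation on homogeneous cochains `a i` of degree `p i`. -/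
def zEval {n : ℕ} {d : ℤ} (θ : zDeg.{u} k n d) (p : Fin n → ℤ) :
    MultilinearMap k (fun i => (nCochains k X).X (p i)) (nCoch k X (∑ i, p i + d)) :=
  MultilinearMap.mk' (fun a => ⟨fun s => zVal θ p s.2 a, zVal_mem θ p a⟩)
    (fun a i x y => Subtype.ext <| funext fun s => (zVal θ p s.2).map_update_add a i x y)
    (fun a i c x => Subtype.ext <| funext fun s => (zVal θ p s.2).map_update_smul a i c x)

variable (X) in
/-- The operation on the cochains of `X` given by an element of the Eilenberg–Zilber operad:
its value on the cochains `a i` at a simplex `x` is the value of the given operation on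
`x^* (a i)` at the tautological simplex. -/
def zOp {n : ℕ} {d : ℤ} (θ : zDeg.{u} k n d) : Op (nCochains k X) n :=
  MultilinearMap.fromDirectSumEquiv fun p =>
    (lof k ℤ (fun i => (nCochains k X).X i) (∑ i, p i + d)).compMultilinearMap (zEval θ p)

lemma zOp_lof {n : ℕ} {d : ℤ} (θ : zDeg.{u} k n d) (p : Fin n → ℤ)
    (a : ∀ i, (nCochains k X).X (p i)) :
    zOp X θ (fun i => lof k ℤ (fun i => (nCochains k X).X i) (p i) (a i)) =
      lof k ℤ (fun i => (nCochains k X).X i) (∑ i, p i + d) (zEval θ p a) := by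
  rw [zOp, MultilinearMap.fromDirectSumEquiv_lof]; rfl

lemma zOp_mem {n : ℕ} {d : ℤ} (θ : zDeg.{u} k n d) : zOp X θ ∈ opDeg (nCochains k X) n d := by
  intro p a ha
  choose x hx using ha
  obtain rfl : (fun i => lof k ℤ (fun i => (nCochains k X).X i) (p i) (x i)) = a := funext hx
  rw [zOp_lof]; exact lof_mem _ _

lemma evalAt_mem_ne {m : ℕ} (x : Sx X m) {q q' : ℤ} (h : q' ≠ q) {z : Tot (nCochains k X)}
    (hz : z ∈ deg _ q) : evalAt k x q' z = 0 := by
  obtain ⟨z, rfl⟩ := hz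
  have : (lof k ℤ (fun i => (nCochains k X).X i) q z) q' = 0 :=
    DirectSum.of_eq_of_ne (β := fun i => (nCochains k X).X i) q q' z h
  change Subtype.val (p := (· ∈ nCoch k X q')) _ _ = _
  rw [this]; rfl

lemma zOp_rel {n : ℕ} {d : ℤ} (θ : zDeg.{u} k n d) {m : ℕ} (x : Sx X m) :
    Rel (classify k x) (zOp X θ) (θ.1 m).1 := by
  refine rel_of_homog fun p a ha => evalAt_ext fun l y q => ?_
  by_cases hq : q = ∑ i, p i + d
  · subst hq
    choose b hb using ha
    obtain rfl : (fun i => lof k ℤ (fun i => (nCochains k X).X i) (p i) (b i)) = a := funext hb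
    obtain ⟨α, rfl⟩ := SSet.stdSimplex.objEquiv.symm.surjective y
    rw [evalAt_nMap, yoneda_app, zOp_lof, evalAt_lof]
    change evalAt k (iota l) _ ((θ.1 l).1 fun i => (classify k (X.map α.op x)).tot _) = _
    simp only [classify_map]
    rw [← θ.2 l m α, evalAt_nMap]
    congr 2
    rw [← SSet.stdSimplex.objEquiv_symm_comp]
    simp
  · rw [evalAt_mem_ne _ hq (SemiMap.tot_mem _ (zOp_mem θ p a ha)),
      evalAt_mem_ne _ hq ((θ.1 m).2 p _ fun i => SemiMap.tot_mem _ (ha i))]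

lemma op_unique {n : ℕ} {θ θ' : Op (nCochains k X) n}
    {η : ∀ m, Op (simplexCochains.{u} k m) n}
    (h : ∀ (m : ℕ) (x : Sx X m), Rel (classify k x) θ (η m))
    (h' : ∀ (m : ℕ) (x : Sx X m), Rel (classify k x) θ' (η m)) : θ = θ' :=
  MultilinearMap.ext fun a => classify_ext fun m x => (h m x a).trans (h' m x a).symm

variable (X) in
/-- The operations given by the elements of the Eilenberg–Zilber operad, additively. -/
def zHom (n : ℕ) (d : ℤ) : zDeg.{u} k n d →+ opDeg (nCochains k X) n d where
  toFun θ := ⟨zOp X θ, zOp_mem θ⟩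
  map_zero' := Subtype.ext <| op_unique (η := fun m => 0) (fun m x => zOp_rel 0 x)
    fun m x => rel_zero
  map_add' := fun θ η => Subtype.ext <| op_unique (fun m x => zOp_rel (θ + η) x)
    fun m x => rel_add (zOp_rel θ x) (zOp_rel η x)

variable (k X) in
/-- The action of the Eilenberg–Zilber operad on the normalized cochains of `X`. -/
def ezAct : AlgStr (EZ.{u} k) (nCochains k X) where
  toFun n d := zHom X n d
  map_smul n d c θ := Subtype.ext <| op_unique (fun m x => zOp_rel (c • θ : zDeg k n d) x)
    fun m x => rel_smul c (zOp_rel θ x)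
  map_d n d d' θ := Subtype.ext <| op_unique (fun m x => zOp_rel (zD d d' θ) x)
    fun m x => rel_opD (θ := ⟨zOp X θ, zOp_mem θ⟩) (zOp_rel θ x)
  map_act σ d θ := Subtype.ext <| op_unique (fun m x => zOp_rel (zPerm σ d θ) x)
    fun m x => rel_permOp σ (zOp_rel θ x)
  map_one := Subtype.ext <| op_unique (fun m x => zOp_rel (EZ k).one x) fun m x => rel_opOne
  map_circ {m n r} h i {a b c} hc θ η := Subtype.ext <| op_unique
    (fun l x => zOp_rel (zCirc h i hc θ η) x)
    fun l x => rel_compOp h i b (zOp_rel θ x) (zOp_rel η x)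

end EZ

/-! ### Extension of scalars -/

section Semi

variable {k K : Type} [CommRing k] [CommRing K] [Algebra k K]

/-- The additive map `s ⊗ x ↦ s • g x` given by a semilinear map `g`. -/
def semiLiftAdd {M : Type*} [AddCommGroup M] [Module k M] {Q : Type*} [AddCommGroup Q]
    [Module K Q] (g : M →+ Q) (hg : ∀ (c : k) (x : M), g (c • x) = algebraMap k K c • g x) :
    K ⊗[k] M →+ Q :=
  TensorProduct.liftAddHom
    ((AddMonoidHom.mk' (fun s : K => (DistribSMul.toAddMonoidHom Q s).comp g) fun s t =>
      AddMonoidHom.ext fun x => add_smul s t (g x)) : K →+ M →+ Q) (fun c s x => by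
        change (c • s) • g x = s • g (c • x)
        rw [hg, Algebra.smul_def, mul_comm, mul_smul])

/-- The `K`-linear map `s ⊗ x ↦ s • g x` given by a semilinear map `g`. -/
def semiLift {M : Type*} [AddCommGroup M] [Module k M] {Q : Type*} [AddCommGroup Q] [Module K Q]
    (g : M →+ Q) (hg : ∀ (c : k) (x : M), g (c • x) = algebraMap k K c • g x) :
    K ⊗[k] M →ₗ[K] Q where
  toFun := semiLiftAdd g hg
  map_add' := map_add _
  map_smul' t x := by
    rw [RingHom.id_apply]
    induction x using TensorProduct.induction_on with
    | zero => simp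
    | tmul s x => exact mul_smul t s (g x)
    | add x y hx hy => rw [smul_add, map_add, map_add, smul_add, hx, hy]

variable {M : Type*} [AddCommGroup M] [Module k M] {Q : Type*} [AddCommGroup Q] [Module K Q]

@[simp] lemma semiLift_tmul (g : M →+ Q)
    (hg : ∀ (c : k) (x : M), g (c • x) = algebraMap k K c • g x) (s : K) (x : M) :
    semiLift g hg (s ⊗ₜ x) = s • g x := rfl

lemma tensor_ext {f g : K ⊗[k] M →ₗ[K] Q} (h : ∀ x, f (1 ⊗ₜ x) = g (1 ⊗ₜ x)) : f = g := by
  refine LinearMap.ext fun x => ?_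
  induction x using TensorProduct.induction_on with
  | zero => simp
  | tmul s x =>
    have : s ⊗ₜ[k] x = s • ((1 : K) ⊗ₜ[k] x) := by simp [TensorProduct.smul_tmul']
    rw [this, map_smul, map_smul, h]
  | add x y hx hy => simp [hx, hy]

/-- `g` exhibits `Q` as the extension of scalars of `M`. -/
def IsExtMap (g : M →+ Q) : Prop :=
  ∃ hg : ∀ (c : k) (x : M), g (c • x) = algebraMap k K c • g x,
    Function.Bijective (semiLift g hg)

lemma IsExtMap.ext {g : M →+ Q} (h : IsExtMap (k := k) (K := K) g) {P : Type*} [AddCommGroup P]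
    [Module K P] {a b : Q →ₗ[K] P} (hab : ∀ x, a (g x) = b (g x)) : a = b := by
  obtain ⟨hg, hb⟩ := h
  have : a ∘ₗ semiLift g hg = b ∘ₗ semiLift g hg := tensor_ext fun x => by simp [hab]
  refine LinearMap.ext fun y => ?_
  obtain ⟨y, rfl⟩ := hb.2 y
  exact LinearMap.congr_fun this y

lemma IsExtMap.lift {g : M →+ Q} (h : IsExtMap (k := k) (K := K) g) {P : Type*} [AddCommGroup P]
    [Module K P] (t : M →+ P) (ht : ∀ (c : k) (x : M), t (c • x) = algebraMap k K c • t x) :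
    ∃ a : Q →ₗ[K] P, ∀ x, a (g x) = t x := by
  obtain ⟨hg, hb⟩ := h
  let e := LinearEquiv.ofBijective (semiLift g hg) hb
  refine ⟨semiLift t ht ∘ₗ e.symm.toLinearMap, fun x => ?_⟩
  have : e.symm (g x) = 1 ⊗ₜ x := by
    rw [LinearEquiv.symm_apply_eq]; simp [e]
  simp [this]

end Semi

lemma multi_unique {k K : Type} [CommRing k] [CommRing K] [Algebra k K] :
    ∀ {n : ℕ} {M N : Fin n → Type u} [∀ i, AddCommGroup (M i)] [∀ i, Module k (M i)]
    [∀ i, AddCommGroup (N i)] [∀ i, Module K (N i)] {Q : Type w} [AddCommGroup Q] [Module K Q]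
    (j : ∀ i, M i →+ N i) (_ : ∀ i, IsExtMap (k := k) (K := K) (j i))
    (G G' : MultilinearMap K N Q) (_ : ∀ a : ∀ i, M i, G (fun i => j i (a i)) = G' fun i => j i (a i)),
    G = G'
  | 0, _, _, _, _, _, _, _, _, _, j, _, G, G', h => MultilinearMap.ext fun a => by
    rw [Subsingleton.elim a fun i => j i (isEmptyElim i)]; exact h _
  | n + 1, M, N, _, _, _, _, _, _, _, j, hj, G, G', h => by
    have : G.curryLeft = G'.curryLeft := (hj 0).ext fun x =>
      multi_unique (fun i => j i.succ) (fun i => hj i.succ) _ _ fun a => by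
        have := h (Fin.cons x a)
        have e : (fun i => j i ((Fin.cons x a : ∀ i, M i) i)) =
            (Fin.cons (j 0 x) fun i => j i.succ (a i) : ∀ i, N i) := funext fun i => by
          refine Fin.cases ?_ (fun i => ?_) i <;> simp
        rw [e] at this
        exact this
    rw [← G.uncurry_curryLeft, this, G'.uncurry_curryLeft]

lemma multi_exists {k K : Type} [CommRing k] [CommRing K] [Algebra k K] :
    ∀ {n : ℕ} {M N : Fin n → Type u} [∀ i, AddCommGroup (M i)] [∀ i, Module k (M i)]
    [∀ i, AddCommGroup (N i)] [∀ i, Module K (N i)] {Q : Type w} [AddCommGroup Q] [Module K Q]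
    [Module k Q] [IsScalarTower k K Q]
    (j : ∀ i, M i →+ N i) (_ : ∀ i, IsExtMap (k := k) (K := K) (j i))
    (g : MultilinearMap k M Q), ∃ G : MultilinearMap K N Q, ∀ a : ∀ i, M i, G (fun i => j i (a i)) = g a
  | 0, M, _, _, _, _, _, _, _, _, _, _, j, _, g =>
    ⟨MultilinearMap.constOfIsEmpty K _ (g fun i => isEmptyElim i), fun a => by
      rw [Subsingleton.elim a fun i => isEmptyElim i]; rfl⟩
  | n + 1, M, N, _, _, _, _, Q, _, _, _, _, j, hj, g => by
    choose T hT using fun x => multi_exists (fun i => j i.succ) (fun i => hj i.succ)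
      (g.curryLeft x)
    have uq := @multi_unique k K _ _ _ n (fun i => M i.succ) (fun i => N i.succ) _ _ _ _ Q _ _
      (fun i => j i.succ) (fun i => hj i.succ)
    obtain ⟨A, hA⟩ := (hj 0).lift (AddMonoidHom.mk' T fun x y => uq _ _ fun a => by
      rw [hT, _root_.add_apply, hT, hT, map_add, _root_.add_apply])
      (fun c x => uq _ _ fun a => by
        change T _ _ = algebraMap k K c • T x _
        rw [hT, hT, map_smul, _root_.smul_apply, algebraMap_smul])
    refine ⟨A.uncurryLeft, fun a => ?_⟩
    rw [LinearMap.uncurryLeft_apply, hA]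
    change T (a 0) (fun i => j i.succ (Fin.tail a i)) = _
    rw [hT, MultilinearMap.curryLeft_apply, Fin.cons_self_tail]

/-! ### Extension of scalars of complexes and of their operations -/

section Ext

variable {k K : Type} [CommRing k] [CommRing K] [Algebra k K]
  {A : CochainComplex (ModuleCat.{w} k) ℤ} {B : CochainComplex (ModuleCat.{w} K) ℤ}

/-- `f` exhibits `B` as the extension of scalars of `A`, degree by degree: the map
`K ⊗ A ⟶ B`, `s ⊗ x ↦ s • f x`, is bijective. -/
def IsExt (f : SemiMap (algebraMap k K) A B) : Prop :=
  ∀ i, Function.Bijective (semiLift (f.toFun i) (f.map_smul i))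

lemma IsExt.map {f : SemiMap (algebraMap k K) A B} (h : IsExt f) (i : ℤ) :
    IsExtMap (k := k) (K := K) (f.toFun i) := ⟨f.map_smul i, h i⟩

lemma ext_unique {f : SemiMap (algebraMap k K) A B} (h : IsExt f) {n : ℕ} {Q : Type*}
    [AddCommGroup Q] [Module K Q] {G G' : MultilinearMap K (fun _ : Fin n => Tot B) Q}
    (hG : ∀ a : Fin n → Tot A, G (fun i => f.tot (a i)) = G' fun i => f.tot (a i)) : G = G' := by
  refine MultilinearMap.directSum_ext fun p => ?_
  refine multi_unique (fun i => f.toFun (p i)) (fun i => h.map (p i)) _ _ fun a => ?_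
  have := hG fun i => lof k ℤ (fun i => A.X i) (p i) (a i)
  simp only [f.tot_lof] at this
  exact this

lemma rel_unique {f : SemiMap (algebraMap k K) A B} (h : IsExt f) {n : ℕ} {θ : Op A n}
    {η η' : Op B n} (hη : Rel f θ η) (hη' : Rel f θ η') : η = η' :=
  ext_unique h fun a => (hη a).symm.trans (hη' a)

lemma ext_exists {f : SemiMap (algebraMap k K) A B} (h : IsExt f) {n : ℕ} {d : ℤ}
    (θ : opDeg A n d) : ∃ η : opDeg B n d, Rel f θ.1 η.1 := by
  have key : ∀ p : Fin n → ℤ, ∃ G : MultilinearMap K (fun i => B.X (p i)) (B.X (∑ i, p i + d)),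
      ∀ a : ∀ i, A.X (p i), lof K ℤ (fun i => B.X i) _ (G fun i => f.toFun (p i) (a i)) =
        f.tot (θ.1 fun i => lof k ℤ (fun i => A.X i) (p i) (a i)) := by
    intro p
    let _ : Module k (B.X (∑ i, p i + d)) := Module.compHom _ (algebraMap k K)
    have : IsScalarTower k K (B.X (∑ i, p i + d)) :=
      ⟨fun c s x => by rw [Algebra.smul_def, mul_smul]; rfl⟩
    let g₀ : A.X (∑ i, p i + d) →ₗ[k] B.X (∑ i, p i + d) :=
      { f.toFun _ with map_smul' := f.map_smul _ }
    obtain ⟨G, hG⟩ := multi_exists (fun i => f.toFun (p i)) (fun i => h.map (p i))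
      ((g₀ ∘ₗ DirectSum.component k ℤ (fun i => A.X i) (∑ i, p i + d)).compMultilinearMap
        (θ.1.compLinearMap fun i => lof k ℤ (fun i => A.X i) (p i)))
    refine ⟨G, fun a => ?_⟩
    rw [hG]
    obtain ⟨x, hx⟩ := θ.2 p _ fun i => lof_mem (p i) (a i)
    rw [← hx, f.tot_lof]
    congr 1
    change f.toFun _ (DirectSum.component k ℤ (fun i => A.X i) _ (θ.1 _)) = _
    rw [← hx, DirectSum.component.lof_self]
  choose G hG using key
  refine ⟨⟨MultilinearMap.fromDirectSumEquiv fun p =>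
    (lof K ℤ (fun i => B.X i) (∑ i, p i + d)).compMultilinearMap (G p), fun p a ha => ?_⟩,
    rel_of_homog fun p a ha => ?_⟩
  · choose x hx using ha
    obtain rfl : (fun i => lof K ℤ (fun i => B.X i) (p i) (x i)) = a := funext hx
    rw [MultilinearMap.fromDirectSumEquiv_lof]
    exact lof_mem _ _
  · choose x hx using ha
    obtain rfl : (fun i => lof k ℤ (fun i => A.X i) (p i) (x i)) = a := funext hx
    simp only [f.tot_lof]
    rw [MultilinearMap.fromDirectSumEquiv_lof]
    exact (hG p x).symm

/-- The extension of scalars of an operation: the unique `K`-multilinear operation `η` with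
`f (θ (a₁, …, aₙ)) = η (f a₁, …, f aₙ)`. -/
def opExt {f : SemiMap (algebraMap k K) A B} (h : IsExt f) {n : ℕ} {d : ℤ}
    (θ : opDeg A n d) : opDeg B n d := (ext_exists h θ).choose

lemma opExt_rel {f : SemiMap (algebraMap k K) A B} (h : IsExt f) {n : ℕ} {d : ℤ}
    (θ : opDeg A n d) : Rel f θ.1 (opExt h θ).1 := (ext_exists h θ).choose_spec

lemma rel_opD' {f : SemiMap (algebraMap k K) A B} {n : ℕ}
    {c d : ℤ} {θ : opDeg A n c} {θ' : opDeg B n c} (h : Rel f θ.1 θ'.1) :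
    Rel f (opD c d θ).1 (opD c d θ').1 := by
  by_cases hcd : c + 1 = d
  · subst hcd
    rw [opD_succ, opD_succ]; exact rel_dOp c h
  · rw [opD_ne hcd, opD_ne hcd]; exact rel_zero

/-- Extension of scalars, as a homomorphism of groups. -/
def opExtHom {f : SemiMap (algebraMap k K) A B} (h : IsExt f) (n : ℕ) (d : ℤ) :
    opDeg A n d →+ opDeg B n d where
  toFun θ := opExt h θ
  map_zero' := Subtype.ext <| rel_unique h (opExt_rel h 0) rel_zero
  map_add' θ η := Subtype.ext <| rel_unique h (opExt_rel h (θ + η))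
    (rel_add (opExt_rel h θ) (opExt_rel h η))

/-- Extension of scalars of operations, as a morphism of endomorphism operads. -/
def endExt {f : SemiMap (algebraMap k K) A B} (h : IsExt f) :
    Operad.Hom (algebraMap k K) (EndOp A) (EndOp B) where
  toFun n d := opExtHom h n d
  map_smul n d c θ := Subtype.ext <| rel_unique h (opExt_rel h (c • θ : opDeg A n d))
    (rel_smul c (opExt_rel h θ))
  map_d n d d' θ := Subtype.ext <| rel_unique h (opExt_rel h (opD d d' θ))
    (rel_opD' (opExt_rel h θ))
  map_act σ d θ := Subtype.ext <| rel_unique h (opExt_rel h (opAct σ d θ))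
    (rel_permOp σ (opExt_rel h θ))
  map_one := Subtype.ext <| rel_unique h (opExt_rel h (opOne A)) rel_opOne
  map_circ {m n r} hr i {a b c} hc θ η := Subtype.ext <| rel_unique h
    (opExt_rel h (opCirc hr i hc θ η)) (rel_compOp hr i b (opExt_rel h θ) (opExt_rel h η))

variable (K A) in
/-- The complex `K ⊗ A`. -/
def extCpx : CochainComplex (ModuleCat.{w} K) ℤ where
  X i := ModuleCat.of K (K ⊗[k] A.X i)
  d i j := ModuleCat.ofHom ((A.d i j).hom.baseChange K)
  shape i j h := by
    rw [A.shape i j h]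
    exact ModuleCat.hom_ext LinearMap.baseChange_zero
  d_comp_d' i j l _ _ := ModuleCat.hom_ext <| tensor_ext fun x => by
    change (1 : K) ⊗ₜ[k] (A.d j l (A.d i j x)) = 0
    have : A.d j l (A.d i j x) = 0 := ConcreteCategory.congr_hom (A.d_comp_d i j l) x
    rw [this, tmul_zero]

variable (K A) in
/-- The canonical map `x ↦ 1 ⊗ x` from `A` to `K ⊗ A`. -/
def extIncl : SemiMap (algebraMap k K) A (extCpx K A) where
  toFun i := (TensorProduct.mk k K (A.X i) 1).toAddMonoidHom
  map_smul i c x := by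
    change (1 : K) ⊗ₜ[k] (c • x) = algebraMap k K c • ((1 : K) ⊗ₜ[k] x)
    rw [TensorProduct.smul_tmul', smul_eq_mul, mul_one, ← TensorProduct.smul_tmul,
      Algebra.smul_def, mul_one]
  map_d i j x := rfl

variable (K A) in
lemma isExt_extIncl : IsExt (extIncl K A) := fun i => by
  have : semiLift ((extIncl K A).toFun i) ((extIncl K A).map_smul i) =
      (LinearMap.id : K ⊗[k] A.X i →ₗ[K] K ⊗[k] A.X i) := tensor_ext fun x =>
      one_smul K ((1 : K) ⊗ₜ[k] x)
  rw [this]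
  exact Function.bijective_id

/-- The map of complexes `K ⊗ f`. -/
def extMap {A A' : CochainComplex (ModuleCat.{w} k) ℤ} (f : A ⟶ A') :
    extCpx K A ⟶ extCpx K A' where
  f i := ModuleCat.ofHom ((f.f i).hom.baseChange K)
  comm' i j _ := ModuleCat.hom_ext <| tensor_ext fun x =>
    congrArg (fun y => (1 : K) ⊗ₜ[k] y) (ConcreteCategory.congr_hom (f.comm i j) x)

/-- The isomorphism of complexes `K ⊗ A ≅ B` for an extension of scalars `f : A ⟶ B`. -/
def extIso {f : SemiMap (algebraMap k K) A B} (h : IsExt f) : extCpx K A ≅ B :=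
  HomologicalComplex.Hom.isoOfComponents
    (fun i => (LinearEquiv.ofBijective _ (h i)).toModuleIso) fun i j _ =>
      ModuleCat.hom_ext <| tensor_ext fun x => by
        change B.d i j ((1 : K) • f.toFun i x) = (1 : K) • f.toFun j (A.d i j x)
        rw [one_smul, one_smul, f.map_d]

end Ext

/-! ### Extension of scalars of operads -/

section OperadExt

variable {k K : Type} [CommRing k] [CommRing K] [Algebra k K]

variable (K) in
/-- The `K`-bilinear extension of a `k`-bilinear map. -/
def bilExt {X Y Z : Type*} [AddCommGroup X] [AddCommGroup Y] [AddCommGroup Z] [Module k X]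
    [Module k Y] [Module k Z] (b : X →ₗ[k] Y →ₗ[k] Z) :
    K ⊗[k] X →ₗ[K] K ⊗[k] Y →ₗ[K] K ⊗[k] Z :=
  semiLift (AddMonoidHom.mk' (fun x => (b x).baseChange K) fun x y => by
      rw [map_add, LinearMap.baseChange_add])
    fun c x => tensor_ext fun y => by
      change (1 : K) ⊗ₜ[k] b (c • x) y = algebraMap k K c • ((1 : K) ⊗ₜ[k] b x y)
      rw [map_smul, LinearMap.smul_apply, tmul_smul, algebraMap_smul]

lemma bilExt_tmul {X Y Z : Type*} [AddCommGroup X] [AddCommGroup Y] [AddCommGroup Z] [Module k X]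
    [Module k Y] [Module k Z] (b : X →ₗ[k] Y →ₗ[k] Z) (s t : K) (x : X) (y : Y) :
    bilExt K b (s ⊗ₜ x) (t ⊗ₜ y) = (s * t) ⊗ₜ b x y := by
  change s • ((b x).baseChange K (t ⊗ₜ y)) = _
  rw [LinearMap.baseChange_tmul, TensorProduct.smul_tmul', smul_eq_mul]

lemma bil_ext {X Y Z : Type*} [AddCommGroup X] [AddCommGroup Y] [AddCommGroup Z] [Module k X]
    [Module k Y] [Module K Z] {f g : K ⊗[k] X →ₗ[K] K ⊗[k] Y →ₗ[K] Z}
    (h : ∀ x y, f (1 ⊗ₜ x) (1 ⊗ₜ y) = g (1 ⊗ₜ x) (1 ⊗ₜ y)) (x : K ⊗[k] X) (y : K ⊗[k] Y) :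
    f x y = g x y := by
  have : f = g := tensor_ext fun x => tensor_ext fun y => h x y
  rw [this]

lemma sg_tmul {X : Type*} [AddCommGroup X] [Module k X] (a : ℤ) (s : K) (x : X) :
    sg K a • (s ⊗ₜ[k] x) = s ⊗ₜ (sg k a • x) := by
  rw [tmul_smul, show sg K a = algebraMap k K (sg k a) from (sc_map _ _).symm, algebraMap_smul]

section

variable {X Y Z U V W : Type*} [AddCommGroup X] [AddCommGroup Y] [AddCommGroup Z]
  [AddCommGroup U] [AddCommGroup V] [AddCommGroup W] [Module k X] [Module k Y] [Module k Z]
  [Module k U] [Module k V] [Module k W]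

lemma bilExt_seq {p : X →ₗ[k] Y →ₗ[k] U} {q : U →ₗ[k] Z →ₗ[k] W} {r : Y →ₗ[k] Z →ₗ[k] V}
    {s : X →ₗ[k] V →ₗ[k] W} (h : ∀ x y z, q (p x y) z = s x (r y z)) (x : K ⊗[k] X)
    (y : K ⊗[k] Y) (z : K ⊗[k] Z) :
    bilExt K q (bilExt K p x y) z = bilExt K s x (bilExt K r y z) := by
  induction x using TensorProduct.induction_on with
  | zero => simp
  | add x x' hx hx' => simp only [map_add, LinearMap.add_apply, hx, hx']
  | tmul a x =>
    induction y using TensorProduct.induction_on with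
    | zero => simp
    | add y y' hy hy' => simp only [map_add, LinearMap.add_apply, hy, hy']
    | tmul b y =>
      induction z using TensorProduct.induction_on with
      | zero => simp
      | add z z' hz hz' => simp only [map_add, hz, hz']
      | tmul c z => simp only [bilExt_tmul, mul_assoc, h]

lemma bilExt_par {p : X →ₗ[k] Y →ₗ[k] U} {q : U →ₗ[k] Z →ₗ[k] W} {r : X →ₗ[k] Z →ₗ[k] V}
    {s : V →ₗ[k] Y →ₗ[k] W} {a : ℤ} (h : ∀ x y z, q (p x y) z = sg k a • s (r x z) y)
    (x : K ⊗[k] X) (y : K ⊗[k] Y) (z : K ⊗[k] Z) :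
    bilExt K q (bilExt K p x y) z = sg K a • bilExt K s (bilExt K r x z) y := by
  induction x using TensorProduct.induction_on with
  | zero => simp
  | add x x' hx hx' => simp only [map_add, LinearMap.add_apply, smul_add, hx, hx']
  | tmul a x =>
    induction y using TensorProduct.induction_on with
    | zero => simp
    | add y y' hy hy' => simp only [map_add, LinearMap.add_apply, smul_add, hy, hy']
    | tmul b y =>
      induction z using TensorProduct.induction_on with
      | zero => simp
      | add z z' hz hz' => simp only [map_add, LinearMap.add_apply, smul_add, hz, hz']
      | tmul c z => rw [bilExt_tmul, bilExt_tmul, bilExt_tmul, bilExt_tmul, sg_tmul, h,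
          mul_right_comm]

end

variable (K) in
/-- The operad `E ⊗ K` over `K` obtained from an operad `E` over `k`. -/
def Operad.baseChange (E : Operad.{0, w} k) : Operad.{0, w} K where
  obj n := extCpx K (E.obj n)
  act σ d := (E.act σ d).baseChange K
  one := (1 : K) ⊗ₜ E.one
  circ h i _ _ _ hc := bilExt K (E.circ h i hc)
  act_one {n} d x := by
    have : (E.act (1 : Equiv.Perm (Fin n)) d).baseChange K = LinearMap.id := tensor_ext fun x =>
      congrArg (fun x => (1 : K) ⊗ₜ[k] x) (E.act_one d x)
    exact LinearMap.congr_fun this x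
  act_mul σ τ d x := by
    have : (E.act (σ * τ) d).baseChange K = (E.act τ d).baseChange K ∘ₗ (E.act σ d).baseChange K :=
      tensor_ext fun x => congrArg (fun x => (1 : K) ⊗ₜ[k] x) (E.act_mul σ τ d x)
    exact LinearMap.congr_fun this x
  d_act {n} σ d d' x := by
    have : ((E.obj n).d d d').hom.baseChange K ∘ₗ (E.act σ d).baseChange K =
        (E.act σ d').baseChange K ∘ₗ ((E.obj n).d d d').hom.baseChange K :=
      tensor_ext fun x => congrArg (fun x => (1 : K) ⊗ₜ[k] x) (E.d_act σ d d' x)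
    exact LinearMap.congr_fun this x
  d_one := (congrArg (fun x => (1 : K) ⊗ₜ[k] x) E.d_one).trans (tmul_zero _ _)
  one_circ h i b hc x := by
    have : bilExt K (E.circ h i hc) (1 ⊗ₜ E.one) = LinearMap.id := tensor_ext fun x => by
      rw [bilExt_tmul, one_mul, E.one_circ]; rfl
    exact LinearMap.congr_fun this x
  circ_one {n} i a hc x := by
    have : (bilExt K (E.circ (rfl : n + 1 = n + 1) i hc)).flip (1 ⊗ₜ E.one) = LinearMap.id :=
      tensor_ext fun x => by
        rw [LinearMap.flip_apply, bilExt_tmul, one_mul, E.circ_one]; rfl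
    exact LinearMap.congr_fun this x
  d_circ {m n r} h i a b c hc hc₁ hc₂ := bil_ext
      (f := (bilExt K (E.circ h i hc)).compr₂ (((E.obj r).d c (c + 1)).hom.baseChange K))
      (g := bilExt K (E.circ h i hc₁) ∘ₗ ((E.obj m).d a (a + 1)).hom.baseChange K +
        sg K a • (bilExt K (E.circ h i hc₂)).compl₂ (((E.obj n).d b (b + 1)).hom.baseChange K))
      fun x y => by
        simp only [LinearMap.compr₂_apply, LinearMap.add_apply, LinearMap.comp_apply,
          LinearMap.smul_apply, LinearMap.compl₂_apply, LinearMap.baseChange_tmul, bilExt_tmul,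
          sg_tmul, ← tmul_add]
        exact congrArg (fun x => ((1 : K) * 1) ⊗ₜ[k] x) (E.d_circ h i hc hc₁ hc₂ x y)
  circ_seq h₁ h₂ h₃ h₄ i j _ _ _ _ _ _ hab hbc h₅ h₆ :=
    bilExt_seq (E.circ_seq h₁ h₂ h₃ h₄ i j hab hbc h₅ h₆)
  circ_par h₁ h₂ h₃ h₄ i j hij _ _ _ _ _ _ hab hac h₅ h₆ :=
    bilExt_par (E.circ_par h₁ h₂ h₃ h₄ i j hij hab hac h₅ h₆)
  circ_act {m n r} h i a b c hc σ τ := bil_ext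
      (f := (bilExt K (E.circ h i hc)).compl₁₂ ((E.act σ a).baseChange K)
        ((E.act τ b).baseChange K))
      (g := (bilExt K (E.circ h (σ i) hc)).compr₂ ((E.act (blockPerm h i σ τ) c).baseChange K))
      fun x y => by
        simp only [LinearMap.compr₂_apply, LinearMap.compl₁₂_apply, LinearMap.baseChange_tmul,
          bilExt_tmul]
        rw [E.circ_act]

/-- The morphism `E ⊗ K ⟶ F` of operads over `K` that extends a semilinear morphism `E ⟶ F`. -/
def Operad.Hom.extend {E : Operad.{0, w} k} {F : Operad.{0, w'} K}
    (f : Operad.Hom (algebraMap k K) E F) : Operad.Hom (RingHom.id K) (E.baseChange K) F where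
  toFun n d := (semiLift (f.toFun n d) (f.map_smul n d)).toAddMonoidHom
  map_smul n d c x := _root_.map_smul (semiLift (f.toFun n d) (f.map_smul n d)) c x
  map_d n d d' := LinearMap.congr_fun (tensor_ext
    (f := semiLift (f.toFun n d') (f.map_smul n d') ∘ₗ ((E.obj n).d d d').hom.baseChange K)
    (g := ((F.obj n).d d d').hom ∘ₗ semiLift (f.toFun n d) (f.map_smul n d)) fun x => by
      rw [LinearMap.comp_apply, LinearMap.comp_apply, LinearMap.baseChange_tmul, semiLift_tmul,
        semiLift_tmul, one_smul, one_smul]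
      exact f.map_d n d d' x)
  map_act {n} σ d := LinearMap.congr_fun (tensor_ext
    (f := semiLift (f.toFun n d) (f.map_smul n d) ∘ₗ (E.act σ d).baseChange K)
    (g := (F.act σ d) ∘ₗ semiLift (f.toFun n d) (f.map_smul n d)) fun x => by
      rw [LinearMap.comp_apply, LinearMap.comp_apply, LinearMap.baseChange_tmul, semiLift_tmul,
        semiLift_tmul, one_smul, one_smul]
      exact f.map_act σ d x)
  map_one := (one_smul K (f.toFun 1 0 E.one)).trans f.map_one
  map_circ {m n r} h i a b c hc := bil_ext
    (f := (bilExt K (E.circ h i hc)).compr₂ (semiLift (f.toFun r c) (f.map_smul r c)))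
    (g := (F.circ h i hc).compl₁₂ (semiLift (f.toFun m a) (f.map_smul m a))
      (semiLift (f.toFun n b) (f.map_smul n b))) fun x y => by
        simp only [LinearMap.compr₂_apply, LinearMap.compl₁₂_apply, semiLift_tmul, bilExt_tmul,
          mul_one, one_smul]
        exact f.map_circ h i hc x y

end OperadExt

/-! ### Extension of scalars of cochains and of the Eilenberg–Zilber operad -/

section CochExt

variable {k K : Type} [CommRing k] [CommRing K] [Algebra k K]

/-- The nondegenerate simplices of dimension `i`. -/
abbrev NonDeg (Y : SSet.{u}) (i : ℤ) : Type u :=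
  {s : Σ m : ℕ, Sx Y m // (s.1 : ℤ) = i ∧ s.2 ∉ Y.degenerate s.1}

lemma finite_nonDeg {Y : SSet.{u}} (hY : ∀ n, Finite (Sx Y n)) (i : ℤ) : Finite (NonDeg Y i) := by
  refine Finite.of_injective (β := Σ m : Fin (i.toNat + 1), Sx Y m)
    (fun s => ⟨⟨s.1.1, by have := s.2.1; omega⟩, s.1.2⟩) ?_
  rintro ⟨⟨m, x⟩, hx⟩ ⟨⟨m', x'⟩, hx'⟩ h
  simp only [Sigma.mk.injEq, Fin.mk.injEq] at h
  obtain ⟨rfl, h⟩ := h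
  simp_all

open Classical in
variable (k) in
/-- Normalized cochains are functions on the nondegenerate simplices. -/
def nCochEquiv (Y : SSet.{u}) (i : ℤ) : nCoch k Y i ≃ₗ[k] (NonDeg Y i → k) where
  toFun f s := f.1 s.1
  map_add' _ _ := rfl
  map_smul' _ _ := rfl
  invFun g := ⟨fun s => if h : (s.1 : ℤ) = i ∧ s.2 ∉ Y.degenerate s.1 then g ⟨s, h⟩ else 0,
    fun m x hx => dif_neg fun h => hx.elim (· h.1) h.2⟩
  left_inv f := Subtype.ext <| funext fun s => by
    by_cases h : (s.1 : ℤ) = i ∧ s.2 ∉ Y.degenerate s.1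
    · exact dif_pos h
    · refine (dif_neg h).trans (f.2 s.1 s.2 ?_).symm
      by_cases h1 : (s.1 : ℤ) = i
      · exact Or.inr (not_not.1 fun h2 => h ⟨h1, h2⟩)
      · exact Or.inl h1
  right_inv g := funext fun s => dif_pos s.2

/-- The cochains of a levelwise finite simplicial set with coefficients in `K` are the extension
of scalars of the cochains with coefficients in `k`. -/
lemma isExt_nCoeff {Y : SSet.{u}} (hY : ∀ n, Finite (Sx Y n)) :
    IsExt (nCoeff (algebraMap k K) Y) := fun i => by
  classical
  have := finite_nonDeg hY i
  have := Fintype.ofFinite (NonDeg Y i)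
  let L := semiLift ((nCoeff (algebraMap k K) Y).toFun i) ((nCoeff (algebraMap k K) Y).map_smul i)
  let e : (nCochains K Y).X i ≃ₗ[K] (NonDeg Y i → K) := nCochEquiv K Y i
  have h : e.toLinearMap ∘ₗ L = (TensorProduct.piScalarRight k K K (NonDeg Y i)).toLinearMap ∘ₗ
      (nCochEquiv k Y i).toLinearMap.baseChange K := tensor_ext fun f => funext fun s => by
    change (e ((1 : K) • (nCoeff (algebraMap k K) Y).toFun i f)) s =
      TensorProduct.piScalarRight k K K (NonDeg Y i) ((1 : K) ⊗ₜ nCochEquiv k Y i f) s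
    rw [one_smul, TensorProduct.piScalarRight_apply, TensorProduct.piScalarRightHom_tmul]
    exact Algebra.algebraMap_eq_smul_one _
  refine (Function.Bijective.of_comp_iff' e.bijective L).1 ?_
  have h' : (e ∘ L) = (TensorProduct.piScalarRight k K K (NonDeg Y i)) ∘
      ((nCochEquiv k Y i).baseChange k K _ _) := funext fun x => LinearMap.congr_fun h x
  rw [h']
  exact (LinearEquiv.bijective _).comp (LinearEquiv.bijective _)

lemma finite_simplex (m n : ℕ) :
    Finite (Sx (SSet.stdSimplex.{u}.obj (SimplexCategory.mk m)) n) :=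
  Finite.of_equiv _ (SSet.stdSimplex.objEquiv (n := SimplexCategory.mk m)
    (m := op (SimplexCategory.mk n))).symm

variable (k K) in
/-- The coefficient map on the cochains of `Δ[m]` is an extension of scalars. -/
lemma isExt_simplex (m : ℕ) :
    IsExt (nCoeff (algebraMap k K) (SSet.stdSimplex.{u}.obj (SimplexCategory.mk m))) :=
  isExt_nCoeff (finite_simplex m)

/-- Extension of scalars of the natural operations. -/
def zExt (n : ℕ) (d : ℤ) : zDeg.{u} k n d →+ zDeg.{u} K n d where
  toFun θ := ⟨fun m => opExt (isExt_simplex k K m) (θ.1 m), fun m m' α => by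
    intro a
    have hα : ∀ z, (SemiMap.ofHom (nMap K (SSet.stdSimplex.{u}.map α))).tot
        ((nCoeff (algebraMap k K) _).tot z) = (nCoeff (algebraMap k K) _).tot
          ((SemiMap.ofHom (nMap k (SSet.stdSimplex.{u}.map α))).tot z) := fun z => by
      refine evalAt_ext fun l x q => rfl
    let g : Tot (simplexCochains.{u} K m') →ₗ[K] Tot (simplexCochains.{u} K m) :=
      { (SemiMap.ofHom (nMap K (SSet.stdSimplex.{u}.map α))).tot with
        map_smul' := SemiMap.tot_smul _ }
    have : g.compMultilinearMap (opExt (isExt_simplex k K m') (θ.1 m')).1 =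
        (opExt (isExt_simplex k K m) (θ.1 m)).1.compLinearMap fun _ => g :=
      ext_unique (isExt_simplex k K m') fun a => by
        change (SemiMap.ofHom _).tot _ = (opExt (isExt_simplex k K m) (θ.1 m)).1 fun i =>
          (SemiMap.ofHom (nMap K (SSet.stdSimplex.{u}.map α))).tot _
        rw [← opExt_rel (isExt_simplex k K m') (θ.1 m') a, hα, θ.2 m m' α]
        simp only [hα]
        exact opExt_rel (isExt_simplex k K m) (θ.1 m) _
    exact congrArg (fun F => F a) this⟩
  map_zero' := Subtype.ext <| funext fun m => map_zero (opExtHom (isExt_simplex k K m) n d)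
  map_add' θ η := Subtype.ext <| funext fun m =>
    map_add (opExtHom (isExt_simplex k K m) n d) (θ.1 m) (η.1 m)

variable (k K) in
/-- The morphism from the Eilenberg–Zilber operad over `k` to that over `K` that extends the
natural operations `K`-multilinearly. -/
def ezExt : Operad.Hom (algebraMap k K) (EZ.{u} k) (EZ.{u} K) where
  toFun n d := zExt n d
  map_smul n d c θ := Subtype.ext <| funext fun m =>
    (endExt (isExt_simplex k K m)).map_smul n d c (θ.1 m)
  map_d n d d' θ := Subtype.ext <| funext fun m =>
    (endExt (isExt_simplex k K m)).map_d n d d' (θ.1 m)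
  map_act σ d θ := Subtype.ext <| funext fun m =>
    (endExt (isExt_simplex k K m)).map_act σ d (θ.1 m)
  map_one := Subtype.ext <| funext fun m => (endExt (isExt_simplex k K m)).map_one
  map_circ h i _ _ _ hc θ η := Subtype.ext <| funext fun m =>
    (endExt (isExt_simplex k K m)).map_circ h i hc (θ.1 m) (η.1 m)

end CochExt

/-! ### `E∞`-operads -/

/-- The left action of the symmetric group that corresponds to the right action of an operad. -/
def Operad.rep {k : Type v} [CommRing k] (E : Operad.{v, w} k) (n : ℕ) (d : ℤ) :
    Representation k (Equiv.Perm (Fin n)) ((E.obj n).X d) where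
  toFun σ := E.act σ⁻¹ d
  map_one' := LinearMap.ext fun x => by rw [inv_one]; exact E.act_one d x
  map_mul' σ τ := LinearMap.ext fun x => by rw [mul_inv_rev]; exact E.act_mul _ _ d x

/-- `E` is an `E∞`-operad: each `E(n)` is a projective resolution of the trivial
`k[Σₙ]`-module `k`, by means of an augmentation that is compatible with the operad structure
(a quasi-isomorphism to the commutative operad). The complexes are graded cohomologically, so
that resolutions are concentrated in degrees `≤ 0`. -/
structure Operad.IsEInfinity {k : Type v} [CommRing k] (E : Operad.{v, w} k) : Prop where
  nonpos (n : ℕ) (d : ℤ) : 0 < d → Subsingleton ((E.obj n).X d)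
  projective (n : ℕ) (d : ℤ) :
    Module.Projective (MonoidAlgebra k (Equiv.Perm (Fin n))) (E.rep n d).asModule
  exact (n : ℕ) (d : ℤ) (x : (E.obj n).X (d + 1)) : d + 1 < 0 →
    (E.obj n).d (d + 1) (d + 2) x = 0 → ∃ y, (E.obj n).d d (d + 1) y = x
  augmentation : ∃ ε : ∀ n : ℕ, (E.obj n).X 0 →ₗ[k] k,
    ε 1 E.one = 1 ∧
    (∀ (n : ℕ) (σ : Equiv.Perm (Fin n)) (x : (E.obj n).X 0), ε n (E.act σ 0 x) = ε n x) ∧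
    (∀ (m n r : ℕ) (h : m + n = r + 1) (i : Fin m) (x : (E.obj m).X 0) (y : (E.obj n).X 0),
      ε r (E.circ h i (add_zero 0) x y) = ε m x * ε n y) ∧
    (∀ n : ℕ, Function.Surjective (ε n)) ∧
    ∀ (n : ℕ) (x : (E.obj n).X 0), ε n x = 0 ↔ ∃ y, (E.obj n).d (-1) 0 y = x

/-- The inverse of a bijective morphism of operads. -/
def Operad.Hom.inv {k : Type v} [CommRing k] {E : Operad.{v, w} k} {F : Operad.{v, w'} k}
    (f : Operad.Hom (RingHom.id k) E F) (hf : ∀ n d, Function.Bijective (f.toFun n d)) :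
    Operad.Hom (RingHom.id k) F E where
  toFun n d := (AddEquiv.ofBijective (f.toFun n d) (hf n d)).symm.toAddMonoidHom
  map_smul n d c x := (hf n d).1 <| by
    have h := (AddEquiv.ofBijective (f.toFun n d) (hf n d)).apply_symm_apply
    exact (h (c • x)).trans ((f.map_smul n d c _).trans (congrArg (c • ·) (h x))).symm
  map_d n d d' x := (hf n d').1 <|
    ((AddEquiv.ofBijective (f.toFun n d') (hf n d')).apply_symm_apply _).trans
      ((f.map_d n d d' _).trans (congrArg ((F.obj n).d d d')
        ((AddEquiv.ofBijective (f.toFun n d) (hf n d)).apply_symm_apply x))).symm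
  map_act {n} σ d x := (hf n d).1 <|
    ((AddEquiv.ofBijective (f.toFun n d) (hf n d)).apply_symm_apply _).trans
      ((f.map_act σ d _).trans (congrArg (F.act σ d)
        ((AddEquiv.ofBijective (f.toFun n d) (hf n d)).apply_symm_apply x))).symm
  map_one := (hf 1 0).1 <|
    ((AddEquiv.ofBijective (f.toFun 1 0) (hf 1 0)).apply_symm_apply _).trans f.map_one.symm
  map_circ {m n r} h i a b c hc x y := (hf r c).1 <|
    ((AddEquiv.ofBijective (f.toFun r c) (hf r c)).apply_symm_apply _).trans
      ((f.map_circ h i hc _ _).trans (congrArg₂ (fun x y => F.circ h i hc x y)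
        ((AddEquiv.ofBijective (f.toFun m a) (hf m a)).apply_symm_apply x)
        ((AddEquiv.ofBijective (f.toFun n b) (hf n b)).apply_symm_apply y))).symm

/-! ### The two algebra structures on `K ⊗ C^*(X; k)` -/

/-- The structure of an `(E ⊗ K)`-algebra on `K ⊗ A` for an `E`-algebra `A`. -/
def AlgStr.baseChange {k : Type} (K : Type) [CommRing k] [CommRing K] [Algebra k K]
    {E : Operad.{0, w} k} {A : CochainComplex (ModuleCat.{w'} k) ℤ} (s : AlgStr E A) :
    AlgStr (E.baseChange K) (extCpx K A) :=
  ((endExt (isExt_extIncl K A)).comp s (RingHom.comp_id _)).extend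

/-- The structure of an `E'`-algebra on `K ⊗ A` for an `E`-algebra `A`, by means of an
isomorphism of operads from `E ⊗ K` to `E'`. -/
def AlgStr.extendScalars {k K : Type} [CommRing k] [CommRing K] [Algebra k K]
    {E : Operad.{0, w} k} {E' : Operad.{0, w'} K}
    (φ : Operad.Hom (RingHom.id K) (E.baseChange K) E')
    (hφ : ∀ n d, Function.Bijective (φ.toFun n d))
    {A : CochainComplex (ModuleCat.{u} k) ℤ} (s : AlgStr E A) : AlgStr E' (extCpx K A) :=
  (s.baseChange K).comp (φ.inv hφ) (RingHom.comp_id _)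

/-- The algebra structure on the normalized cochains of `X` over an operad that maps to the
Eilenberg–Zilber operad. -/
def cochStr {k : Type} [CommRing k] {E : Operad.{0, w} k}
    (ζ : Operad.Hom (RingHom.id k) E (EZ.{u} k)) (X : SSet.{u}) : AlgStr E (nCochains k X) :=
  (ezAct k X).comp ζ (RingHom.comp_id _)

lemma zOp_natural {k : Type} [CommRing k] {X Y : SSet.{u}} (g : X ⟶ Y) {n : ℕ} {d : ℤ}
    (θ : zDeg.{u} k n d) : Rel (SemiMap.ofHom (nMap k g)) (zOp Y θ) (zOp X θ) := fun a =>
  classify_ext fun m x => by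
    have h : ∀ z, (classify k x).tot ((SemiMap.ofHom (nMap k g)).tot z) =
        (classify k (g.app _ x)).tot z := fun z => evalAt_ext fun l y q => by
      rw [evalAt_nMap, evalAt_nMap, evalAt_nMap]
      obtain ⟨α, rfl⟩ := SSet.stdSimplex.objEquiv.symm.surjective y
      rw [yoneda_app, yoneda_app]
      exact congrArg (fun w => evalAt k w q z) (congrArg (fun f => f x) (g.naturality α.op))
    rw [h, zOp_rel θ (g.app _ x) a, zOp_rel θ x]
    simp only [h]

lemma cochStr_natural {k : Type} [CommRing k] {E : Operad.{0, w} k}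
    (ζ : Operad.Hom (RingHom.id k) E (EZ.{u} k)) {X Y : SSet.{u}} (g : X ⟶ Y) :
    IsAlgHom (cochStr ζ Y) (cochStr ζ X) (nMap k g) := fun n d x =>
  zOp_natural g (ζ.toFun n d x)

/-- The levelwise finite quotients of the simplicial set `X`, as a category of simplicial sets
under `X`. -/
abbrev FinQuot (X : SSet.{u}) := ObjectProperty.FullSubcategory (C := Under X) fun Y =>
  (∀ n, Function.Surjective (Y.hom.app n)) ∧ ∀ n, Finite (Sx Y.right n)

/-- The diagram of the cochain complexes `C^*(Y; K)` of the levelwise finite quotients `Y`. -/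
def cochDiagram (K : Type) [CommRing K] (X : SSet.{u}) :
    (FinQuot X)ᵒᵖ ⥤ CochainComplex (ModuleCat.{u} K) ℤ where
  obj Y := nCochains K Y.unop.obj.right
  map f := nMap K f.unop.hom.right
  map_id _ := rfl
  map_comp _ _ := rfl

/-- The diagram of the `E`-algebras `C^*(Y; K)` of the levelwise finite quotients `Y`. -/
def algDiagram {K : Type} [CommRing K] {E : Operad.{0, w} K}
    (ζ : Operad.Hom (RingHom.id K) E (EZ.{u} K)) (X : SSet.{u}) :
    (FinQuot X)ᵒᵖ ⥤ AlgCat.{0, w, u} E where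
  obj Y := ⟨nCochains K Y.unop.obj.right, cochStr ζ _⟩
  map f := ⟨nMap K f.unop.hom.right, cochStr_natural ζ _⟩
  map_id _ := rfl
  map_comp _ _ := rfl

section Cocone

variable (k K : Type) [CommRing k] [CommRing K] [Algebra k K] (X : SSet.{u})

/-- The map `C^*(Y; K) ≅ K ⊗ C^*(Y; k) ⟶ K ⊗ C^*(X; k)` for a levelwise finite quotient `Y`. -/
def leg (Y : FinQuot X) : nCochains K Y.obj.right ⟶ extCpx K (nCochains k X) :=
  (extIso (isExt_nCoeff (k := k) Y.property.2)).inv ≫ extMap (nMap k Y.obj.hom)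

variable {X} in
lemma leg_natural {Y Y' : FinQuot X} (f : Y ⟶ Y') :
    nMap K f.hom.right ≫ leg k K X Y = leg k K X Y' := by
  have h : (extIso (isExt_nCoeff (k := k) (K := K) Y'.property.2)).hom ≫ nMap K f.hom.right =
      extMap (nMap k f.hom.right) ≫ (extIso (isExt_nCoeff (k := k) Y.property.2)).hom :=
    HomologicalComplex.hom_ext _ _ fun i => ModuleCat.hom_ext <| tensor_ext fun x => by
      refine Subtype.ext (funext fun s => ?_)
      rfl
  rw [leg, leg, Iso.eq_inv_comp, ← Category.assoc, h, Category.assoc, Iso.hom_inv_id_assoc]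
  have : Y'.obj.hom = Y.obj.hom ≫ f.hom.right := (Under.w f.hom).symm
  rw [this]
  exact HomologicalComplex.hom_ext _ _ fun i => ModuleCat.hom_ext <| tensor_ext fun x => rfl

/-- The cocone formed by the maps `leg`, in the category of complexes. -/
def cochCocone : Limits.Cocone (cochDiagram K X) where
  pt := extCpx K (nCochains k X)
  ι := { app := fun Y => leg k K X Y.unop
         naturality := fun Y Y' f => (leg_natural k K f.unop).trans (Category.comp_id _).symm }

variable {k K X}

/-- The cocone formed by the maps `leg`, in the category of algebras. -/
def algCocone {E : Operad.{0, w} K} (ζ : Operad.Hom (RingHom.id K) E (EZ.{u} K))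
    (S : AlgStr E (extCpx K (nCochains k X)))
    (hS : ∀ Y : FinQuot X, IsAlgHom (cochStr ζ _) S (leg k K X Y)) :
    Limits.Cocone (algDiagram ζ X) where
  pt := ⟨extCpx K (nCochains k X), S⟩
  ι := { app := fun Y => ⟨leg k K X Y.unop, hS Y.unop⟩
         naturality := fun Y Y' f => Subtype.ext <|
          (leg_natural k K f.unop).trans (Category.comp_id _).symm }

/-- `S` is the structure of an `E`-algebra on `K ⊗ C^*(X; k)` that is obtained by identifying
this complex with the colimit of the `E`-algebras `C^*(Y; K)` over the levelwise finite
quotients `Y` of `X`. -/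
def IsColimitStr {E : Operad.{0, w} K} (ζ : Operad.Hom (RingHom.id K) E (EZ.{u} K))
    (S : AlgStr E (extCpx K (nCochains k X))) : Prop :=
  ∃ hS : ∀ Y : FinQuot X, IsAlgHom (cochStr ζ _) S (leg k K X Y),
    Nonempty (Limits.IsColimit (algCocone ζ S hS))

end Cocone

end EInf

end

noncomputable section

namespace EInf

/-! ### Levelwise finite quotients -/

section Quotients

variable {X : SSet.{u}}

/-! The complex `K ⊗ C^*(X; k)` is the directed union of the complexes `C^*(Y; K)` over the
levelwise finite quotients `Y` of `X`, and both halves of the theorem follow from this. Only two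
properties of `k = 𝔽_p` enter: it is finite, and it is a field.

Finiteness of `k` makes the legs jointly surjective. Given a cochain `f` of degree `i` on `X` with
values in `k`, call two `n`-simplices equivalent if `f` does not separate their images under any
simplicial operator. Since `f` vanishes outside dimension `i`, only the finitely many operators into
dimension `i` matter, and each contributes one of finitely many values; so there are finitely many
classes in each dimension, and `f` is pulled back from the quotient (`FinQuot.exists_nPull`). A
general element of `K ⊗ C^*(X; k)` is a finite sum of tensors `s ⊗ f`, and finitely many finite
quotients are dominated by one, the image of `X` in their product (`FinQuot.exists_common`). Hence
every finite family of elements comes from a single `Y` (`exists_leg_eq_family`). For infinite `K`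
the argument does not apply to `C^*(X; K)` itself, whose cochains may take infinitely many values.

The field property makes each leg injective: pull-back along the surjection `X ⟶ Y` is injective,
and `K` is flat over `k` (`leg_injective`). So a cocone takes the same value on any two
representatives of an element, which gives the colimit of complexes (`cochCoconeIsColimit`).

An `n`-ary operation on a directed union is determined by its restrictions to the members, because
its `n` arguments lie in one of them. Thus at most one algebra structure makes all the legs maps of
algebras (`algStr_unique`). For the same reason, if the legs are maps of algebras, then the map of
complexes induced by a cocone of algebras is again a map of algebras, so the structure is a colimit
structure (`isColimitStr_of_isAlgHom`).

It remains to see that the legs are maps of algebras for the structure obtained by extension of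
scalars (`leg_isAlgHom`). Through the isomorphism from `E ⊗ K` to `E'` and by linearity this
concerns only the operations `1 ⊗ x` with `x` in `E`. Both sides are then `K`-multilinear in
cochains of the levelwise finite `Y`, so they may be compared on `k`-valued cochains, where the
claim is the naturality of the Eilenberg–Zilber action along `X ⟶ Y` (`leg_rel`). -/

/-- The quotient of a simplicial set by a simplicial congruence. -/
def congrQuot (r : ∀ n, Setoid (X.obj n))
    (hr : ∀ {n m} (α : n ⟶ m) {x y}, r n x y → r m (X.map α x) (X.map α y)) : SSet.{u} where
  obj n := Quotient (r n)
  map α := TypeCat.ofHom (Quotient.map (X.map α) fun _ _ h => hr α h)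
  map_id n := by
    ext x
    obtain ⟨x, rfl⟩ := Quotient.exists_rep x
    simp
  map_comp α β := by
    ext x
    obtain ⟨x, rfl⟩ := Quotient.exists_rep x
    simp

/-- The projection to the quotient by a simplicial congruence. -/
def congrProj (r : ∀ n, Setoid (X.obj n))
    (hr : ∀ {n m} (α : n ⟶ m) {x y}, r n x y → r m (X.map α x) (X.map α y)) :
    X ⟶ congrQuot r hr where
  app n := TypeCat.ofHom (Quotient.mk (r n))
  naturality _ _ _ := rfl

/-- The map out of the quotient by a simplicial congruence that is induced by a map which
identifies congruent simplices. -/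
def congrDesc (r : ∀ n, Setoid (X.obj n))
    (hr : ∀ {n m} (α : n ⟶ m) {x y}, r n x y → r m (X.map α x) (X.map α y))
    {Y : SSet.{u}} (g : X ⟶ Y) (hg : ∀ n x y, r n x y → g.app n x = g.app n y) :
    congrQuot r hr ⟶ Y where
  app n := TypeCat.ofHom (Quotient.lift (g.app n) (hg n))
  naturality n m α := by
    ext x
    obtain ⟨x, rfl⟩ := Quotient.exists_rep x
    exact congrArg (fun h => h x) (g.naturality α)

/-- The quotient by a simplicial congruence with finitely many classes in each dimension. -/
def FinQuot.ofCongr (r : ∀ n, Setoid (X.obj n))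
    (hr : ∀ {n m} (α : n ⟶ m) {x y}, r n x y → r m (X.map α x) (X.map α y))
    (hfin : ∀ n, Finite (Quotient (r n))) : FinQuot X :=
  ⟨Under.mk (congrProj r hr), fun n => Quotient.mk_surjective (s := r n), fun _ => hfin _⟩

/-! ### Directedness of the finite quotients, and factorization of cochains through them -/

/-- Finitely many levelwise finite quotients of `X` are dominated by a single one. -/
lemma FinQuot.exists_common {ι : Type} [Finite ι] (Y : ι → FinQuot X) :
    ∃ Z : FinQuot X, ∀ j, Nonempty (Z ⟶ Y j) := by
  -- The classes are the fibres of the map from `X` to the product of the `Y j`, so the quotient is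
  -- the image of `X` in that product. For an empty family all simplices of a given dimension become
  -- equal.
  let r (n) : Setoid (X.obj n) :=
    { r := fun x y => ∀ j, (Y j).obj.hom.app n x = (Y j).obj.hom.app n y
      iseqv := ⟨fun _ _ => rfl, fun h j => (h j).symm, fun h h' j => (h j).trans (h' j)⟩ }
  have hr : ∀ {n m} (α : n ⟶ m) {x y}, r n x y → r m (X.map α x) (X.map α y) :=
    fun {n m} α {x y} h j => by
      have := fun x => congrArg (fun h => h x) ((Y j).obj.hom.naturality α)
      exact (this x).trans ((congrArg ((Y j).obj.right.map α) (h j)).trans (this y).symm)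
  have hfin (n) : Finite (Quotient (r n)) := by
    have hY (j) : Finite ((Y j).obj.right.obj n) := (Y j).property.2 n.unop.len
    refine Finite.of_injective (β := ∀ j, (Y j).obj.right.obj n)
      (Quotient.lift (fun x j => (Y j).obj.hom.app n x) fun _ _ h => funext h) ?_
    rintro ⟨x⟩ ⟨y⟩ h
    exact Quotient.sound fun j => congrFun h j
  exact ⟨ofCongr r hr hfin, fun j =>
    ⟨⟨Under.homMk (congrDesc r hr (Y j).obj.hom fun n _ _ h => h j) rfl⟩⟩⟩

/-- A normalized cochain with values in a finite ring is pulled back from a levelwise finite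
quotient. -/
lemma FinQuot.exists_nPull {k : Type} [CommRing k] [Finite k] {i : ℤ} (f : nCoch k X i) :
    ∃ (Y : FinQuot X) (g : nCoch k Y.obj.right i), nPull k Y.obj.hom i g = f := by
  -- The coarsest simplicial congruence for which `f` is constant on classes: testing against all
  -- operators, not only the identity, is what makes it stable under the simplicial structure.
  let r (n) : Setoid (X.obj n) :=
    { r := fun x y => ∀ (l : ℕ) (α : n ⟶ op (SimplexCategory.mk l)),
        f.1 ⟨l, X.map α x⟩ = f.1 ⟨l, X.map α y⟩
      iseqv := ⟨fun _ _ _ => rfl, fun h l α => (h l α).symm,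
        fun h h' l α => (h l α).trans (h' l α)⟩ }
  have hr : ∀ {n m} (α : n ⟶ m) {x y}, r n x y → r m (X.map α x) (X.map α y) :=
    fun {n m} α {x y} h l β => by
      have := h l (α ≫ β)
      simpa using this
  have hfin (n) : Finite (Quotient (r n)) := by
    have : Finite (n ⟶ op (SimplexCategory.mk i.toNat)) :=
      Finite.of_equiv _ (SSet.stdSimplex.objEquiv.{u} (n := n.unop)
        (m := op (SimplexCategory.mk i.toNat))|>.trans (opEquiv _ _).symm)
    -- A class is recorded by the values of `f` at the images of a representative in dimension `i`:
    -- a function between two finite sets. This is where finiteness of `k` is needed.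
    refine Finite.of_injective (β := (n ⟶ op (SimplexCategory.mk i.toNat)) → k)
      (Quotient.lift (fun x α => f.1 ⟨i.toNat, X.map α x⟩) fun _ _ h => funext fun α => h _ α) ?_
    rintro ⟨x⟩ ⟨y⟩ h
    refine Quotient.sound fun l α => ?_
    -- Operators into another dimension `l` impose no condition, as `f` vanishes there; so the
    -- recorded values determine the class.
    by_cases hl : (l : ℤ) = i
    · obtain rfl : i.toNat = l := by omega
      exact congrFun h α
    · rw [f.2 l _ (Or.inl hl), f.2 l _ (Or.inl hl)]
  have hf (l : ℕ) (x y : Sx X l) (h : r _ x y) : f.1 ⟨l, x⟩ = f.1 ⟨l, y⟩ := by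
    simpa using h l (𝟙 _)
  refine ⟨ofCongr r hr hfin, ⟨fun s => Quotient.lift (fun x => f.1 ⟨s.1, x⟩) (hf s.1) s.2, ?_⟩,
    rfl⟩
  -- The descended function must again be normalized. If the class of `x` is degenerate in the
  -- quotient, `x` itself need not be, but it is congruent to a degenerate simplex of `X`, obtained
  -- by lifting `y`, and `f` has the same value at both.
  rintro m ⟨x⟩ (hm | ⟨l, hl, α, ⟨y⟩, h⟩)
  · exact f.2 m x (Or.inl hm)
  · exact (hf m _ _ (Quotient.exact h)).symm.trans (f.2 m _ (Or.inr ⟨l, hl, α, y, rfl⟩))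

/-- Every simplex of a quotient lifts to `X`, so a cochain on the quotient can be read off from its
pull-back. -/
lemma nPull_injective (k : Type) [CommRing k] (Y : FinQuot X) (i : ℤ) :
    Function.Injective (nPull k Y.obj.hom i) := fun f g h => Subtype.ext <| funext fun ⟨m, y⟩ => by
  obtain ⟨x, rfl⟩ := Y.property.1 _ y
  exact congrFun (congrArg Subtype.val h) ⟨m, x⟩

end Quotients

/-! ### The colimit of the cochain complexes -/

section Colimit

variable {k K : Type} [Field k] [CommRing K] [Algebra k K] {X : SSet.{u}}

/-- A leg is the inverse of the isomorphism `K ⊗ C^*(Y; k) ≅ C^*(Y; K)`, available because `Y` is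
levelwise finite, followed by `K ⊗ -` of an injective map; and `K` is flat over the field `k`. -/
lemma leg_injective (Y : FinQuot X) (i : ℤ) : Function.Injective ((leg k K X Y).f i) := by
  have h : Function.Injective ((nPull k Y.obj.hom i).baseChange K) :=
    Module.Flat.lTensor_preserves_injective_linearMap _ (nPull_injective k Y i)
  exact h.comp (LinearEquiv.injective (LinearEquiv.ofBijective _
    (isExt_nCoeff (k := k) (K := K) Y.property.2 i)).symm)

/-- This formula characterizes the leg by `K`-linearity, since the cochains with values in `k`
generate `C^*(Y; K)` over `K`. It replaces the inverse isomorphism in the definition of `leg` in all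
computations below. -/
lemma leg_nCoeff (Y : FinQuot X) (i : ℤ) (f : nCoch k Y.obj.right i) :
    (leg k K X Y).f i ((nCoeff (algebraMap k K) Y.obj.right).toFun i f) =
      (1 : K) ⊗ₜ[k] (nPull k Y.obj.hom i f) := by
  have : (LinearEquiv.ofBijective _ (isExt_nCoeff (k := k) (K := K) Y.property.2 i)).symm
      ((nCoeff (algebraMap k K) Y.obj.right).toFun i f) = (1 : K) ⊗ₜ[k] f :=
    (LinearEquiv.symm_apply_eq _).2 (one_smul K _).symm
  exact congrArg ((nPull k Y.obj.hom i).baseChange K) this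

lemma leg_map {Y Z : FinQuot X} (f : Z ⟶ Y) (i : ℤ) (x : (nCochains K Y.obj.right).X i) :
    (leg k K X Z).f i ((nMap K f.hom.right).f i x) = (leg k K X Y).f i x :=
  ConcreteCategory.congr_hom (congrArg (fun g => g.f i) (leg_natural k K f)) x

/-- The legs are jointly surjective. A pure tensor `s ⊗ f` is handled by factoring `f` through a
finite quotient, and a sum by passing to a quotient that dominates those of its two terms. -/
lemma exists_leg_eq [Finite k] (i : ℤ) (z : (extCpx K (nCochains k X)).X i) :
    ∃ (Y : FinQuot X) (x : (nCochains K Y.obj.right).X i), (leg k K X Y).f i x = z := by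
  induction z using TensorProduct.induction_on with
  | zero =>
    -- Any finite quotient will do for zero; the empty family shows that there is one.
    obtain ⟨Y, -⟩ := FinQuot.exists_common (ι := Empty) (X := X) (fun j => j.elim)
    exact ⟨Y, 0, map_zero _⟩
  | tmul s f =>
    obtain ⟨Y, g, rfl⟩ := FinQuot.exists_nPull f
    refine ⟨Y, s • (nCoeff (algebraMap k K) Y.obj.right).toFun i g, ?_⟩
    rw [map_smul, leg_nCoeff]
    refine (TensorProduct.smul_tmul' s (1 : K) _).trans ?_
    rw [smul_eq_mul, mul_one]
    rfl
  | add z z' hz hz' =>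
    obtain ⟨Y, x, hx⟩ := hz
    obtain ⟨Y', x', hx'⟩ := hz'
    -- The two quotients are indexed by `Bool`; both representatives are then pulled back to `Z` and
    -- added there.
    obtain ⟨Z, hZ⟩ := FinQuot.exists_common (fun b : Bool => cond b Y Y')
    obtain ⟨f⟩ := hZ true
    obtain ⟨f'⟩ := hZ false
    refine ⟨Z, (nMap K f.hom.right).f i x + (nMap K f'.hom.right).f i x', ?_⟩
    rw [map_add]
    exact congrArg₂ (· + ·) ((leg_map f i x).trans hx) ((leg_map f' i x').trans hx')

/-- Finitely many elements of `K ⊗ C^*(X; k)` come from a single levelwise finite quotient. -/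
lemma exists_leg_eq_family [Finite k] {n : ℕ} (p : Fin n → ℤ)
    (z : ∀ j, (extCpx K (nCochains k X)).X (p j)) :
    ∃ (Y : FinQuot X) (x : ∀ j, (nCochains K Y.obj.right).X (p j)),
      ∀ j, (leg k K X Y).f (p j) (x j) = z j := by
  choose Y x hx using fun j => exists_leg_eq (p j) (z j)
  obtain ⟨Z, hZ⟩ := FinQuot.exists_common Y
  exact ⟨Z, fun j => (nMap K (hZ j).some.hom.right).f (p j) (x j),
    fun j => (leg_map _ _ _).trans (hx j)⟩

/-- On a common dominating quotient `Z` the pull-backs of `x` and `x'` have the same image under the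
leg of `Z`, which is injective, so they are equal; and the cocone factors through the pull-back to
`Z`. No uniqueness of the maps `Z ⟶ Y` and `Z ⟶ Y'` is needed. -/
lemma cocone_app_eq (s : Limits.Cocone (cochDiagram K X)) {Y Y' : FinQuot X} (i : ℤ)
    (x : (nCochains K Y.obj.right).X i) (x' : (nCochains K Y'.obj.right).X i)
    (h : (leg k K X Y).f i x = (leg k K X Y').f i x') :
    (s.ι.app (op Y)).f i x = (s.ι.app (op Y')).f i x' := by
  obtain ⟨Z, hZ⟩ := FinQuot.exists_common (fun b : Bool => cond b Y Y')
  obtain ⟨f⟩ := hZ true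
  obtain ⟨f'⟩ := hZ false
  have hs {W : FinQuot X} (g : Z ⟶ W) (y : (nCochains K W.obj.right).X i) :
      (s.ι.app (op Z)).f i ((nMap K g.hom.right).f i y) = (s.ι.app (op W)).f i y :=
    ConcreteCategory.congr_hom (congrArg (fun g => g.f i) (s.w g.op)) y
  have e : (nMap K f.hom.right).f i x = (nMap K f'.hom.right).f i x' :=
    leg_injective (k := k) Z i ((leg_map f i x).trans (h.trans (leg_map f' i x').symm))
  exact (hs f x).symm.trans ((congrArg _ e).trans (hs f' x'))

/-! ### Descent of cocones of complexes -/

variable [Finite k]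

/-- The map out of `K ⊗ C^*(X; k)` given by a cocone, in degree `i`. -/
def cochDescFun (s : Limits.Cocone (cochDiagram K X)) (i : ℤ)
    (z : (extCpx K (nCochains k X)).X i) : s.pt.X i :=
  (s.ι.app (op (exists_leg_eq i z).choose)).f i (exists_leg_eq i z).choose_spec.choose

/-- Independence of the choices in `cochDescFun`: the chosen representative and `x` have the same
image in `K ⊗ C^*(X; k)`, so the cocone agrees on them. All further properties of the induced map
are deduced from this formula. -/
lemma cochDescFun_leg (s : Limits.Cocone (cochDiagram K X)) (i : ℤ) (Y : FinQuot X)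
    (x : (nCochains K Y.obj.right).X i) :
    cochDescFun s i ((leg k K X Y).f i x) = (s.ι.app (op Y)).f i x :=
  cocone_app_eq (k := k) s i _ _ (exists_leg_eq i _).choose_spec.choose_spec

/-- The map of complexes out of `K ⊗ C^*(X; k)` given by a cocone. -/
def cochDesc (s : Limits.Cocone (cochDiagram K X)) : extCpx K (nCochains k X) ⟶ s.pt where
  f i := ModuleCat.ofHom
    { toFun := cochDescFun s i
      map_add' := fun z z' => by
        -- Additivity requires both summands on the same quotient, where it is the additivity of the
        -- leg and of the cocone map.
        obtain ⟨Y, x, hx⟩ := exists_leg_eq_family (fun _ : Fin 2 => i) ![z, z']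
        obtain rfl : _ = z := hx 0
        obtain rfl : _ = z' := hx 1
        rw [cochDescFun_leg, cochDescFun_leg]
        exact (congrArg (cochDescFun s i) (map_add ((leg k K X Y).f i).hom (x 0) (x 1)).symm).trans
          ((cochDescFun_leg s i Y _).trans (map_add ((s.ι.app (op Y)).f i).hom (x 0) (x 1)))
      map_smul' := fun c z => by
        obtain ⟨Y, x, rfl⟩ := exists_leg_eq i z
        rw [cochDescFun_leg]
        exact (congrArg (cochDescFun s i) (map_smul ((leg k K X Y).f i).hom c x).symm).trans
          ((cochDescFun_leg s i Y _).trans (map_smul ((s.ι.app (op Y)).f i).hom c x)) }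
  comm' i j _ := ModuleCat.hom_ext <| LinearMap.ext fun z => by
    -- With a representative on `Y` chosen, compatibility with the differentials follows from that
    -- of the leg and of the cocone map on `Y`.
    obtain ⟨Y, x, rfl⟩ := exists_leg_eq i z
    have h1 := ConcreteCategory.congr_hom ((leg k K X Y).comm i j) x
    have h2 := ConcreteCategory.congr_hom ((s.ι.app (op Y)).comm i j) x
    change s.pt.d i j (cochDescFun s i _) =
      cochDescFun s j ((extCpx K (nCochains k X)).d i j ((leg k K X Y).f i x))
    rw [cochDescFun_leg]
    exact h2.trans ((cochDescFun_leg s j Y _).symm.trans (congrArg (cochDescFun s j) h1.symm))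

variable (k K X) in
/-- The complex `K ⊗ C^*(X; k)` is the colimit of the complexes `C^*(Y; K)` over the levelwise
finite quotients `Y` of `X`. -/
def cochCoconeIsColimit : Limits.IsColimit (cochCocone k K X) where
  desc s := cochDesc s
  fac s Y := HomologicalComplex.hom_ext _ _ fun i => ModuleCat.hom_ext <| LinearMap.ext fun x =>
    cochDescFun_leg s i Y.unop x
  uniq s m hm := HomologicalComplex.hom_ext _ _ fun i => ModuleCat.hom_ext <| LinearMap.ext
    fun (z : (extCpx K (nCochains k X)).X i) => by
      -- Uniqueness is joint surjectivity of the legs: every `z` lies in the image of one of them,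
      -- where the map is prescribed.
      obtain ⟨Y, x, rfl⟩ := exists_leg_eq i z
      exact (ConcreteCategory.congr_hom (congrArg (fun g => g.f i) (hm (op Y))) x).trans
        (cochDescFun_leg (k := k) s i Y x).symm

end Colimit

/-! ### The algebra structures -/

section Algebras

variable {k K : Type} [Field k] [CommRing K] [Algebra k K] {X : SSet.{u}}

/-- Operations on the cochains of `X` are determined by their pull-backs to simplices, and on `Δ[m]`
the extended operation was defined by compatibility with the change of coefficients. No finiteness
of `X` is required, although `C^*(X; K)` need not be an extension of scalars of `C^*(X; k)`. -/
lemma zOp_nCoeff {n : ℕ} {d : ℤ} (θ : zDeg.{u} k n d) :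
    Rel (nCoeff (algebraMap k K) X) (zOp X θ) (zOp X (zExt (K := K) n d θ)) := fun a =>
  classify_ext fun m x => by
    have h (z : Tot (nCochains k X)) : (classify K x).tot ((nCoeff (algebraMap k K) X).tot z) =
        (nCoeff (algebraMap k K) _).tot ((classify k x).tot z) := evalAt_ext fun _ _ _ => rfl
    rw [h, zOp_rel θ x a, zOp_rel (zExt n d θ) x]
    simp only [h]
    exact opExt_rel (isExt_simplex k K m) (θ.1 m) _

/-- The form of `leg_nCoeff` on direct sums over all degrees, as needed to compare operations. -/
lemma leg_tot_nCoeff (Y : FinQuot X) (z : Tot (nCochains k Y.obj.right)) :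
    (SemiMap.ofHom (leg k K X Y)).tot ((nCoeff (algebraMap k K) Y.obj.right).tot z) =
      (extIncl K (nCochains k X)).tot ((SemiMap.ofHom (nMap k Y.obj.hom)).tot z) :=
  DFinsupp.ext fun i => leg_nCoeff Y i (z i)

/-- The heart of the comparison of the two structures. Both composites are `K`-multilinear maps on
the cochains of the levelwise finite `Y`, so it suffices that they agree on cochains with values in
`k`. There the operation extended to `K` is the original one, the leg is the pull-back to `X`
followed by `x ↦ 1 ⊗ x`, the original operation commutes with the pull-back, and the extension to `K
⊗ C^*(X; k)` is compatible with `x ↦ 1 ⊗ x` by construction. -/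
lemma leg_rel (Y : FinQuot X) {n : ℕ} {d : ℤ} (θ : zDeg.{u} k n d) :
    Rel (SemiMap.ofHom (leg k K X Y)) (zOp Y.obj.right (zExt n d θ))
      (opExt (isExt_extIncl K (nCochains k X)) ⟨zOp X θ, zOp_mem θ⟩).1 := by
  -- `SemiMap.tot` is only an additive map; its `K`-linear form is needed to compose it with
  -- multilinear maps.
  let g : Tot (nCochains K Y.obj.right) →ₗ[K] Tot (extCpx K (nCochains k X)) :=
    { (SemiMap.ofHom (leg k K X Y)).tot with map_smul' := SemiMap.tot_smul _ }
  have : g.compMultilinearMap (zOp Y.obj.right (zExt n d θ)) =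
      (opExt (isExt_extIncl K (nCochains k X)) ⟨zOp X θ, zOp_mem θ⟩).1.compLinearMap fun _ => g :=
    -- This is the point at which finiteness of `Y` enters: `K`-multilinear maps on its cochains are
    -- determined by their values on `k`-valued ones.
    ext_unique (isExt_nCoeff (k := k) Y.property.2) fun a => by
      change (SemiMap.ofHom (leg k K X Y)).tot _ =
        (opExt (isExt_extIncl K (nCochains k X)) ⟨zOp X θ, zOp_mem θ⟩).1 fun i =>
          (SemiMap.ofHom (leg k K X Y)).tot _
      -- On the left the operation is moved past the coefficient map, then the leg becomes a
      -- pull-back, then naturality moves the operation from `Y` to `X`; the arguments on the right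
      -- are rewritten in the same way.
      rw [← zOp_nCoeff θ a, leg_tot_nCoeff, zOp_natural Y.obj.hom θ a]
      simp only [leg_tot_nCoeff]
      exact opExt_rel (isExt_extIncl K (nCochains k X)) ⟨zOp X θ, zOp_mem θ⟩ _
  exact fun a => congrArg (fun F => F a) this

/-! ### Compatibility of the legs with extension of scalars of algebras -/

variable {E : Operad.{0, w} k} (ζ : Operad.Hom (RingHom.id k) E (EZ.{u} k))
  {E' : Operad.{0, w'} K} (ζ' : Operad.Hom (RingHom.id K) E' (EZ.{u} K))

/-- Maps of algebras over `E ⊗ K` are checked on the operations that come from `E`. -/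
lemma isAlgHom_baseChange {E : Operad.{0, w} k} {A B : CochainComplex (ModuleCat.{u} K) ℤ}
    {s : AlgStr (E.baseChange K) A} {t : AlgStr (E.baseChange K) B} {f : A ⟶ B}
    (h : ∀ (n : ℕ) (d : ℤ) (x : (E.obj n).X d), Rel (SemiMap.ofHom f)
      (s.toFun n d ((1 : K) ⊗ₜ[k] x)).1 (t.toFun n d ((1 : K) ⊗ₜ[k] x)).1) : IsAlgHom s t f := by
  intro n d x
  change Rel _ (s.toFun n d x).1 (t.toFun n d x).1
  -- The elements of `E(n) ⊗ K` whose operations are intertwined by `f` form a `K`-submodule, and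
  -- the tensors `1 ⊗ x` generate everything.
  induction x using TensorProduct.induction_on with
  | zero =>
    have hs := congrArg (Subtype.val (p := (· ∈ opDeg A n d))) (map_zero (s.toFun n d))
    have ht := congrArg (Subtype.val (p := (· ∈ opDeg B n d))) (map_zero (t.toFun n d))
    exact hs ▸ ht ▸ rel_zero
  | tmul c x =>
    have e : c ⊗ₜ[k] x = c • ((1 : K) ⊗ₜ[k] x) := by simp [TensorProduct.smul_tmul']
    have hs := congrArg (Subtype.val (p := (· ∈ opDeg A n d))) (s.map_smul n d c (1 ⊗ₜ x))
    have ht := congrArg (Subtype.val (p := (· ∈ opDeg B n d))) (t.map_smul n d c (1 ⊗ₜ x))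
    rw [e]
    exact hs ▸ ht ▸ rel_smul c (h n d x)
  | add x y hx hy =>
    have hs := congrArg (Subtype.val (p := (· ∈ opDeg A n d))) (map_add (s.toFun n d) x y)
    have ht := congrArg (Subtype.val (p := (· ∈ opDeg B n d))) (map_add (t.toFun n d) x y)
    exact hs ▸ ht ▸ rel_add hx hy

/-- The maps `leg` are maps of algebras for the structure obtained by extension of scalars. -/
lemma leg_isAlgHom (φ : Operad.Hom (RingHom.id K) (E.baseChange K) E')
    (hφ : ∀ n d, Function.Bijective (φ.toFun n d))
    (hζ : ζ'.comp φ (RingHom.comp_id _) = ((ezExt k K).comp ζ (RingHom.comp_id _)).extend)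
    (Y : FinQuot X) :
    IsAlgHom (cochStr ζ' _) ((cochStr ζ X).extendScalars φ hφ) (leg k K X Y) := by
  intro n d x
  -- Writing the operation as the image of `y` in `E ⊗ K` turns both structures into structures over
  -- `E ⊗ K`: on the cochains of `Y` by the compatibility `hζ`, and on `K ⊗ C^*(X; k)` because the
  -- inverse of `φ` cancels.
  obtain ⟨y, rfl⟩ := (hφ n d).2 x
  have e1 : ζ'.toFun n d (φ.toFun n d y) =
      (((ezExt k K).comp ζ (RingHom.comp_id _)).extend).toFun n d y :=
    congrArg (fun f => f.toFun n d y) hζ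
  have e2 : (φ.inv hφ).toFun n d (φ.toFun n d y) = y :=
    (AddEquiv.ofBijective (φ.toFun n d) (hφ n d)).symm_apply_apply y
  change Rel _ (zOp Y.obj.right (ζ'.toFun n d (φ.toFun n d y)))
    (AlgStr.op ((cochStr ζ X).baseChange K) ((φ.inv hφ).toFun n d (φ.toFun n d y)))
  rw [e1, e2]
  refine isAlgHom_baseChange (s := (ezAct K Y.obj.right).comp
    ((ezExt k K).comp ζ (RingHom.comp_id _)).extend (RingHom.comp_id _))
    (t := (cochStr ζ X).baseChange K) (fun n d x => ?_) n d y
  -- On `1 ⊗ x` an extended morphism of operads takes the value `1 • f x`, which explains the proofs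
  -- by `one_smul` of this identity and of the next.
  have h1 : (((ezExt k K).comp ζ (RingHom.comp_id _)).extend).toFun n d ((1 : K) ⊗ₜ[k] x) =
      zExt n d (ζ.toFun n d x) := one_smul K _
  have h2 : ((cochStr ζ X).baseChange K).toFun n d ((1 : K) ⊗ₜ[k] x) =
      opExt (isExt_extIncl K (nCochains k X)) ⟨zOp X (ζ.toFun n d x), zOp_mem _⟩ := one_smul K _
  rw [h2]
  change Rel _ (zOp Y.obj.right ((((ezExt k K).comp ζ (RingHom.comp_id _)).extend).toFun n d
    ((1 : K) ⊗ₜ[k] x))) _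
  rw [h1]
  exact leg_rel Y _

/-! ### Uniqueness and universal property of the algebra structure -/

variable {ζ'}

/-- The maps `leg` determine the algebra structure. -/
lemma algStr_unique [Finite k] {S S' : AlgStr E' (extCpx K (nCochains k X))}
    (hS : ∀ Y : FinQuot X, IsAlgHom (cochStr ζ' _) S (leg k K X Y))
    (hS' : ∀ Y : FinQuot X, IsAlgHom (cochStr ζ' _) S' (leg k K X Y)) : S = S' := by
  refine Operad.Hom.ext (funext fun n => funext fun d => AddMonoidHom.ext fun x =>
    Subtype.ext (op_ext fun p a ha => ?_))
  choose z hz using ha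
  -- All `n` homogeneous arguments are lifted to one quotient `Y`. There both structures are forced
  -- to give the image under the leg of the value of the operation on the cochains of `Y`.
  obtain ⟨Y, y, hy⟩ := exists_leg_eq_family p z
  obtain rfl : (fun j => (SemiMap.ofHom (leg k K X Y)).tot
      (lof K ℤ (fun i => (nCochains K Y.obj.right).X i) (p j) (y j))) = a := funext fun j => by
    rw [SemiMap.tot_lof, ← hz j, ← hy j]; rfl
  exact (hS Y n d x _).symm.trans (hS' Y n d x _)

/-- A structure for which the maps `leg` are maps of algebras is a colimit structure. -/
lemma isColimitStr_of_isAlgHom [Finite k] {S : AlgStr E' (extCpx K (nCochains k X))}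
    (hS : ∀ Y : FinQuot X, IsAlgHom (cochStr ζ' _) S (leg k K X Y)) : IsColimitStr ζ' S := by
  -- The forgetful functor carries the diagram of algebras to the diagram of complexes by
  -- definition, so a cocone of algebras yields a map `D s` of complexes; what has to be shown is
  -- that `D s` respects the operations.
  let U : AlgCat.{0, w', u} E' ⥤ CochainComplex (ModuleCat.{u} K) ℤ :=
    { obj := fun A => A.cpx, map := fun f => f.1, map_id := fun _ => rfl, map_comp := fun _ _ => rfl }
  let D (s : Limits.Cocone (algDiagram ζ' X)) : extCpx K (nCochains k X) ⟶ s.pt.cpx :=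
    (cochCoconeIsColimit k K X).desc (U.mapCocone s)
  have fac (s : Limits.Cocone (algDiagram ζ' X)) (Y : FinQuot X) :
      leg k K X Y ≫ D s = (s.ι.app (op Y)).1 :=
    (cochCoconeIsColimit k K X).fac (U.mapCocone s) (op Y)
  have hD (s : Limits.Cocone (algDiagram ζ' X)) : IsAlgHom S s.pt.str (D s) := fun n d x =>
    rel_of_homog fun p a ha => by
      choose z hz using ha
      -- Again all arguments come from one `Y`. There `D s` composed with the leg is a component of
      -- the cocone, hence a map of algebras, and the leg is one by hypothesis.
      obtain ⟨Y, y, hy⟩ := exists_leg_eq_family p z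
      obtain rfl : (fun j => (SemiMap.ofHom (leg k K X Y)).tot
          (lof K ℤ (fun i => (nCochains K Y.obj.right).X i) (p j) (y j))) = a :=
        funext fun j => by
          rw [SemiMap.tot_lof, ← hz j, ← hy j]; rfl
      have hf (b : Tot (nCochains K Y.obj.right)) :
          (SemiMap.ofHom (D s)).tot ((SemiMap.ofHom (leg k K X Y)).tot b) =
            (SemiMap.ofHom (s.ι.app (op Y)).1).tot b := by
        rw [← SemiMap.ofHom_comp_tot, fac]; rfl
      rw [← hS Y n d x, hf]
      simp only [hf]
      exact (s.ι.app (op Y)).2 n d x _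
  exact ⟨hS, ⟨{
    desc := fun s => ⟨D s, hD s⟩
    fac := fun s Y => Subtype.ext (fac s Y.unop)
    -- A map of algebras is determined by its map of complexes, so uniqueness is inherited from the
    -- colimit of complexes.
    uniq := fun s m hm => Subtype.ext ((cochCoconeIsColimit k K X).uniq (U.mapCocone s) m.1
      fun Y => congrArg Subtype.val (hm Y)) }⟩⟩

end Algebras

end EInf

end

/-! ### The theorem -/

theorem mainTheorem4 (p : ℕ) [Fact p.Prime] (K : Type) [Field K] [Algebra (ZMod p) K]
    [IsAlgClosure (ZMod p) K]
    (E : EInf.Operad.{0, w} (ZMod p)) (hE : E.IsEInfinity)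
    (ζ : EInf.Operad.Hom (RingHom.id (ZMod p)) E (EInf.EZ.{u} (ZMod p)))
    (E' : EInf.Operad.{0, w'} K) (hE' : E'.IsEInfinity)
    (ζ' : EInf.Operad.Hom (RingHom.id K) E' (EInf.EZ.{u} K))
    (φ : EInf.Operad.Hom (RingHom.id K) (E.baseChange K) E')
    (hφ : ∀ n d, Function.Bijective (φ.toFun n d))
    (hζ : ζ'.comp φ (RingHom.comp_id _) =
      ((EInf.ezExt (ZMod p) K).comp ζ (RingHom.comp_id _)).extend)
    (X : SSet.{u}) :
    Nonempty (CategoryTheory.Limits.IsColimit (EInf.cochCocone (ZMod p) K X)) ∧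
      ∀ S : EInf.AlgStr E' (EInf.extCpx K (EInf.nCochains (ZMod p) X)),
        EInf.IsColimitStr ζ' S ↔ S = (EInf.cochStr ζ X).extendScalars φ hφ := by
  have h := EInf.leg_isAlgHom (X := X) ζ ζ' φ hφ hζ
  -- The legs are maps of algebras for a colimit structure by definition and for the extended
  -- structure by `h`. In one direction the two structures therefore coincide by uniqueness; in the
  -- other, `h` already suffices for the universal property.
  refine ⟨⟨EInf.cochCoconeIsColimit (ZMod p) K X⟩, fun S => ⟨fun hS => ?_, ?_⟩⟩
  · obtain ⟨hS, -⟩ := hS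
    exact EInf.algStr_unique hS h
  · rintro rfl
    exact EInf.isColimitStr_of_isAlgHom h
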